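/- **Definitions.** Let $\Sigma$ be an alphabet (a finite non-empty set) and let $w\ge 1$. A *$(\Sigma,w)$-layer* is a tuple $B=(\ell,r,T,I,F,\iota,\phi)$ with $\ell,r\subseteq\{0,\dots,w-1\}$ (left and right states), $T\subseteq \ell\times\Sigma\times r$ (transitions), $I\subseteq \ell$ (initial states), $F\subseteq r$ (final states), and flags $\iota,\phi\in\{0,1\}$ such that $I=\emptyset$ if $\iota=0$, and $F=\emptyset$ if $\phi=0$. The layer is *deterministic* if ($\iota=1$ implies $I=\ell$ and $|\ell|=1$) and for all $p\in \ell$, $a\in\Sigma$ there is at most one $q\in r$ with $(p,a,q)\in T$; it is *complete* if ($\iota=1$ implies $I\ne\emptyset$) and for all $p\in \ell$, $a\in\Sigma$ there is at least one $q\in r$ with $(p,a,q)\in T$. An *ODD* of length $k\ge1$ is a sequence $B_1\cdots B_k$ of $(\Sigma,w)$-layers such that $\ell(B_{i+1})=r(B_i)$ for $1\le i<k$, exactly $B_1$ has $\iota=1$, and exactly $B_k$ has $\phi=1$. It computes the function $f:\Sigma^k\to\{0,1\}$ with $f(s_1\cdots s_k)=1$ if and only if there are transitions $(p_i,s_i,q_i)\in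 T(B_i)$, $1\le i\le k$, with $p_{i+1}=q_i$ for $1\le i<k$, $p_1\in I(B_1)$ and $q_k\in F(B_k)$. For a set $S$ of $(\Sigma,w)$-layers, let $N_S(k)$ be the number of functions $f:\Sigma^k\to\{0,1\}$ computed by some ODD of length $k$ all of whose layers are in $S$. Time is measured on a random access machine with logarithmic cost (each operation is charged one plus the number of bits of its operands). The input consists of the numbers $|\Sigma|$, $w$, $k$ in binary, and of a list without repetitions of the layers in $S$, each described by the characteristic bits of its components with respect to some numbering of $\Sigma$. **Statement.** 1. There are an algorithm and a constant $c$ such that for all alphabets $\Sigma$, all $w\ge1$, all sets $S$ of $(\Sigma,w)$-layers and all $k\ge1$, the algorithm computes $N_S(k)$ in time at most $2^{2^{c\cdot|\Sigma|\cdot w\cdot 2^w}}\cdot k^2$. 2. There are an algorithm and a constant $c$ such that for all alphabets $\Sigma$, all $w\ge1$, all sets $S$ of deterministic, complete $(\Sigma,w)$-layers and all $k\ge1$, the algorithm computes $N_S(k)$ in time at most $2^{2^{c\cdot|\Sigma|\cdot w\cdot\lfloor\log_2(w+1)\rfloor}}\cdot k^2$. 3. In particular, for every fixed alphabet $\Sigma$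 and $w\ge1$, the number of functions $\Sigma^k\to\{0,1\}$ computed by some ODD of length $k$ with $(\Sigma,w)$-layers, and the number of those computed by some such ODD all of whose layers are deterministic and complete (for $\Sigma=\{0,1\}$: by OBDDs of width at most $w$ with a fixed variable order), can each be computed from $k\ge 1$ in time $O(k^2)$, where the hidden constant depends only on $\Sigma$ and $w$. -/

import Mathlib

universe u

/-! ## Layers and ordered decision diagrams (ODDs) -/

/-- A `(A, w)`-layer: left and right states in `{0, …, w-1}`, transitions labelled by symbols of the
alphabet `A`, initial (left) and final (right) states, and two Boolean flags; there are no initial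
(final) states when the initial (final) flag is off. -/
@[ext]
structure Layer (A : Type*) (w : ℕ) where
  leftStates : Set (Fin w)
  rightStates : Set (Fin w)
  transitions : Set (Fin w × A × Fin w)
  initialStates : Set (Fin w)
  finalStates : Set (Fin w)
  initialFlag : Bool
  finalFlag : Bool
  transitions_subset : ∀ p a q, (p, a, q) ∈ transitions → p ∈ leftStates ∧ q ∈ rightStates
  initialStates_subset : initialStates ⊆ leftStates
  finalStates_subset : finalStates ⊆ rightStates
  initialStates_eq_empty : initialFlag = false → initialStates = ∅
  finalStates_eq_empty : finalFlag = false → finalStates = ∅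

namespace Layer

variable {A : Type*} {w : ℕ}

/-- Deterministic layers. -/
def Deterministic (B : Layer A w) : Prop :=
  (B.initialFlag = true → B.initialStates = B.leftStates ∧ B.leftStates.ncard = 1) ∧
  ∀ p ∈ B.leftStates, ∀ a : A, ∀ q ∈ B.rightStates, ∀ q' ∈ B.rightStates,
    (p, a, q) ∈ B.transitions → (p, a, q') ∈ B.transitions → q = q'

/-- Complete layers. -/
def Complete (B : Layer A w) : Prop :=
  (B.initialFlag = true → B.initialStates.Nonempty) ∧
  ∀ p ∈ B.leftStates, ∀ a : A, ∃ q ∈ B.rightStates, (p, a, q) ∈ B.transitions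

end Layer

/-- `D = D₀ ⋯ D_{k-1}` is a `(A, w)`-ODD of length `k` (which is positive): consecutive frontiers
agree, exactly the first layer has its initial flag on, and exactly the last layer has its final
flag on. -/
def IsODD {A : Type*} {w k : ℕ} (D : Fin k → Layer A w) : Prop :=
  0 < k ∧
  (∀ i j : Fin k, (j : ℕ) = i + 1 → (D j).leftStates = (D i).rightStates) ∧
  (∀ i : Fin k, (D i).initialFlag = true ↔ (i : ℕ) = 0) ∧
  (∀ i : Fin k, (D i).finalFlag = true ↔ (i : ℕ) + 1 = k)

/-- The string `s` of length `k` has an accepting sequence of transitions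
`(p₀, s₀, q₀), …, (p_{k-1}, s_{k-1}, q_{k-1})` in `D`. -/
def ODDAccepts {A : Type*} {w k : ℕ} (D : Fin k → Layer A w) (s : Fin k → A) : Prop :=
  ∃ p q : Fin k → Fin w,
    (∀ i, (p i, s i, q i) ∈ (D i).transitions) ∧
    (∀ i j : Fin k, (j : ℕ) = i + 1 → p j = q i) ∧
    (∀ i : Fin k, (i : ℕ) = 0 → p i ∈ (D i).initialStates) ∧
    (∀ i : Fin k, (i : ℕ) + 1 = k → q i ∈ (D i).finalStates)

/-- The functions `A^k → {0, 1}` computed by the ODDs of length `k` all of whose layers are in `S`. -/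
def computableFunctions {A : Type*} {w : ℕ} (S : Set (Layer A w)) (k : ℕ) :
    Set ((Fin k → A) → Bool) :=
  {f | ∃ D : Fin k → Layer A w, IsODD D ∧ (∀ i, D i ∈ S) ∧
    ∀ s, f s = true ↔ ODDAccepts D s}

/-! ## Random access machines with logarithmic cost

A state consists of registers, which a program addresses by fixed names, and of a memory, which it
addresses through the content of a register. Registers and memory cells hold natural numbers of
arbitrary size; every operation is charged the total number of bits of its operands (memory
addresses included), plus one. -/

structure RAMState where
  reg : ℕ → ℕ
  mem : ℕ → ℕ

/-- Writing a value to a register. -/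
def RAMState.setReg (s : RAMState) (i v : ℕ) : RAMState :=
  { s with reg := Function.update s.reg i v }

/-- Writing a value to a memory cell. -/
def RAMState.setMem (s : RAMState) (a v : ℕ) : RAMState :=
  { s with mem := Function.update s.mem a v }

/-- Programs of the random access machine. -/
inductive RAMProgram where
  /-- `rᵢ := c` -/
  | const (i c : ℕ)
  /-- `rᵢ := rⱼ` -/
  | copy (i j : ℕ)
  /-- `rᵢ := rⱼ + rₗ` -/
  | add (i j l : ℕ)
  /-- `rᵢ := max (rⱼ - rₗ) 0` -/
  | sub (i j l : ℕ)
  /-- `rᵢ := ⌊rⱼ / 2⌋` -/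
  | half (i j : ℕ)
  /-- `rᵢ := mem[rⱼ]` -/
  | load (i j : ℕ)
  /-- `mem[rᵢ] := rⱼ` -/
  | store (i j : ℕ)
  /-- run `P`, then `Q` -/
  | seq (P Q : RAMProgram)
  /-- if `rᵢ ≠ 0` then run `P`, else run `Q` -/
  | cond (i : ℕ) (P Q : RAMProgram)
  /-- while `rᵢ ≠ 0`, run `P` -/
  | loop (i : ℕ) (P : RAMProgram)

/-- `RAMRuns P s t s'`: started in state `s`, the program `P` halts in state `s'`, and the execution
takes time exactly `t`. Here `Nat.size x` is the number of binary digits of `x`. -/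
inductive RAMRuns : RAMProgram → RAMState → ℕ → RAMState → Prop
  | const (i c : ℕ) (s : RAMState) :
      RAMRuns (.const i c) s (1 + c.size) (s.setReg i c)
  | copy (i j : ℕ) (s : RAMState) :
      RAMRuns (.copy i j) s (1 + (s.reg j).size) (s.setReg i (s.reg j))
  | add (i j l : ℕ) (s : RAMState) :
      RAMRuns (.add i j l) s (1 + (s.reg j).size + (s.reg l).size)
        (s.setReg i (s.reg j + s.reg l))
  | sub (i j l : ℕ) (s : RAMState) :
      RAMRuns (.sub i j l) s (1 + (s.reg j).size + (s.reg l).size)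
        (s.setReg i (s.reg j - s.reg l))
  | half (i j : ℕ) (s : RAMState) :
      RAMRuns (.half i j) s (1 + (s.reg j).size) (s.setReg i (s.reg j / 2))
  | load (i j : ℕ) (s : RAMState) :
      RAMRuns (.load i j) s (1 + (s.reg j).size + (s.mem (s.reg j)).size)
        (s.setReg i (s.mem (s.reg j)))
  | store (i j : ℕ) (s : RAMState) :
      RAMRuns (.store i j) s (1 + (s.reg i).size + (s.reg j).size)
        (s.setMem (s.reg i) (s.reg j))
  | seq (P Q : RAMProgram) (s s' s'' : RAMState) (t t' : ℕ) :
      RAMRuns P s t s' → RAMRuns Q s' t' s'' → RAMRuns (.seq P Q) s (t + t') s''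
  | cond_true (i : ℕ) (P Q : RAMProgram) (s s' : RAMState) (t : ℕ) :
      s.reg i ≠ 0 → RAMRuns P s t s' → RAMRuns (.cond i P Q) s (1 + (s.reg i).size + t) s'
  | cond_false (i : ℕ) (P Q : RAMProgram) (s s' : RAMState) (t : ℕ) :
      s.reg i = 0 → RAMRuns Q s t s' → RAMRuns (.cond i P Q) s (1 + t) s'
  | loop_true (i : ℕ) (P : RAMProgram) (s s' s'' : RAMState) (t t' : ℕ) :
      s.reg i ≠ 0 → RAMRuns P s t s' → RAMRuns (.loop i P) s' t' s'' →
      RAMRuns (.loop i P) s (1 + (s.reg i).size + t + t') s''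
  | loop_false (i : ℕ) (P : RAMProgram) (s : RAMState) :
      s.reg i = 0 → RAMRuns (.loop i P) s 1 s

/-- Started in state `s`, the program `P` halts after time at most `T` with the number `v` in
register `0`. -/
def RAMOutputsWithin (P : RAMProgram) (s : RAMState) (v T : ℕ) : Prop :=
  ∃ t s', RAMRuns P s t s' ∧ t ≤ T ∧ s'.reg 0 = v

/-! ## Inputs -/

open Classical in
/-- The bit that tells whether a proposition holds. -/
noncomputable def propBit (p : Prop) : ℕ := if p then 1 else 0

/-- The bits that describe a layer, the symbols of the alphabet being numbered by `e`: the two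
flags, the characteristic sequences of the left, right, initial and final states, and the
characteristic sequence of the transitions in lexicographic order; `2 + 4w + w²n` bits in all. -/
noncomputable def Layer.encode {A : Type*} {w n : ℕ} (e : A ≃ Fin n) (B : Layer A w) : List ℕ :=
  [propBit (B.initialFlag = true), propBit (B.finalFlag = true)] ++
  (List.finRange w).map (fun q => propBit (q ∈ B.leftStates)) ++
  (List.finRange w).map (fun q => propBit (q ∈ B.rightStates)) ++
  (List.finRange w).map (fun q => propBit (q ∈ B.initialStates)) ++
  (List.finRange w).map (fun q => propBit (q ∈ B.finalStates)) ++
  (List.finRange w).flatMap fun p => (List.finRange n).flatMap fun a =>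
    (List.finRange w).map fun q => propBit ((p, e.symm a, q) ∈ B.transitions)

/-- The initial state for the input consisting of the numbers `n` (the size of the alphabet), `w`
and `k`, in binary, and of a list of layers: registers `0, 1, 2, 3` hold `n`, `w`, `k` and the
length of the list, the memory holds the bits of the layers one after the other, one bit per cell,
and everything else is `0`. -/
noncomputable def countingInput {A : Type*} {w n : ℕ} (e : A ≃ Fin n) (Ls : List (Layer A w))
    (k : ℕ) : RAMState where
  reg i := [n, w, k, Ls.length].getD i 0
  mem a := (Ls.flatMap (Layer.encode e)).getD a 0

/-- The initial state for the input consisting of the number `k` alone, held by register `0`. -/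
def numberInput (k : ℕ) : RAMState where
  reg i := if i = 0 then k else 0
  mem _ := 0

/-!
Let the layers be deterministic and numbered, so that an ODD is a sequence of numbers. In every set
of sequences that compute the same function there is one that is minimal for the lexicographic
order, so `N_S(k)` is the number of minimal sequences of length `k`. Two sequences `D` and `D'`
compute the same function if and only if, at every cut, the states of both can be labelled such that
on every string they reach states with equal labels, and at the end states with equal labels agree
on acceptance. Hence an automaton that reads `D` can guess `D'` layer by layer, remembering the
last layers, which sequence is smaller, and the current pair of labellings. The set of all possible
guesses is the *profile* of `D`; it determines whether `D` is minimal, and the number of profiles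
does not depend on `k`. So the minimal sequences are the accepting paths of a deterministic
automaton of fixed size, which are counted by `k` applications of its transition matrix to a vector
of numbers with `O(k)` bits. Nondeterministic layers are determinized first, which replaces `w` by
`2 ^ w`; since there are about `2 ^ (w * log w)` labellings, the exponents of the two bounds differ.
-/

/-! ## Timed executions -/

/-- Started in `s`, the program `P` halts in `s'` after time at most `T`. -/
def RunsIn (P : RAMProgram) (s : RAMState) (T : ℕ) (s' : RAMState) : Prop :=
  ∃ t, RAMRuns P s t s' ∧ t ≤ T

/-- Run `P` as many times as register `r` says; register `t` is scratch space for decreasing `r`. -/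
def RAMProgram.countdown (r t : ℕ) (P : RAMProgram) : RAMProgram :=
  .loop r (.seq (.const t 1) (.seq (.sub r r t) P))

namespace RAMState

@[simp] theorem setReg_reg (s : RAMState) (i v j : ℕ) :
    (s.setReg i v).reg j = if j = i then v else s.reg j := by
  simp [setReg, Function.update_apply]

@[simp] theorem setReg_mem (s : RAMState) (i v : ℕ) : (s.setReg i v).mem = s.mem := rfl

@[simp] theorem setMem_reg (s : RAMState) (a v : ℕ) : (s.setMem a v).reg = s.reg := rfl

end RAMState

namespace RunsIn

variable {P Q : RAMProgram} {s s' s'' : RAMState} {T T' : ℕ}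

theorem mono (h : RunsIn P s T s') (hT : T ≤ T') : RunsIn P s T' s' :=
  let ⟨t, ht, hle⟩ := h; ⟨t, ht, hle.trans hT⟩

theorem seq (h : RunsIn P s T s') (h' : RunsIn Q s' T' s'') : RunsIn (.seq P Q) s (T + T') s'' :=
  let ⟨_, ht, hle⟩ := h; let ⟨_, ht', hle'⟩ := h'
  ⟨_, .seq _ _ _ _ _ _ _ ht ht', Nat.add_le_add hle hle'⟩

theorem const (i c : ℕ) (s : RAMState) : RunsIn (.const i c) s (1 + c.size) (s.setReg i c) :=
  ⟨_, .const _ _ _, le_rfl⟩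

theorem copy (i j : ℕ) (s : RAMState) :
    RunsIn (.copy i j) s (1 + (s.reg j).size) (s.setReg i (s.reg j)) :=
  ⟨_, .copy _ _ _, le_rfl⟩

theorem add (i j l : ℕ) (s : RAMState) :
    RunsIn (.add i j l) s (1 + (s.reg j).size + (s.reg l).size) (s.setReg i (s.reg j + s.reg l)) :=
  ⟨_, .add _ _ _ _, le_rfl⟩

theorem sub (i j l : ℕ) (s : RAMState) :
    RunsIn (.sub i j l) s (1 + (s.reg j).size + (s.reg l).size) (s.setReg i (s.reg j - s.reg l)) :=
  ⟨_, .sub _ _ _ _, le_rfl⟩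

theorem half (i j : ℕ) (s : RAMState) :
    RunsIn (.half i j) s (1 + (s.reg j).size) (s.setReg i (s.reg j / 2)) :=
  ⟨_, .half _ _ _, le_rfl⟩

theorem load (i j : ℕ) (s : RAMState) :
    RunsIn (.load i j) s (1 + (s.reg j).size + (s.mem (s.reg j)).size)
      (s.setReg i (s.mem (s.reg j))) :=
  ⟨_, .load _ _ _, le_rfl⟩

theorem store (i j : ℕ) (s : RAMState) :
    RunsIn (.store i j) s (1 + (s.reg i).size + (s.reg j).size) (s.setMem (s.reg i) (s.reg j)) :=
  ⟨_, .store _ _ _, le_rfl⟩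

theorem cond_true {i : ℕ} (hi : s.reg i ≠ 0) (h : RunsIn P s T s') :
    RunsIn (.cond i P Q) s (1 + (s.reg i).size + T) s' :=
  let ⟨_, ht, hle⟩ := h
  ⟨_, .cond_true _ _ _ _ _ _ hi ht, Nat.add_le_add_left hle _⟩

theorem cond_false {i : ℕ} (hi : s.reg i = 0) (h : RunsIn Q s T s') :
    RunsIn (.cond i P Q) s (1 + T) s' :=
  let ⟨_, ht, hle⟩ := h
  ⟨_, .cond_false _ _ _ _ _ _ hi ht, Nat.add_le_add_left hle _⟩

theorem countdown {r t N : ℕ} (Inv : ℕ → RAMState → Prop) (hrt : r ≠ t)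
    (hreg : ∀ j s, Inv j s → s.reg r = j)
    (hbody : ∀ j < N, ∀ s, Inv (j + 1) s →
      ∃ s', RunsIn P ((s.setReg t 1).setReg r j) T s' ∧ Inv j s') (h₀ : Inv N s) :
    ∃ s', RunsIn (.countdown r t P) s (N * (T + 2 * N.size + 5) + 1) s' ∧ Inv 0 s' := by
  suffices H : ∀ j ≤ N, ∀ s, Inv j s → ∃ s',
      RunsIn (.countdown r t P) s (j * (T + 2 * N.size + 5) + 1) s' ∧ Inv 0 s' from
    H N le_rfl s h₀
  intro j
  induction j with
  | zero => exact fun _ s hs => ⟨s, ⟨1, .loop_false _ _ _ (hreg _ _ hs), by omega⟩, hs⟩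
  | succ j ih =>
    intro hj s hs
    have hr : s.reg r = j + 1 := hreg _ _ hs
    obtain ⟨s₁, hrun, hs₁⟩ := hbody j (by omega) s hs
    obtain ⟨s₂, ⟨t₂, hr₂, ht₂⟩, hs₂⟩ := ih (by omega) s₁ hs₁
    have hdec : RunsIn (.sub r r t) (s.setReg t 1) (1 + (j + 1).size + 1)
        ((s.setReg t 1).setReg r j) := by
      simpa [hrt, hr] using RunsIn.sub r r t (s.setReg t 1)
    obtain ⟨t₁, hr₁, ht₁⟩ := (RunsIn.const t 1 s).seq (hdec.seq hrun)
    have hsize : (j + 1).size ≤ N.size := Nat.size_le_size hj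
    refine ⟨s₂, ⟨_, .loop_true _ _ _ _ _ _ _ (by omega) hr₁ hr₂, ?_⟩, hs₂⟩
    rw [hr, Nat.succ_mul]
    simp only [Nat.size_one] at ht₁
    omega

end RunsIn

/-! ## Functions computed in time polynomial in the values of the arguments -/

/-- The state `s'` has the memory of `s` and the registers below `d` of `s`. -/
def RAMState.AgreesBelow (d : ℕ) (s s' : RAMState) : Prop :=
  s'.mem = s.mem ∧ ∀ j < d, s'.reg j = s.reg j

/-- Started in `s`, the program `P` writes `v` to register `d` within time `T`, changing neither the
memory nor the registers below `d`. -/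
def Evaluates (P : RAMProgram) (s : RAMState) (T d v : ℕ) : Prop :=
  ∃ s', RunsIn P s T s' ∧ s.AgreesBelow d s' ∧ s'.reg d = v

/-- Registers `ρ 0, ρ 1, …`, all below `d`, hold an environment bounded by `U ≥ 2`, and the memory
is bounded by `2 ^ K`. -/
structure BoundedEnv (ρ : ℕ → ℕ) (d : ℕ) (s : RAMState) (U K : ℕ) : Prop where
  lt : ∀ i, ρ i < d
  two_le : 2 ≤ U
  reg_le : ∀ i, s.reg (ρ i) ≤ U
  mem_le : ∀ a, s.mem a ≤ 2 ^ K

/-- Prepending a value to an environment. -/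
def envCons (x : ℕ) (σ : ℕ → ℕ) : ℕ → ℕ
  | 0 => x
  | i + 1 => σ i

/-- Dropping the first value of an environment. -/
abbrev envTail (σ : ℕ → ℕ) : ℕ → ℕ := fun i => σ (i + 1)

/-- The function `f` of the memory and of an environment is computed by a program, which is given
uniformly in the registers `ρ` that hold the environment and in the register `d` for the result.
If the environment is bounded by `U` and the memory by `2 ^ K`, then the result is at most
`U ^ c * 2 ^ (κ * K)` and the time at most `U ^ c * (κ * K + 1)`. For `κ = 0` the bounds do not
depend on the memory, so that the values of `f` are small enough for addresses and loop bounds. -/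
def RamComp (κ : ℕ) (f : (ℕ → ℕ) → (ℕ → ℕ) → ℕ) : Prop :=
  ∃ (C : (ℕ → ℕ) → ℕ → RAMProgram) (c : ℕ), ∀ (ρ : ℕ → ℕ) (d : ℕ) (s : RAMState) (U K : ℕ),
    BoundedEnv ρ d s U K → f s.mem (s.reg ∘ ρ) ≤ U ^ c * 2 ^ (κ * K) ∧
      Evaluates (C ρ d) s (U ^ c * (κ * K + 1)) d (f s.mem (s.reg ∘ ρ))

/-- The characteristic function of the predicate `p` is computed in the sense of `RamComp`. -/
def RamPred (κ : ℕ) (p : (ℕ → ℕ) → (ℕ → ℕ) → Prop) : Prop :=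
  RamComp κ fun m σ => propBit (p m σ)

theorem size_le_of_le_mul_two_pow {v U c K : ℕ} (hU : 2 ≤ U) (h : v ≤ U ^ c * 2 ^ K) :
    v.size ≤ U ^ c * (K + 1) := by
  have h1 : 1 ≤ U ^ c := Nat.one_le_pow _ _ (by omega)
  rw [Nat.size_le]
  calc v ≤ U ^ c * 2 ^ K := h
    _ < 2 ^ U ^ c * 2 ^ K := Nat.mul_lt_mul_of_pos_right Nat.lt_two_pow_self (by positivity)
    _ = 2 ^ (U ^ c + K) := (pow_add _ _ _).symm
    _ ≤ 2 ^ (U ^ c * (K + 1)) := Nat.pow_le_pow_right (by norm_num) (by nlinarith)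

theorem size_le_self (n : ℕ) : n.size ≤ n := Nat.size_le.2 Nat.lt_two_pow_self

theorem pow_mul_le_pow_mul {U a b X : ℕ} (hU : 2 ≤ U) (h : a ≤ b) : U ^ a * X ≤ U ^ b * X :=
  Nat.mul_le_mul_right _ (Nat.pow_le_pow_right (by omega) h)

theorem mul_le_pow_add_mul {U c X n e : ℕ} (hU : 2 ≤ U) (hn : n ≤ 2 ^ e) :
    n * (U ^ c * X) ≤ U ^ (c + e) * X :=
  calc n * (U ^ c * X) ≤ U ^ e * (U ^ c * X) :=
        Nat.mul_le_mul_right _ (hn.trans (Nat.pow_le_pow_left hU _))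
    _ = U ^ (c + e) * X := by ring

namespace RAMState.AgreesBelow

variable {d d' : ℕ} {s s' s'' : RAMState}

theorem refl (d : ℕ) (s : RAMState) : s.AgreesBelow d s := ⟨rfl, fun _ _ => rfl⟩

theorem mono (h : s.AgreesBelow d' s') (hd : d ≤ d') : s.AgreesBelow d s' :=
  ⟨h.1, fun j hj => h.2 j (hj.trans_le hd)⟩

theorem trans (h : s.AgreesBelow d s') (h' : s'.AgreesBelow d s'') : s.AgreesBelow d s'' :=
  ⟨h'.1.trans h.1, fun j hj => (h'.2 j hj).trans (h.2 j hj)⟩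

theorem setReg {i : ℕ} (h : s.AgreesBelow d s') (hi : d ≤ i) (v : ℕ) :
    s.AgreesBelow d (s'.setReg i v) :=
  ⟨h.1, fun j hj => by simp [(hj.trans_le hi).ne, h.2 j hj]⟩

end RAMState.AgreesBelow

namespace BoundedEnv

variable {ρ : ℕ → ℕ} {d d' U U' K x : ℕ} {s s' : RAMState}

theorem reg_comp_eq (h : BoundedEnv ρ d s U K) (hs : s.AgreesBelow d s') :
    s'.reg ∘ ρ = s.reg ∘ ρ :=
  funext fun i => hs.2 _ (h.lt i)

theorem of_agreesBelow (h : BoundedEnv ρ d s U K) (hs : s.AgreesBelow d s') (hd : d ≤ d') :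
    BoundedEnv ρ d' s' U K where
  lt i := (h.lt i).trans_le hd
  two_le := h.two_le
  reg_le i := (hs.2 _ (h.lt i)).trans_le (h.reg_le i)
  mem_le a := by rw [hs.1]; exact h.mem_le a

theorem tail (h : BoundedEnv ρ d s U K) : BoundedEnv (envTail ρ) d s U K :=
  ⟨fun _ => h.lt _, h.two_le, fun _ => h.reg_le _, h.mem_le⟩

theorem cons (h : BoundedEnv ρ d s U K) (hU : U ≤ U') (hx : x < d) (hx' : s.reg x ≤ U') :
    BoundedEnv (envCons x ρ) d s U' K where
  lt | 0 => hx | _ + 1 => h.lt _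
  two_le := h.two_le.trans hU
  reg_le | 0 => hx' | _ + 1 => (h.reg_le _).trans hU
  mem_le := h.mem_le

theorem one_le_pow_mul (h : BoundedEnv ρ d s U K) (c X : ℕ) : 1 ≤ U ^ c * (X + 1) :=
  Nat.mul_pos (Nat.pow_pos (by have := h.two_le; omega)) (by omega)

end BoundedEnv

theorem Evaluates.mono {P : RAMProgram} {s : RAMState} {T T' d v : ℕ} (h : Evaluates P s T d v)
    (hT : T ≤ T') : Evaluates P s T' d v :=
  let ⟨s', hr, h'⟩ := h; ⟨s', hr.mono hT, h'⟩

theorem Evaluates.seq {P Q : RAMProgram} {s : RAMState} {T T' d v v' : ℕ}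
    (h : Evaluates P s T d v)
    (h' : ∀ s', s.AgreesBelow d s' → s'.reg d = v → Evaluates Q s' T' d v') :
    Evaluates (.seq P Q) s (T + T') d v' :=
  let ⟨s₁, hr, ha, hv⟩ := h
  let ⟨s₂, hr', ha', hv'⟩ := h' s₁ ha hv
  ⟨s₂, hr.seq hr', ha.trans ha', hv'⟩

theorem RunsIn.evaluates_setReg {P : RAMProgram} {s : RAMState} {T d v : ℕ}
    (h : RunsIn P s T (s.setReg d v)) : Evaluates P s T d v :=
  ⟨_, h, (RAMState.AgreesBelow.refl d s).setReg le_rfl v, by simp⟩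

namespace RamComp

variable {κ : ℕ} {f g h : (ℕ → ℕ) → (ℕ → ℕ) → ℕ}

theorem of_eq (hf : RamComp κ f) (e : ∀ m σ, f m σ = g m σ) : RamComp κ g :=
  (funext fun m => funext fun σ => e m σ : f = g) ▸ hf

theorem of_zero (hf : RamComp 0 f) : RamComp κ f := by
  obtain ⟨C, c, hC⟩ := hf
  refine ⟨C, c, fun ρ d s U K hs => ?_⟩
  obtain ⟨hv, hev⟩ := hC ρ d s U K hs
  exact ⟨hv.trans (Nat.mul_le_mul_left _ (Nat.pow_le_pow_right (by norm_num) (by simp))),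
    hev.mono (Nat.mul_le_mul_left _ (by simp))⟩

theorem const (n : ℕ) : RamComp κ fun _ _ => n := by
  refine of_zero ⟨fun _ d => .const d n, n + 1, fun ρ d s U K hs => ?_⟩
  have hn : n + 1 ≤ U ^ (n + 1) :=
    Nat.lt_two_pow_self.le.trans (Nat.pow_le_pow_left hs.two_le _)
  have := size_le_self n
  exact ⟨by simp; omega, (RunsIn.const d n s).evaluates_setReg.mono (by simp; omega)⟩

theorem var (i : ℕ) : RamComp κ fun _ σ => σ i := by
  refine of_zero ⟨fun ρ d => .copy d (ρ i), 2, fun ρ d s U K hs => ?_⟩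
  have hle := hs.reg_le i
  have hU := hs.two_le
  have := size_le_self (s.reg (ρ i))
  exact ⟨by simp; nlinarith, (RunsIn.copy d (ρ i) s).evaluates_setReg.mono (by simp; nlinarith)⟩

theorem tail (hf : RamComp κ f) : RamComp κ fun m σ => f m (envTail σ) := by
  obtain ⟨C, c, hC⟩ := hf
  exact ⟨fun ρ d => C (envTail ρ) d, c, fun ρ d s U K hs => hC (envTail ρ) d s U K hs.tail⟩

theorem exists_pair (hf : RamComp κ f) (hg : RamComp κ g) :
    ∃ (C : (ℕ → ℕ) → ℕ → RAMProgram) (c : ℕ), ∀ (ρ : ℕ → ℕ) (d : ℕ) (s : RAMState) (U K : ℕ),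
      BoundedEnv ρ d s U K → f s.mem (s.reg ∘ ρ) ≤ U ^ c * 2 ^ (κ * K) ∧
        g s.mem (s.reg ∘ ρ) ≤ U ^ c * 2 ^ (κ * K) ∧
        ∃ s', RunsIn (C ρ d) s (U ^ c * (κ * K + 1)) s' ∧ s.AgreesBelow d s' ∧
          s'.reg d = f s.mem (s.reg ∘ ρ) ∧ s'.reg (d + 1) = g s.mem (s.reg ∘ ρ) := by
  obtain ⟨F, cf, hF⟩ := hf
  obtain ⟨G, cg, hG⟩ := hg
  refine ⟨fun ρ d => .seq (F ρ d) (G ρ (d + 1)), cf + cg + 1, fun ρ d s U K hs => ?_⟩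
  obtain ⟨hvf, s₁, hr₁, ha₁, hd₁⟩ := hF ρ d s U K hs
  obtain ⟨hvg, s₂, hr₂, ha₂, hd₂⟩ := hG ρ (d + 1) s₁ U K (hs.of_agreesBelow ha₁ (by omega))
  rw [ha₁.1, hs.reg_comp_eq ha₁] at hvg hd₂
  have hU := hs.two_le
  refine ⟨hvf.trans (pow_mul_le_pow_mul hU (by omega)),
    hvg.trans (pow_mul_le_pow_mul hU (by omega)), s₂,
    (hr₁.seq hr₂).mono ?_, ha₁.trans (ha₂.mono (by omega)), ?_, hd₂⟩
  · have h1 := pow_mul_le_pow_mul (X := κ * K + 1) hU (show cf ≤ cf + cg by omega)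
    have h2 := pow_mul_le_pow_mul (X := κ * K + 1) hU (show cg ≤ cf + cg by omega)
    have h3 := mul_le_pow_add_mul (c := cf + cg) (X := κ * K + 1) (n := 2) (e := 1) hU le_rfl
    omega
  · rw [ha₂.2 _ (by omega), hd₁]

theorem of_pair (hf : RamComp κ f) (hg : RamComp κ g) {op : ℕ → ℕ → ℕ} (Q : ℕ → RAMProgram)
    (hop : ∀ x y, op x y ≤ x + y)
    (hQ : ∀ d s, RunsIn (Q d) s (1 + (s.reg d).size + (s.reg (d + 1)).size)
      (s.setReg d (op (s.reg d) (s.reg (d + 1))))) :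
    RamComp κ fun m σ => op (f m σ) (g m σ) := by
  obtain ⟨C, c, hC⟩ := exists_pair hf hg
  refine ⟨fun ρ d => .seq (C ρ d) (Q d), c + 2, fun ρ d s U K hs => ?_⟩
  obtain ⟨hf, hg, s', hr, ha, hd, hd'⟩ := hC ρ d s U K hs
  have hU := hs.two_le
  have hQ' := hQ d s'
  rw [hd, hd'] at hQ'
  refine ⟨?_, _, (hr.seq hQ').mono ?_, ha.setReg le_rfl _, by simp⟩
  · have := mul_le_pow_add_mul (c := c) (X := 2 ^ (κ * K)) (n := 2) (e := 2) hU (by norm_num)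
    have := hop (f s.mem (s.reg ∘ ρ)) (g s.mem (s.reg ∘ ρ))
    dsimp only
    omega
  · have h1 := size_le_of_le_mul_two_pow hU hf
    have h2 := size_le_of_le_mul_two_pow hU hg
    have h3 := mul_le_pow_add_mul (c := c) (X := κ * K + 1) (n := 4) (e := 2) hU le_rfl
    have h4 := hs.one_le_pow_mul c (κ * K)
    omega

theorem add (hf : RamComp κ f) (hg : RamComp κ g) : RamComp κ fun m σ => f m σ + g m σ :=
  hf.of_pair hg (fun d => .add d d (d + 1)) (fun _ _ => le_rfl) fun _ _ => .add _ _ _ _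

theorem sub (hf : RamComp κ f) (hg : RamComp κ g) : RamComp κ fun m σ => f m σ - g m σ :=
  hf.of_pair hg (fun d => .sub d d (d + 1)) (fun _ _ => by omega) fun _ _ => .sub _ _ _ _

theorem read (hf : RamComp 0 f) : RamComp 1 fun m σ => m (f m σ) := by
  obtain ⟨C, c, hC⟩ := hf
  refine ⟨fun ρ d => .seq (C ρ d) (.load d d), c + 2, fun ρ d s U K hs => ?_⟩
  obtain ⟨hf, s', hr, ha, hd⟩ := hC ρ d s U K hs
  have hU := hs.two_le
  have hmem := hs.mem_le (f s.mem (s.reg ∘ ρ))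
  have hload := RunsIn.load d d s'
  rw [hd, ha.1] at hload
  simp only [zero_mul, one_mul, zero_add, pow_zero, mul_one] at hf hr ⊢
  refine ⟨hmem.trans (Nat.le_mul_of_pos_left _ (Nat.pow_pos (by omega))), _,
    (hr.seq hload).mono ?_, ha.setReg le_rfl _, by simp⟩
  have h1 := (size_le_self _).trans hf
  have h2 := size_le_of_le_mul_two_pow (c := 0) (K := K) hU (hmem.trans_eq (by simp))
  have h3 := mul_le_pow_add_mul (c := c) (X := K + 1) (n := 4) (e := 2) hU le_rfl
  have h4 : 1 ≤ U ^ c := Nat.pow_pos (by omega)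
  simp only [pow_zero, one_mul] at h2
  nlinarith

theorem ite_ne_zero (hf : RamComp κ f) (hg : RamComp κ g) (hh : RamComp κ h) :
    RamComp κ fun m σ => if f m σ ≠ 0 then g m σ else h m σ := by
  obtain ⟨F, cf, hF⟩ := hf
  obtain ⟨G, cg, hG⟩ := hg
  obtain ⟨H, ch, hH⟩ := hh
  refine ⟨fun ρ d => .seq (F ρ d) (.cond d (G ρ d) (H ρ d)), cf + cg + ch + 3,
    fun ρ d s U K hs => ?_⟩
  obtain ⟨hvf, s₁, hr₁, ha₁, hd₁⟩ := hF ρ d s U K hs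
  have hs₁ := hs.of_agreesBelow ha₁ le_rfl
  obtain ⟨hvg, s₂, hr₂, ha₂, hd₂⟩ := hG ρ d s₁ U K hs₁
  obtain ⟨hvh, s₃, hr₃, ha₃, hd₃⟩ := hH ρ d s₁ U K hs₁
  rw [ha₁.1, hs.reg_comp_eq ha₁] at hvg hd₂ hvh hd₃
  have hU := hs.two_le
  have h0 := size_le_of_le_mul_two_pow hU hvf
  have h1 := pow_mul_le_pow_mul (X := κ * K + 1) hU (show cf ≤ cf + cg + ch by omega)
  have h2 := pow_mul_le_pow_mul (X := κ * K + 1) hU (show cg ≤ cf + cg + ch by omega)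
  have h3 := pow_mul_le_pow_mul (X := κ * K + 1) hU (show ch ≤ cf + cg + ch by omega)
  have h4 := mul_le_pow_add_mul (c := cf + cg + ch) (X := κ * K + 1) (n := 8) (e := 3) hU le_rfl
  have h5 := hs.one_le_pow_mul cf (κ * K)
  by_cases hc : f s.mem (s.reg ∘ ρ) = 0
  · simp only [hc, ne_eq, not_true_eq_false, if_false]
    exact ⟨hvh.trans (pow_mul_le_pow_mul hU (by omega)), s₃,
      (hr₁.seq (.cond_false (hd₁.trans hc) hr₃)).mono (by omega), ha₁.trans ha₃, hd₃⟩
  · simp only [hc, ne_eq, not_false_eq_true, if_true]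
    exact ⟨hvg.trans (pow_mul_le_pow_mul hU (by omega)), s₂,
      (hr₁.seq (.cond_true (by rwa [hd₁]) hr₂)).mono (by rw [hd₁]; omega), ha₁.trans ha₂, hd₂⟩

end RamComp

theorem Evaluates.sum_loop {P : RAMProgram} {s : RAMState} {d b T V : ℕ} {F : ℕ → ℕ}
    (hb : s.reg d = b) (hV : (∑ x ∈ Finset.range b, F x).size ≤ V)
    (hP : ∀ x < b, ∀ s', s.AgreesBelow d s' → s'.reg d = x → Evaluates P s' T (d + 2) (F x)) :
    Evaluates (.seq (.const (d + 1) 0) (.seq (.countdown d (d + 2)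
      (.seq P (.add (d + 1) (d + 1) (d + 2)))) (.copy d (d + 1))))
      s (b * (T + 2 * V + 2 * b.size + 6) + V + 3) d (∑ x ∈ Finset.range b, F x) := by
  have hsize : ∀ t ⊆ Finset.range b, (∑ x ∈ t, F x).size ≤ V := fun t ht =>
    (Nat.size_le_size (Finset.sum_le_sum_of_subset ht)).trans hV
  have hIco : ∀ j, Finset.Ico j b ⊆ Finset.range b := fun j x hx => by
    simp only [Finset.mem_Ico, Finset.mem_range] at hx ⊢; omega
  let Inv : ℕ → RAMState → Prop := fun j s' => s.AgreesBelow d s' ∧ s'.reg d = j ∧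
    s'.reg (d + 1) = ∑ x ∈ Finset.Ico j b, F x
  have hbody : ∀ j < b, ∀ s', Inv (j + 1) s' → ∃ s'',
      RunsIn (.seq P (.add (d + 1) (d + 1) (d + 2))) ((s'.setReg (d + 2) 1).setReg d j)
        (T + 2 * V + 1) s'' ∧ Inv j s'' := by
    rintro j hj s' ⟨ha, -, hsum⟩
    have ha₀ : s.AgreesBelow d ((s'.setReg (d + 2) 1).setReg d j) :=
      (ha.setReg (by omega) 1).setReg le_rfl j
    obtain ⟨s₁, hr₁, ha₁, hd₁⟩ := hP j hj _ ha₀ (by simp)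
    have hsum₁ : s₁.reg (d + 1) = ∑ x ∈ Finset.Ico (j + 1) b, F x := by
      rw [ha₁.2 _ (by omega), ← hsum]; simp
    refine ⟨_, (hr₁.seq (.add (d + 1) (d + 1) (d + 2) s₁)).mono ?_,
      (ha₀.trans (ha₁.mono (by omega))).setReg (by omega) _, ?_, ?_⟩
    · have h1 := hsize _ (hIco (j + 1))
      have h2 := hsize {j} (by simpa using hj)
      rw [Finset.sum_singleton] at h2
      rw [hsum₁, hd₁]
      omega
    · simp [ha₁.2 d (by omega)]
    · simp [hsum₁, hd₁, Finset.sum_eq_sum_Ico_succ_bot hj, Nat.add_comm]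
  obtain ⟨s₁, hr, ha, -, hsum⟩ := RunsIn.countdown (r := d) (t := d + 2) Inv (by omega)
    (fun j s h => h.2.1) hbody (s := s.setReg (d + 1) 0)
    ⟨(RAMState.AgreesBelow.refl d s).setReg (by omega) 0, by simp [hb], by simp⟩
  rw [Nat.Ico_zero_eq_range] at hsum
  refine ⟨_, ((RunsIn.const (d + 1) 0 s).seq (hr.seq (.copy d (d + 1) s₁))).mono ?_,
    ha.setReg le_rfl _, by simp [hsum]⟩
  rw [hsum, Nat.size_zero]
  have : b * (T + 2 * V + 1 + 2 * b.size + 5) = b * (T + 2 * V + 2 * b.size + 6) := by ring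
  omega

namespace RamComp

variable {κ : ℕ} {f g : (ℕ → ℕ) → (ℕ → ℕ) → ℕ}

theorem sum_time_le {U N a c X : ℕ} (hU : 2 ≤ U) (hN : N ≤ U ^ a) (hX : 0 < X) :
    U ^ a + (N * (U ^ ((a + 1) * c) * X + 2 * (U ^ (a + (a + 1) * c) * X) + 2 * N.size + 6) +
      U ^ (a + (a + 1) * c) * X + 3) ≤ U ^ (a + (a + (a + 1) * c) + 4) * X := by
  set e := a + (a + 1) * c
  have hpos : 0 < U ^ e * X := Nat.mul_pos (Nat.pow_pos (by omega)) hX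
  have ha : U ^ a ≤ U ^ e * X := (Nat.pow_le_pow_right (by omega) (by omega)).trans
    (Nat.le_mul_of_pos_right _ hX)
  have hterm := pow_mul_le_pow_mul (X := X) hU (show (a + 1) * c ≤ e by omega)
  have hsize := (size_le_self N).trans hN
  have hloop : N * (U ^ ((a + 1) * c) * X + 2 * (U ^ e * X) + 2 * N.size + 6) ≤
      11 * (U ^ (a + e) * X) :=
    calc _ ≤ U ^ a * (11 * (U ^ e * X)) := Nat.mul_le_mul hN (by omega)
      _ = 11 * (U ^ (a + e) * X) := by rw [pow_add]; ring
  have he := pow_mul_le_pow_mul (X := X) hU (show e ≤ a + e by omega)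
  have h16 := mul_le_pow_add_mul (c := a + e) (X := X) (n := 16) (e := 4) hU le_rfl
  omega

theorem sum {b : (ℕ → ℕ) → (ℕ → ℕ) → ℕ} {F : (ℕ → ℕ) → (ℕ → ℕ) → ℕ → ℕ} (hb : RamComp 0 b)
    (hF : RamComp κ fun m σ => F m (envTail σ) (σ 0)) :
    RamComp κ fun m σ => ∑ x ∈ Finset.range (b m σ), F m σ x := by
  obtain ⟨B, cb, hB⟩ := hb
  obtain ⟨G, cg, hG⟩ := hF
  refine ⟨fun ρ d => .seq (B ρ d) (.seq (.const (d + 1) 0) (.seq (.countdown d (d + 2)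
    (.seq (G (envCons d ρ) (d + 2)) (.add (d + 1) (d + 1) (d + 2)))) (.copy d (d + 1)))),
    cb + (cb + (cb + 1) * cg) + 4, fun ρ d s U K hs => ?_⟩
  obtain ⟨hvb, hevb⟩ := hB ρ d s U K hs
  simp only [zero_mul, pow_zero, mul_one, zero_add] at hvb hevb
  have hU := hs.two_le
  have hpow : (U ^ (cb + 1)) ^ cg = U ^ ((cb + 1) * cg) := (pow_mul _ _ _).symm
  set N := b s.mem (s.reg ∘ ρ)
  set c₀ := cb + (cb + 1) * cg
  set X := κ * K + 1
  have hterm : ∀ x < N, ∀ s', s.AgreesBelow d s' → s'.reg d = x →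
      F s.mem (s.reg ∘ ρ) x ≤ U ^ ((cb + 1) * cg) * 2 ^ (κ * K) ∧
      Evaluates (G (envCons d ρ) (d + 2)) s' (U ^ ((cb + 1) * cg) * X) (d + 2)
        (F s.mem (s.reg ∘ ρ) x) := by
    intro x hx s' ha hd
    have hs' := (hs.of_agreesBelow ha (Nat.le_add_right d 2)).cons
      (Nat.le_self_pow (show cb + 1 ≠ 0 by omega) U) (by omega)
      (hd.trans_le ((hx.le.trans hvb).trans (Nat.pow_le_pow_right (by omega) (by omega))))
    have h := hG _ _ _ _ _ hs'
    have henv : envTail (s'.reg ∘ envCons d ρ) = s.reg ∘ ρ := hs.reg_comp_eq ha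
    have hhead : (s'.reg ∘ envCons d ρ) 0 = x := hd
    simpa only [ha.1, henv, hhead, hpow] using h
  have hsum : ∑ x ∈ Finset.range N, F s.mem (s.reg ∘ ρ) x ≤ U ^ c₀ * 2 ^ (κ * K) :=
    calc ∑ x ∈ Finset.range N, F s.mem (s.reg ∘ ρ) x
        ≤ N * (U ^ ((cb + 1) * cg) * 2 ^ (κ * K)) := by
          simpa using Finset.sum_le_card_nsmul _ _ _ fun x hx => (hterm x (Finset.mem_range.1 hx)
            _ ((RAMState.AgreesBelow.refl d s).setReg le_rfl x) (by simp)).1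
      _ ≤ U ^ cb * (U ^ ((cb + 1) * cg) * 2 ^ (κ * K)) := Nat.mul_le_mul_right _ hvb
      _ = U ^ c₀ * 2 ^ (κ * K) := by rw [pow_add]; ring
  exact ⟨hsum.trans (pow_mul_le_pow_mul hU (by omega)), (hevb.seq fun s₁ ha₁ hd₁ =>
    Evaluates.sum_loop hd₁ (size_le_of_le_mul_two_pow hU hsum) fun x hx s' ha hd =>
      (hterm x hx s' (ha₁.trans ha) hd).2).mono (sum_time_le hU hvb (Nat.succ_pos _))⟩

theorem mul (hf : RamComp 0 f) (hg : RamComp κ g) : RamComp κ fun m σ => f m σ * g m σ :=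
  (sum (F := fun m σ _ => g m σ) hf hg.tail).of_eq fun m σ => by simp

theorem pow (hf : RamComp 0 f) (e : ℕ) : RamComp 0 fun m σ => f m σ ^ e := by
  induction e with
  | zero => simpa only [pow_zero] using const 1
  | succ e ih => simpa only [pow_succ] using ih.mul hf

end RamComp

theorem propBit_of_true {p : Prop} (h : p) : propBit p = 1 := by simp [propBit, h]

theorem propBit_ne_zero {p : Prop} : propBit p ≠ 0 ↔ p := by
  by_cases h : p <;> simp [propBit, h]

theorem propBit_le_one (p : Prop) : propBit p ≤ 1 := by
  by_cases h : p <;> simp [propBit, h]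

theorem RamComp.ite {κ : ℕ} {p : (ℕ → ℕ) → (ℕ → ℕ) → Prop} [∀ m σ, Decidable (p m σ)]
    {f g : (ℕ → ℕ) → (ℕ → ℕ) → ℕ} (hp : RamPred κ p) (hf : RamComp κ f) (hg : RamComp κ g) :
    RamComp κ fun m σ => if p m σ then f m σ else g m σ :=
  (RamComp.ite_ne_zero hp hf hg).of_eq fun m σ => by simp only [propBit_ne_zero]

theorem RunsIn.exists_shiftRight_loop {s : RAMState} {d a b V : ℕ} (hd : s.reg d = a)
    (hd' : s.reg (d + 1) = b) (ha : a ≤ V) :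
    ∃ s', RunsIn (.countdown (d + 1) (d + 2) (.half d d)) s (b * (V + 2 * b.size + 6) + 1) s' ∧
      s.AgreesBelow d s' ∧ s'.reg d = a / 2 ^ b := by
  let Inv : ℕ → RAMState → Prop := fun j s' => s.AgreesBelow d s' ∧ s'.reg (d + 1) = j ∧
    s'.reg d = a / 2 ^ (b - j)
  have hbody : ∀ j < b, ∀ s', Inv (j + 1) s' → ∃ s'',
      RunsIn (.half d d) ((s'.setReg (d + 2) 1).setReg (d + 1) j) (V + 1) s'' ∧ Inv j s'' := by
    rintro j hj s' ⟨hagree, -, hdiv⟩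
    have hreg : ((s'.setReg (d + 2) 1).setReg (d + 1) j).reg d = a / 2 ^ (b - (j + 1)) := by
      simp [hdiv]
    refine ⟨_, (RunsIn.half d d _).mono ?_,
      ((hagree.setReg (by omega) 1).setReg (by omega) j).setReg le_rfl _, by simp, ?_⟩
    · have := (size_le_self (a / 2 ^ (b - (j + 1)))).trans ((Nat.div_le_self _ _).trans ha)
      rw [hreg]
      omega
    · rw [hreg, Nat.div_div_eq_div_mul, ← pow_succ, show b - (j + 1) + 1 = b - j by omega]
      simp
  obtain ⟨s', hr, hagree, -, hdiv⟩ := RunsIn.countdown Inv (by omega) (fun j s h => h.2.1) hbody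
    ⟨RAMState.AgreesBelow.refl d s, hd', by simp [hd]⟩
  exact ⟨s', hr.mono (le_of_eq (by ring)), hagree, by simpa using hdiv⟩

namespace RamPred

variable {κ : ℕ} {f g : (ℕ → ℕ) → (ℕ → ℕ) → ℕ} {p q : (ℕ → ℕ) → (ℕ → ℕ) → Prop}

theorem of_iff (hp : RamPred κ p) (h : ∀ m σ, p m σ ↔ q m σ) : RamPred κ q :=
  RamComp.of_eq hp fun m σ => by rw [propext (h m σ)]

theorem ne_zero (hf : RamComp κ f) : RamPred κ fun m σ => f m σ ≠ 0 :=
  (hf.ite_ne_zero (.const 1) (.const 0)).of_eq fun m σ => by simp [propBit]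

theorem not (hp : RamPred κ p) : RamPred κ fun m σ => ¬p m σ :=
  (RamComp.sub (.const 1) hp).of_eq fun m σ => by by_cases h : p m σ <;> simp [propBit, h]

theorem and (hp : RamPred κ p) (hq : RamPred κ q) : RamPred κ fun m σ => p m σ ∧ q m σ := by
  classical
  exact (RamComp.ite hp hq (.const 0)).of_eq fun m σ => by by_cases h : p m σ <;> simp [propBit, h]

theorem imp (hp : RamPred κ p) (hq : RamPred κ q) : RamPred κ fun m σ => p m σ → q m σ :=
  (hp.and hq.not).not.of_iff fun m σ => by tauto

theorem or (hp : RamPred κ p) (hq : RamPred κ q) : RamPred κ fun m σ => p m σ ∨ q m σ :=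
  (hp.not.imp hq).of_iff fun m σ => by tauto

theorem iff (hp : RamPred κ p) (hq : RamPred κ q) : RamPred κ fun m σ => (p m σ ↔ q m σ) :=
  ((hp.imp hq).and (hq.imp hp)).of_iff fun m σ => by tauto

theorem lt (hf : RamComp κ f) (hg : RamComp κ g) : RamPred κ fun m σ => f m σ < g m σ :=
  (ne_zero (hg.sub hf)).of_iff fun m σ => by omega

theorem le (hf : RamComp κ f) (hg : RamComp κ g) : RamPred κ fun m σ => f m σ ≤ g m σ :=
  (lt hg hf).not.of_iff fun m σ => by omega

theorem eq (hf : RamComp κ f) (hg : RamComp κ g) : RamPred κ fun m σ => f m σ = g m σ :=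
  ((le hf hg).and (le hg hf)).of_iff fun m σ => by omega

theorem exists_lt {P : (ℕ → ℕ) → (ℕ → ℕ) → ℕ → Prop} (hf : RamComp 0 f)
    (hP : RamPred κ fun m σ => P m (envTail σ) (σ 0)) :
    RamPred κ fun m σ => ∃ x < f m σ, P m σ x :=
  (ne_zero (RamComp.sum (F := fun m σ x => propBit (P m σ x)) hf hP)).of_iff fun m σ => by
    simp only [ne_eq, Finset.sum_eq_zero_iff, not_forall, Finset.mem_range, exists_prop]
    simp only [← ne_eq, propBit_ne_zero]

theorem forall_lt {P : (ℕ → ℕ) → (ℕ → ℕ) → ℕ → Prop} (hf : RamComp 0 f)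
    (hP : RamPred κ fun m σ => P m (envTail σ) (σ 0)) :
    RamPred κ fun m σ => ∀ x < f m σ, P m σ x :=
  (exists_lt (P := fun m σ x => ¬P m σ x) hf hP.not).not.of_iff fun m σ => by simp

theorem testBit (hf : RamComp 0 f) (hg : RamComp 0 g) :
    RamPred 0 fun m σ => (f m σ).testBit (g m σ) := by
  obtain ⟨C, c, hC⟩ := RamComp.exists_pair hf hg
  refine ⟨fun ρ d => .seq (C ρ d) (.seq (.countdown (d + 1) (d + 2) (.half d d))
    (.seq (.half (d + 1) d) (.seq (.add (d + 1) (d + 1) (d + 1)) (.sub d d (d + 1))))),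
    c + c + 5, fun ρ d s U K hs => ?_⟩
  obtain ⟨hf, hg, s₁, hr₁, ha₁, hd₁, hd₁'⟩ := hC ρ d s U K hs
  have hU := hs.two_le
  simp only [zero_mul, pow_zero, mul_one, zero_add] at hf hg hr₁ ⊢
  set a := f s.mem (s.reg ∘ ρ)
  set b := g s.mem (s.reg ∘ ρ)
  obtain ⟨s₂, hr₂, ha₂, hd₂⟩ := RunsIn.exists_shiftRight_loop hd₁ hd₁' hf
  have hy : a / 2 ^ b ≤ U ^ c := (Nat.div_le_self _ _).trans hf
  have hbit : a.testBit b = decide (a / 2 ^ b % 2 = 1) := by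
    rw [Nat.testBit_eq_decide_div_mod_eq]
  set y := a / 2 ^ b
  refine ⟨(propBit_le_one _).trans (Nat.pow_pos (by omega)), _,
    (hr₁.seq (hr₂.seq ((RunsIn.half (d + 1) d s₂).seq ((RunsIn.add _ (d + 1) (d + 1) _).seq
      (RunsIn.sub d d (d + 1) _))))).mono ?_, (((ha₁.trans ha₂).setReg (by omega) _).setReg
      (by omega) _).setReg le_rfl _, ?_⟩
  · have hone : 1 ≤ U ^ c := Nat.pow_pos (by omega)
    have hcc : U ^ c ≤ U ^ c * U ^ c := Nat.le_mul_of_pos_right _ hone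
    have hpow := mul_le_pow_add_mul (c := c + c) (X := 1) (n := 32) (e := 5) hU le_rfl
    have hloop : b * (U ^ c + 2 * b.size + 6) ≤ U ^ c * (9 * U ^ c) :=
      Nat.mul_le_mul hg (by have := size_le_self b; omega)
    have h1 := size_le_self y
    have h2 := size_le_self (y / 2)
    have h3 : (y / 2 + y / 2).size ≤ y := (size_le_self _).trans (by omega)
    have h4 : U ^ c * (9 * U ^ c) = 9 * (U ^ c * U ^ c) := by ring
    have h5 : U ^ (c + c) = U ^ c * U ^ c := pow_add _ _ _
    simp only [RAMState.setReg_reg, if_true, if_false, hd₂, (Nat.succ_ne_self d).symm]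
    omega
  · simp only [RAMState.setReg_reg, if_true, if_false, hd₂, (Nat.succ_ne_self d).symm, hbit,
      propBit, decide_eq_true_eq]
    split_ifs <;> omega

end RamPred

namespace RamComp

variable {f g : (ℕ → ℕ) → (ℕ → ℕ) → ℕ}

theorem pair (hf : RamComp 0 f) (hg : RamComp 0 g) :
    RamComp 0 fun m σ => Nat.pair (f m σ) (g m σ) :=
  (ite (.lt hf hg) (.add (.mul hg hg) hf) (.add (.add (.mul hf hf) hf) hg)).of_eq
    fun m σ => by simp only [Nat.pair]

theorem size (hf : RamComp 0 f) : RamComp 0 fun m σ => (f m σ).size := by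
  have hlt : RamPred 0 fun m σ => σ 0 < (f m (envTail σ)).size :=
    RamPred.of_iff (.exists_lt
      (P := fun m σ y => σ 0 ≤ y ∧ (f m (envTail σ)).testBit y) (hf.tail.add (.const 1))
      (.and (.le (.var 1) (.var 0)) (.testBit hf.tail.tail (.var 0)))) fun m σ => by
      constructor
      · rintro ⟨y, -, hxy, hy⟩
        exact hxy.trans_lt (Nat.lt_size.2 (Nat.ge_two_pow_of_testBit hy))
      · intro hx
        obtain ⟨y, hxy, hy⟩ := Nat.exists_ge_and_testBit_of_ge_two_pow (Nat.lt_size.1 hx)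
        exact ⟨y, (Nat.lt_two_pow_self.trans_le (Nat.ge_two_pow_of_testBit hy)).trans
          (Nat.lt_succ_self _), hxy, hy⟩
  refine (sum (F := fun m σ x => propBit (x < (f m σ).size)) hf hlt).of_eq fun m σ => ?_
  have hset : {x ∈ Finset.range (f m σ) | x < (f m σ).size} = Finset.range (f m σ).size := by
    ext x
    have := size_le_self (f m σ)
    simp only [Finset.mem_filter, Finset.mem_range]
    omega
  calc ∑ x ∈ Finset.range (f m σ), propBit (x < (f m σ).size)
      = ∑ x ∈ Finset.range (f m σ), if x < (f m σ).size then 1 else 0 :=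
        Finset.sum_congr rfl fun x _ => by simp only [propBit]; congr
    _ = (f m σ).size := by rw [← Finset.card_filter, hset, Finset.card_range]

end RamComp

/-! ## Straight-line programs -/

/-- Started in a state that agrees with `x` in the memory and in the registers below `8`, the
program `P` halts within time `T` in a state that agrees with `y` there. The registers from `8` on
are scratch space. -/
def Transforms (P : RAMProgram) (x : RAMState) (T : ℕ) (y : RAMState) : Prop :=
  ∀ s, x.AgreesBelow 8 s → ∃ s', RunsIn P s T s' ∧ y.AgreesBelow 8 s'

/-- The registers `0, …, 6`, as an environment; register `7` is left for a loop counter. -/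
abbrev paramReg (i : ℕ) : ℕ := min i 6

/-- The values of the registers `0, …, 6`. -/
abbrev RAMState.params (s : RAMState) : ℕ → ℕ := s.reg ∘ paramReg

/-- The memory `m` with `v 0, …, v (N - 1)` written to the cells `β, …, β + N - 1`. -/
def overwrite (m : ℕ → ℕ) (β N : ℕ) (v : ℕ → ℕ) : ℕ → ℕ := fun a =>
  if β ≤ a ∧ a < β + N then v (a - β) else m a

namespace Transforms

variable {P Q : RAMProgram} {x y z : RAMState} {T T' : ℕ}

theorem seq (h : Transforms P x T y) (h' : Transforms Q y T' z) :
    Transforms (.seq P Q) x (T + T') z := fun s hs =>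
  let ⟨s₁, hr, hs₁⟩ := h s hs
  let ⟨s₂, hr', hs₂⟩ := h' s₁ hs₁
  ⟨s₂, hr.seq hr', hs₂⟩

theorem mono (h : Transforms P x T y) (hT : T ≤ T') : Transforms P x T' y := fun s hs =>
  let ⟨s', hr, hs'⟩ := h s hs
  ⟨s', hr.mono hT, hs'⟩

end Transforms

theorem RAMState.AgreesBelow.setReg_setReg {d : ℕ} {s s' : RAMState} (h : s.AgreesBelow d s')
    (i v : ℕ) : (s.setReg i v).AgreesBelow d (s'.setReg i v) :=
  ⟨h.1, fun j hj => by simp only [setReg_reg, h.2 j hj]⟩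

theorem RamComp.exists_assign {κ : ℕ} {f : (ℕ → ℕ) → (ℕ → ℕ) → ℕ} (hf : RamComp κ f) (r : ℕ) :
    ∃ P c, ∀ (s : RAMState) (U K : ℕ), BoundedEnv paramReg 8 s U K →
      Transforms P s (U ^ c * (κ * K + 1)) (s.setReg r (f s.mem s.params)) := by
  obtain ⟨C, c, hC⟩ := hf
  refine ⟨.seq (C paramReg 8) (.copy r 8), c + 2, fun s U K hs s' hs' => ?_⟩
  obtain ⟨hv, s₁, hr, ha, hd⟩ := hC paramReg 8 s' U K (hs.of_agreesBelow hs' le_rfl)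
  rw [hs'.1, hs.reg_comp_eq hs'] at hv hd
  have hcopy := RunsIn.copy r 8 s₁
  rw [hd] at hcopy
  refine ⟨_, (hr.seq hcopy).mono ?_, (hs'.trans ha).setReg_setReg r _⟩
  have h1 := size_le_of_le_mul_two_pow hs.two_le hv
  have h2 := mul_le_pow_add_mul (c := c) (X := κ * K + 1) (n := 3) (e := 2) hs.two_le (by norm_num)
  have h3 := hs.one_le_pow_mul c (κ * K)
  omega

theorem RunsIn.exists_doubling_loop {s : RAMState} {d F V : ℕ} (hd : s.reg d = F)
    (hF : 2 ^ F ≤ V) :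
    ∃ s', RunsIn (.seq (.const (d + 1) 1) (.countdown d (d + 2) (.add (d + 1) (d + 1) (d + 1))))
      s (F * (2 * V + 2 * F.size + 6) + 3) s' ∧ s.AgreesBelow d s' ∧ s'.reg (d + 1) = 2 ^ F := by
  let Inv : ℕ → RAMState → Prop := fun j s' => s.AgreesBelow d s' ∧ s'.reg d = j ∧
    s'.reg (d + 1) = 2 ^ (F - j)
  have hbody : ∀ j < F, ∀ s', Inv (j + 1) s' → ∃ s'',
      RunsIn (.add (d + 1) (d + 1) (d + 1)) ((s'.setReg (d + 2) 1).setReg d j) (2 * V + 1) s'' ∧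
        Inv j s'' := by
    rintro j hj s' ⟨ha, -, hpow⟩
    have hreg : ((s'.setReg (d + 2) 1).setReg d j).reg (d + 1) = 2 ^ (F - (j + 1)) := by
      simp [hpow]
    refine ⟨_, (RunsIn.add (d + 1) (d + 1) (d + 1) _).mono ?_,
      ((ha.setReg (by omega) 1).setReg le_rfl j).setReg (by omega) _, by simp, ?_⟩
    · have h1 : 2 ^ (F - (j + 1)) ≤ 2 ^ F := Nat.pow_le_pow_right (by norm_num) (by omega)
      have h2 := size_le_self (2 ^ (F - (j + 1)))
      rw [hreg]
      omega
    · rw [hreg, ← mul_two, ← pow_succ, show F - (j + 1) + 1 = F - j by omega]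
      simp
  obtain ⟨s', hr, ha, -, hpow⟩ := RunsIn.countdown Inv (by omega) (fun j s h => h.2.1) hbody
    (s := s.setReg (d + 1) 1)
    ⟨(RAMState.AgreesBelow.refl d s).setReg (by omega) 1, by simp [hd], by simp⟩
  refine ⟨s', ((RunsIn.const (d + 1) 1 s).seq hr).mono ?_, ha, by simpa using hpow⟩
  have : F * (2 * V + 1 + 2 * F.size + 5) = F * (2 * V + 2 * F.size + 6) := by ring
  simp only [Nat.size_one]
  omega

theorem RamComp.exists_assign_two_pow {f : (ℕ → ℕ) → (ℕ → ℕ) → ℕ} (hf : RamComp 0 f) (r : ℕ) :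
    ∃ P c, ∀ (s : RAMState) (U K : ℕ), BoundedEnv paramReg 8 s U K →
      2 ^ f s.mem s.params ≤ U → Transforms P s (U ^ c) (s.setReg r (2 ^ f s.mem s.params)) := by
  obtain ⟨C, c, hC⟩ := hf
  refine ⟨.seq (C paramReg 8) (.seq (.seq (.const 9 1) (.countdown 8 10 (.add 9 9 9)))
    (.copy r 9)), c + 6, fun s U K hs hF s' hs' => ?_⟩
  obtain ⟨-, s₁, hr₁, ha₁, hd₁⟩ := hC paramReg 8 s' U K (hs.of_agreesBelow hs' le_rfl)
  rw [hs'.1, hs.reg_comp_eq hs'] at hd₁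
  obtain ⟨s₂, hr₂, ha₂, hd₂⟩ := RunsIn.exists_doubling_loop hd₁ hF
  have hcopy := RunsIn.copy r 9 s₂
  rw [hd₂] at hcopy
  refine ⟨_, (hr₁.seq (hr₂.seq hcopy)).mono ?_, (hs'.trans (ha₁.trans ha₂)).setReg_setReg r _⟩
  simp only [zero_mul, zero_add, mul_one]
  set F := f s.mem s.params
  have hU := hs.two_le
  have hFU : F ≤ U := Nat.lt_two_pow_self.le.trans hF
  have hloop : F * (2 * U + 2 * F.size + 6) ≤ U * (7 * U) :=
    Nat.mul_le_mul hFU (by have := size_le_self F; omega)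
  have h1 := size_le_self (2 ^ F)
  have h2 : U ^ c ≤ U ^ (c + 2) := Nat.pow_le_pow_right (by omega) (by omega)
  have h3 : U ^ 2 ≤ U ^ (c + 2) := Nat.pow_le_pow_right (by omega) (by omega)
  have h4 := mul_le_pow_add_mul (c := c + 2) (X := 1) (n := 16) (e := 4) hU le_rfl
  rw [mul_one, mul_one, show c + 2 + 4 = c + 6 by omega] at h4
  have h5 : U * (7 * U) = 7 * U ^ 2 := by ring
  have h6 : U * 2 ≤ U ^ 2 := by nlinarith
  omega

theorem RamComp.exists_store {a g : (ℕ → ℕ) → (ℕ → ℕ) → ℕ} (ha : RamComp 0 a) (hg : RamComp 1 g) :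
    ∃ (C : (ℕ → ℕ) → ℕ → RAMProgram) (c : ℕ), ∀ (ρ : ℕ → ℕ) (d : ℕ) (s : RAMState) (U K : ℕ),
      BoundedEnv ρ d s U K → ∃ s', RunsIn (C ρ d) s (U ^ c * (K + 1)) s' ∧
        (s.setMem (a s.mem (s.reg ∘ ρ)) (g s.mem (s.reg ∘ ρ))).AgreesBelow d s' := by
  obtain ⟨C, c, hC⟩ := RamComp.exists_pair (ha.of_zero (κ := 1)) hg
  refine ⟨fun ρ d => .seq (C ρ d) (.store d (d + 1)), c + 2, fun ρ d s U K hs => ?_⟩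
  obtain ⟨hva, hvg, s', hr, hs', hd, hd'⟩ := hC ρ d s U K hs
  have hstore := RunsIn.store d (d + 1) s'
  rw [hd, hd'] at hstore
  have h1 := size_le_of_le_mul_two_pow hs.two_le hva
  have h2 := size_le_of_le_mul_two_pow hs.two_le hvg
  rw [one_mul] at hr h1 h2
  refine ⟨_, (hr.seq hstore).mono ?_, ?_, fun j hj => hs'.2 j hj⟩
  · have h3 := mul_le_pow_add_mul (c := c) (X := K + 1) (n := 4) (e := 2) hs.two_le le_rfl
    have h4 := hs.one_le_pow_mul c K
    omega
  · simp only [RAMState.setMem, hs'.1]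

theorem update_overwrite {m v : ℕ → ℕ} {β N j : ℕ} (hj : j < N) :
    Function.update (overwrite m β N fun y => if j + 1 ≤ y then v y else m (β + y)) (β + j) (v j) =
      overwrite m β N fun y => if j ≤ y then v y else m (β + y) := by
  funext a
  rcases eq_or_ne a (β + j) with rfl | ha
  · simp [overwrite, hj]
  · simp only [Function.update_of_ne ha, overwrite]
    grind

theorem overwrite_of_lt {m v v' : ℕ → ℕ} {β N : ℕ} (h : ∀ y < N, v y = v' y) :
    overwrite m β N v = overwrite m β N v' := by
  funext a
  simp only [overwrite]
  split_ifs with ha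
  · exact h _ (by omega)
  · rfl

theorem overwrite_self (m : ℕ → ℕ) (β N : ℕ) : overwrite m β N (fun y => m (β + y)) = m := by
  funext a
  simp only [overwrite]
  split_ifs with ha
  · rw [Nat.add_sub_cancel' ha.1]
  · rfl

theorem overwrite_le {m v : ℕ → ℕ} {β N V : ℕ} (hm : ∀ a, m a ≤ V) (hv : ∀ y < N, v y ≤ V)
    (a : ℕ) : overwrite m β N v a ≤ V := by
  simp only [overwrite]
  split_ifs with ha
  · exact hv _ (by omega)
  · exact hm a

theorem BoundedEnv.cons_counter {ρ : ℕ → ℕ} {d U K : ℕ} {s s' : RAMState}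
    (hs : BoundedEnv ρ d s U K) (hreg : ∀ i < d, s'.reg i = s.reg i) (hle : s'.reg d ≤ U)
    (hmem : ∀ a, s'.mem a ≤ 2 ^ K) :
    BoundedEnv (envCons d ρ) (d + 1) s' U K ∧
      s'.reg ∘ envCons d ρ = envCons (s'.reg d) (s.reg ∘ ρ) := by
  have hρ : ∀ i, s'.reg (ρ i) = s.reg (ρ i) := fun i => hreg _ (hs.lt i)
  have hs' : BoundedEnv ρ (d + 1) s' U K :=
    ⟨fun i => (hs.lt i).trans d.lt_succ_self, hs.two_le, fun i => (hρ i).trans_le (hs.reg_le i),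
      hmem⟩
  refine ⟨hs'.cons le_rfl d.lt_succ_self hle, funext fun i => ?_⟩
  cases i with
  | zero => rfl
  | succ i => exact hρ i

theorem fill_time_le {U N c X : ℕ} (hU : 2 ≤ U) (hN : N ≤ U) (hX : 0 < X) :
    1 + N.size + (N * (U ^ c * X + 2 * N.size + 5) + 1) ≤ U ^ (c + 2 + 4) * X := by
  have hpos : 0 < U ^ c * X := Nat.mul_pos (Nat.pow_pos (by omega)) hX
  have hsize := size_le_self N
  have h1 : U ≤ U * (U ^ c * X) := Nat.le_mul_of_pos_right _ hpos
  have h2 : U ^ c * X ≤ U * (U ^ c * X) := Nat.le_mul_of_pos_left _ (by omega)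
  have h3 : U * (U ^ c * X) ≤ U * (U * (U ^ c * X)) := Nat.le_mul_of_pos_left _ (by omega)
  have hloop : N * (U ^ c * X + 2 * N.size + 5) ≤ 8 * (U * (U * (U ^ c * X))) :=
    calc _ ≤ U * (8 * (U * (U ^ c * X))) := Nat.mul_le_mul hN (by omega)
      _ = _ := by ring
  calc 1 + N.size + (N * (U ^ c * X + 2 * N.size + 5) + 1)
      ≤ 16 * (U * (U * (U ^ c * X))) := by omega
    _ = 16 * (U ^ (c + 2) * X) := by ring
    _ ≤ U ^ (c + 2 + 4) * X := mul_le_pow_add_mul hU le_rfl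

/-- Writing the values of `g` to consecutive memory cells; their number is held by register `6`, and
they do not depend on the previous content of these cells. -/
theorem RamComp.exists_fill {b : (ℕ → ℕ) → ℕ} {g : (ℕ → ℕ) → (ℕ → ℕ) → ℕ}
    (hb : RamComp 0 fun _ σ => b σ) (hg : RamComp 1 g) :
    ∃ P c, ∀ (s : RAMState) (U K : ℕ), BoundedEnv paramReg 8 s U K → ∀ v : ℕ → ℕ,
      (∀ w, ∀ y < s.reg 6,
        g (overwrite s.mem (b s.params) (s.reg 6) w) (envCons y s.params) = v y) →
      (∀ y < s.reg 6, v y ≤ 2 ^ K) →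
      Transforms P s (U ^ c * (K + 1)) ⟨s.reg, overwrite s.mem (b s.params) (s.reg 6) v⟩ := by
  obtain ⟨C, c, hC⟩ := exists_store (a := fun _ σ => b (envTail σ) + σ 0) (hb.tail.add (.var 0)) hg
  refine ⟨.seq (.copy 8 6) (.countdown 8 9 (C (envCons 8 paramReg) 9)), c + 2 + 4,
    fun s U K hs v hv hle x hx => ?_⟩
  set N := s.reg 6
  set β := b s.params
  have hNU : N ≤ U := hs.reg_le 6
  set M : ℕ → ℕ → ℕ := fun j => overwrite s.mem β N fun y => if j ≤ y then v y else s.mem (β + y)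
  let Inv : ℕ → RAMState → Prop := fun j s' =>
    RAMState.AgreesBelow 8 ⟨s.reg, M j⟩ s' ∧ s'.reg 8 = j
  have hbody : ∀ j < N, ∀ s', Inv (j + 1) s' → ∃ s'',
      RunsIn (C (envCons 8 paramReg) 9) ((s'.setReg 9 1).setReg 8 j) (U ^ c * (K + 1)) s'' ∧
        Inv j s'' := by
    rintro j hj s' ⟨ha, -⟩
    set s₁ := (s'.setReg 9 1).setReg 8 j
    have ha₁ : RAMState.AgreesBelow 8 ⟨s.reg, M (j + 1)⟩ s₁ :=
      (ha.setReg (by norm_num) 1).setReg le_rfl j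
    have hj₁ : s₁.reg 8 = j := by simp [s₁]
    have hmem : s₁.mem = M (j + 1) := ha₁.1
    obtain ⟨hs₁, henv⟩ := hs.cons_counter ha₁.2 (by omega) fun a => by
      rw [hmem]
      exact overwrite_le hs.mem_le (fun y hy => by split_ifs; exacts [hle y hy, hs.mem_le _]) a
    obtain ⟨s₂, hr, ha₂⟩ := hC (envCons 8 paramReg) 9 s₁ U K hs₁
    rw [henv, hj₁, hmem, hv _ j hj] at ha₂
    refine ⟨s₂, hr, ⟨ha₂.1.trans ?_, fun i hi => (ha₂.2 i (by omega)).trans (ha₁.2 i hi)⟩,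
      (ha₂.2 8 (by norm_num)).trans hj₁⟩
    simp only [RAMState.setMem, hmem]
    exact update_overwrite hj
  have hM : M N = s.mem :=
    (overwrite_of_lt fun y hy => if_neg (by omega)).trans (overwrite_self s.mem β N)
  have hcopy := RunsIn.copy 8 6 x
  rw [hx.2 6 (by norm_num)] at hcopy
  obtain ⟨s', hr, ha, -⟩ := RunsIn.countdown Inv (by norm_num) (fun j s h => h.2) hbody
    (s := x.setReg 8 N) ⟨by rw [hM]; exact hx.setReg le_rfl N, by simp⟩
  exact ⟨s', (hcopy.seq hr).mono (fill_time_le hs.two_le hNU (Nat.succ_pos K)),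
    by simpa [M] using ha⟩

/-! ## Iterated vector-matrix products -/

/-- The numbers of ways of reaching the states `y < N` of an automaton with `S` letters. -/
noncomputable def pathCount (N S : ℕ) (start : ℕ → Prop) (next : ℕ → ℕ → ℕ → Prop) : ℕ → ℕ → ℕ
  | 0, y => propBit (start y)
  | t + 1, y => ∑ x ∈ Finset.range N, ∑ i ∈ Finset.range S,
      propBit (next i x y) * pathCount N S start next t x

theorem overwrite_apply_add {m v : ℕ → ℕ} {β N y : ℕ} (hy : y < N) :
    overwrite m β N v (β + y) = v y := by
  simp [overwrite, hy]

theorem overwrite_apply_of_lt {m v : ℕ → ℕ} {β N a : ℕ} (ha : a < β) :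
    overwrite m β N v a = m a := by
  simp only [overwrite, if_neg (show ¬(β ≤ a ∧ a < β + N) by omega)]

theorem overwrite_apply_of_le {m v : ℕ → ℕ} {β N a : ℕ} (ha : β + N ≤ a) :
    overwrite m β N v a = m a := by
  simp only [overwrite, if_neg (show ¬(β ≤ a ∧ a < β + N) by omega)]

/-- One multiplication of the vector in the memory cells below `σ 6` with the transition matrix. The
product is written to a second block of cells and copied back. -/
theorem exists_step_program {next : (ℕ → ℕ) → ℕ → ℕ → ℕ → Prop}
    (hnext : RamPred 0 fun _ σ => next (envTail (envTail (envTail σ))) (σ 0) (σ 1) (σ 2)) :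
    ∃ P c, ∀ (s : RAMState) (U K : ℕ), BoundedEnv paramReg 8 s U K → ∀ v v' : ℕ → ℕ,
      (∀ y < s.reg 6, s.mem y = v y) → (∀ y < s.reg 6, v' y = ∑ x ∈ Finset.range (s.reg 6),
        ∑ i ∈ Finset.range (s.reg 3), propBit (next s.params i x y) * v x) →
      (∀ y < s.reg 6, v' y ≤ 2 ^ K) →
      ∃ m, (∀ y < s.reg 6, m y = v' y) ∧ (∀ a, m a ≤ 2 ^ K) ∧
        Transforms P s (U ^ c * (K + 1)) ⟨s.reg, m⟩ := by
  have hg : RamComp 1 fun m σ => ∑ x ∈ Finset.range (σ 7), ∑ i ∈ Finset.range (σ 4),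
      propBit (next (envTail σ) i x (σ 0)) * m x :=
    .sum (F := fun m σ x => ∑ i ∈ Finset.range (σ 4), propBit (next (envTail σ) i x (σ 0)) * m x)
      (.var 7) (.sum (F := fun m σ i =>
        propBit (next (envTail (envTail σ)) i (σ 0) (σ 1)) * m (σ 0)) (.var 5)
        (.mul hnext (.read (.var 1))))
  obtain ⟨P₁, c₁, h₁⟩ := RamComp.exists_fill (b := fun σ => σ 6) (.var 6) hg
  obtain ⟨P₂, c₂, h₂⟩ := RamComp.exists_fill (b := fun _ => 0) (g := fun m σ => m (σ 7 + σ 0))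
    (.const 0) (.read (.add (.var 7) (.var 0)))
  refine ⟨.seq P₁ P₂, c₁ + c₂ + 1, fun s U K hs v v' hv hv' hle => ?_⟩
  have hprod : ∀ m : ℕ → ℕ, (∀ y < s.reg 6, m y = v y) → ∀ y < s.reg 6,
      ∑ x ∈ Finset.range (s.reg 6), ∑ i ∈ Finset.range (s.reg 3),
        propBit (next s.params i x y) * m x = v' y := fun m hm y hy =>
    (Finset.sum_congr rfl fun x hx => by rw [hm x (Finset.mem_range.1 hx)]).trans (hv' y hy).symm
  have hrun₁ := h₁ s U K hs v' (fun w => hprod _ fun x hx =>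
    (overwrite_apply_of_lt hx).trans (hv x hx)) hle
  set m₁ := overwrite s.mem (s.reg 6) (s.reg 6) v'
  have hm₁ : ∀ a, m₁ a ≤ 2 ^ K := overwrite_le hs.mem_le hle
  have hrun₂ := h₂ ⟨s.reg, m₁⟩ U K ⟨hs.lt, hs.two_le, hs.reg_le, hm₁⟩ v' (fun w y hy =>
    (overwrite_apply_of_le (by change 0 + s.reg 6 ≤ s.reg 6 + y; omega)).trans
      (overwrite_apply_add hy)) hle
  refine ⟨overwrite m₁ 0 (s.reg 6) v', fun y hy => ?_, overwrite_le hm₁ hle, ?_⟩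
  · simpa only [zero_add] using overwrite_apply_add (m := m₁) (β := 0) hy
  · refine (hrun₁.seq hrun₂).mono ?_
    have h3 := pow_mul_le_pow_mul (X := K + 1) hs.two_le (Nat.le_add_right c₁ c₂)
    have h4 := pow_mul_le_pow_mul (X := K + 1) hs.two_le (Nat.le_add_left c₂ c₁)
    have h5 := mul_le_pow_add_mul (c := c₁ + c₂) (X := K + 1) (n := 2) (e := 1) hs.two_le le_rfl
    omega

theorem iterate_time_le {U k c X : ℕ} (hU : 2 ≤ U) (hk : k < X) :
    k * (U ^ c * X + 2 * k.size + 5) + 1 ≤ U ^ (c + 3) * (X * (k + 1)) := by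
  have hsize := size_le_self k
  have hX : X ≤ U ^ c * X := Nat.le_mul_of_pos_left _ (Nat.pow_pos (by omega))
  calc k * (U ^ c * X + 2 * k.size + 5) + 1
      ≤ k * (8 * (U ^ c * X)) + 8 * (U ^ c * X) :=
        Nat.add_le_add (Nat.mul_le_mul_left _ (by omega)) (by omega)
    _ = 8 * (U ^ c * (X * (k + 1))) := by ring
    _ ≤ U ^ (c + 3) * (X * (k + 1)) := mul_le_pow_add_mul hU le_rfl

theorem exists_iterate_program {next : (ℕ → ℕ) → ℕ → ℕ → ℕ → Prop}
    (hnext : RamPred 0 fun _ σ => next (envTail (envTail (envTail σ))) (σ 0) (σ 1) (σ 2)) :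
    ∃ P c, ∀ (s : RAMState) (U K : ℕ), BoundedEnv paramReg 8 s U K → s.reg 7 ≤ K →
      ∀ v : ℕ → ℕ → ℕ, (∀ y < s.reg 6, s.mem y = v 0 y) →
      (∀ t, ∀ y < s.reg 6, v (t + 1) y = ∑ x ∈ Finset.range (s.reg 6),
        ∑ i ∈ Finset.range (s.reg 3), propBit (next s.params i x y) * v t x) →
      (∀ t ≤ s.reg 7, ∀ y < s.reg 6, v t y ≤ 2 ^ K) →
      ∃ s', RunsIn P s (U ^ c * ((K + 1) * (s.reg 7 + 1))) s' ∧ (∀ i < 7, s'.reg i = s.reg i) ∧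
        (∀ y < s.reg 6, s'.mem y = v (s.reg 7) y) ∧ ∀ a, s'.mem a ≤ 2 ^ K := by
  obtain ⟨P, c, hP⟩ := exists_step_program hnext
  refine ⟨.countdown 7 8 P, c + 3, fun s U K hs hk v hv₀ hv hle => ?_⟩
  set k := s.reg 7
  let Inv : ℕ → RAMState → Prop := fun j s' => s'.reg 7 = j ∧ (∀ i < 7, s'.reg i = s.reg i) ∧
    (∀ y < s.reg 6, s'.mem y = v (k - j) y) ∧ ∀ a, s'.mem a ≤ 2 ^ K
  have hbody : ∀ j < k, ∀ s', Inv (j + 1) s' → ∃ s'',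
      RunsIn P ((s'.setReg 8 1).setReg 7 j) (U ^ c * (K + 1)) s'' ∧ Inv j s'' := by
    rintro j hj s' ⟨-, hreg, hmem, hbound⟩
    set x := (s'.setReg 8 1).setReg 7 j
    have hx : ∀ i < 7, x.reg i = s.reg i := fun i hi => by
      simp [x, hi.ne, (hi.trans (by norm_num : 7 < 8)).ne, hreg i hi]
    have hparams : x.params = s.params := funext fun i => hx _ (by simp only [paramReg]; omega)
    have hstep := hv (k - (j + 1))
    rw [show k - (j + 1) + 1 = k - j by omega, ← hparams, ← hx 6 (by norm_num),
      ← hx 3 (by norm_num)] at hstep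
    rw [← hx 6 (by norm_num)] at hmem hle
    obtain ⟨m, hm, hbound', hrun⟩ := hP x U K ⟨hs.lt, hs.two_le,
      fun i => (congrFun hparams i).trans_le (hs.reg_le i), hbound⟩ (v (k - (j + 1))) (v (k - j))
      hmem hstep (hle _ (by omega))
    obtain ⟨s'', hr, ha⟩ := hrun x (.refl 8 x)
    refine ⟨s'', hr, ?_, fun i hi => (ha.2 i (by omega)).trans (hx i hi), ?_, ?_⟩
    · exact (ha.2 7 (by norm_num)).trans (by simp [x])
    · rw [← hx 6 (by norm_num), ha.1]
      exact hm
    · rw [ha.1]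
      exact hbound'
  obtain ⟨s', hr, -, hreg, hmem, hbound⟩ := RunsIn.countdown Inv (by norm_num) (fun j s h => h.1)
    hbody (s := s) ⟨rfl, fun i _ => rfl, by simpa using hv₀, hs.mem_le⟩
  exact ⟨s', hr.mono (iterate_time_le hs.two_le (Nat.lt_succ_of_le hk)), hreg, hmem, hbound⟩

theorem pow_mul_add_add_le {U a b c X : ℕ} (hU : 2 ≤ U) :
    U ^ a * X + (U ^ b * X + U ^ c * X) ≤ U ^ (a + b + c + 2) * X := by
  have ha := pow_mul_le_pow_mul (X := X) hU (show a ≤ a + b + c by omega)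
  have hb := pow_mul_le_pow_mul (X := X) hU (show b ≤ a + b + c by omega)
  have hc := pow_mul_le_pow_mul (X := X) hU (show c ≤ a + b + c by omega)
  calc U ^ a * X + (U ^ b * X + U ^ c * X) ≤ 3 * (U ^ (a + b + c) * X) := by omega
    _ ≤ U ^ (a + b + c + 2) * X := mul_le_pow_add_mul hU (by norm_num)

theorem exists_pathCount_program {start acc : (ℕ → ℕ) → ℕ → Prop}
    {next : (ℕ → ℕ) → ℕ → ℕ → ℕ → Prop}
    (hstart : RamPred 0 fun _ σ => start (envTail σ) (σ 0))
    (hnext : RamPred 0 fun _ σ => next (envTail (envTail (envTail σ))) (σ 0) (σ 1) (σ 2))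
    (hacc : RamPred 0 fun _ σ => acc (envTail σ) (σ 0)) :
    ∃ P c, ∀ (s : RAMState) (U K : ℕ), BoundedEnv paramReg 8 s U K → s.reg 7 ≤ K →
      (∀ t ≤ s.reg 7, ∀ y < s.reg 6,
        pathCount (s.reg 6) (s.reg 3) (start s.params) (next s.params) t y ≤ 2 ^ K) →
      RAMOutputsWithin P s (∑ x ∈ Finset.range (s.reg 6), propBit (acc s.params x) *
        pathCount (s.reg 6) (s.reg 3) (start s.params) (next s.params) (s.reg 7) x)
        (U ^ c * ((K + 1) * (s.reg 7 + 1))) := by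
  obtain ⟨P₁, c₁, h₁⟩ := RamComp.exists_fill (b := fun _ => 0) (.const 0) (hstart.of_zero (κ := 1))
  obtain ⟨P₂, c₂, h₂⟩ := exists_iterate_program hnext
  obtain ⟨P₃, c₃, h₃⟩ := RamComp.exists_assign (κ := 1)
    (f := fun m σ => ∑ x ∈ Finset.range (σ 6), propBit (acc σ x) * m x)
    (.sum (F := fun m σ x => propBit (acc σ x) * m x) (.var 6) (.mul hacc (.read (.var 0)))) 0
  refine ⟨.seq P₁ (.seq P₂ P₃), c₁ + c₂ + c₃ + 2, fun s U K hs hk hle => ?_⟩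
  set v := pathCount (s.reg 6) (s.reg 3) (start s.params) (next s.params)
  obtain ⟨s₁, hr₁, ha₁⟩ := h₁ s U K hs (v 0) (fun _ _ _ => rfl) (hle 0 (Nat.zero_le _)) s
    (.refl 8 s)
  have hreg₁ : ∀ i < 8, s₁.reg i = s.reg i := ha₁.2
  have hparams₁ : s₁.params = s.params := funext fun i => hreg₁ _ (hs.lt i)
  have hiterate := h₂ s₁ U K ⟨hs.lt, hs.two_le,
    fun i => (congrFun hparams₁ i).trans_le (hs.reg_le i), fun a => by
      rw [ha₁.1]; exact overwrite_le hs.mem_le (hle 0 (Nat.zero_le _)) a⟩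
  rw [hreg₁ 3 (by norm_num), hreg₁ 6 (by norm_num), hreg₁ 7 (by norm_num), hparams₁] at hiterate
  obtain ⟨s₂, hr₂, hreg₂, hmem₂, hbound₂⟩ := hiterate hk v (fun y hy => by
    simpa [ha₁.1] using overwrite_apply_add (m := s.mem) (β := 0) (v := v 0) hy)
    (fun t y _ => rfl) hle
  have hparams₂ : s₂.params = s.params := funext fun i =>
    (hreg₂ _ (by simp only [paramReg]; omega)).trans (hreg₁ _ (hs.lt i))
  have hassign := h₃ s₂ U K ⟨hs.lt, hs.two_le,
    fun i => (congrFun hparams₂ i).trans_le (hs.reg_le i), hbound₂⟩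
  obtain ⟨s₃, hr₃, ha₃⟩ := hassign s₂ (.refl 8 s₂)
  obtain ⟨t, hr, ht⟩ := hr₁.seq (hr₂.seq hr₃)
  refine ⟨t, s₃, hr, ht.trans ?_, (ha₃.2 0 (by norm_num)).trans ?_⟩
  · have hle (c : ℕ) : U ^ c * (K + 1) ≤ U ^ c * ((K + 1) * (s.reg 7 + 1)) :=
      Nat.mul_le_mul_left _ (Nat.le_mul_of_pos_right _ (Nat.succ_pos _))
    rw [one_mul]
    exact (Nat.add_le_add (hle c₁) (Nat.add_le_add_left (hle c₃) _)).trans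
      (pow_mul_add_add_le hs.two_le)
  · simp only [RAMState.setReg, Function.update_self, hparams₂]
    exact Finset.sum_congr rfl fun x hx => by rw [hmem₂ x (Finset.mem_range.1 hx)]

/-! ## Words and path counts -/

/-- The lists of length `t` of numbers less than `S`. -/
def words (S : ℕ) : ℕ → Finset (List ℕ)
  | 0 => {[]}
  | t + 1 => (Finset.range S ×ˢ words S t).image fun p => p.1 :: p.2

theorem cons_mem_words {S t a : ℕ} {u : List ℕ} :
    a :: u ∈ words S (t + 1) ↔ a < S ∧ u ∈ words S t := by
  simp [words]

theorem mem_words {S t : ℕ} {u : List ℕ} : u ∈ words S t ↔ u.length = t ∧ ∀ a ∈ u, a < S := by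
  induction t generalizing u with
  | zero => simp +contextual [words]
  | succ t ih =>
    cases u with
    | nil => simp [words]
    | cons a u =>
      rw [cons_mem_words, ih]
      simp only [List.length_cons, Nat.add_right_cancel_iff, List.forall_mem_cons]
      tauto

theorem sum_words_succ {S t : ℕ} (f : List ℕ → ℕ) :
    ∑ u ∈ words S (t + 1), f u = ∑ u ∈ words S t, ∑ a ∈ Finset.range S, f (a :: u) := by
  have hinj : Set.InjOn (fun p : ℕ × List ℕ => p.1 :: p.2)
      (Finset.range S ×ˢ words S t : Finset (ℕ × List ℕ)) := fun p _ q _ h =>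
    Prod.ext (List.cons.inj h).1 (List.cons.inj h).2
  rw [words, Finset.sum_image hinj, Finset.sum_product, Finset.sum_comm]

theorem card_words (S t : ℕ) : (words S t).card = S ^ t := by
  induction t with
  | zero => rfl
  | succ t ih =>
    rw [Finset.card_eq_sum_ones, sum_words_succ]
    simp [ih, pow_succ]

theorem sum_propBit_mul {N y : ℕ} (hy : y < N) (f : ℕ → ℕ) :
    ∑ x ∈ Finset.range N, propBit (y = x) * f x = f y := by
  simp [propBit, hy]

/-- The relations `start` and `next` describe the deterministic automaton with states below `N`,
letters below `S`, initial state `y₀` and transition function `step`. -/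
structure IsAutomaton (N S : ℕ) (start : ℕ → Prop) (next : ℕ → ℕ → ℕ → Prop) (y₀ : ℕ)
    (step : ℕ → ℕ → ℕ) : Prop where
  start_lt : y₀ < N
  step_lt : ∀ i x, step i x < N
  start_iff : ∀ y < N, start y ↔ y₀ = y
  next_iff : ∀ i < S, ∀ x < N, ∀ y < N, next i x y ↔ step i x = y

namespace IsAutomaton

variable {N S : ℕ} {start : ℕ → Prop} {next : ℕ → ℕ → ℕ → Prop} {y₀ : ℕ} {step : ℕ → ℕ → ℕ}

theorem foldr_lt (h : IsAutomaton N S start next y₀ step) (D : List ℕ) : D.foldr step y₀ < N := by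
  cases D with
  | nil => exact h.start_lt
  | cons i D => exact h.step_lt _ _

theorem pathCount_eq (h : IsAutomaton N S start next y₀ step) (t : ℕ) {y : ℕ} (hy : y < N) :
    pathCount N S start next t y = ∑ D ∈ words S t, propBit (D.foldr step y₀ = y) := by
  induction t generalizing y with
  | zero => simp [pathCount, words, h.start_iff y hy]
  | succ t ih =>
    have hcount : ∀ x ∈ Finset.range N, ∑ i ∈ Finset.range S,
        propBit (next i x y) * pathCount N S start next t x = ∑ D ∈ words S t,
          propBit (D.foldr step y₀ = x) * ∑ i ∈ Finset.range S, propBit (step i x = y) := by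
      intro x hx
      rw [Finset.mem_range] at hx
      rw [ih hx, ← Finset.sum_mul, ← Finset.sum_mul, Nat.mul_comm]
      congr 1
      exact Finset.sum_congr rfl fun i hi =>
        congrArg propBit (propext (h.next_iff i (Finset.mem_range.1 hi) x hx y hy))
    rw [pathCount, sum_words_succ, Finset.sum_congr rfl hcount, Finset.sum_comm]
    exact Finset.sum_congr rfl fun D _ => sum_propBit_mul (h.foldr_lt D) _

theorem pathCount_le (h : IsAutomaton N S start next y₀ step) (t : ℕ) {y : ℕ} (hy : y < N) :
    pathCount N S start next t y ≤ S ^ t := by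
  rw [h.pathCount_eq t hy, ← card_words, Finset.card_eq_sum_ones]
  exact Finset.sum_le_sum fun _ _ => propBit_le_one _

open Classical in
theorem sum_pathCount_eq (h : IsAutomaton N S start next y₀ step) (acc : ℕ → Prop) (t : ℕ) :
    ∑ x ∈ Finset.range N, propBit (acc x) * pathCount N S start next t x =
      ((words S t).filter fun D => acc (D.foldr step y₀)).card := by
  have hcount : ∀ x ∈ Finset.range N, propBit (acc x) * pathCount N S start next t x =
      ∑ D ∈ words S t, propBit (D.foldr step y₀ = x) * propBit (acc x) := fun x hx => by
    rw [h.pathCount_eq t (Finset.mem_range.1 hx), Finset.mul_sum]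
    exact Finset.sum_congr rfl fun _ _ => Nat.mul_comm _ _
  rw [Finset.sum_congr rfl hcount, Finset.sum_comm, Finset.card_filter]
  exact Finset.sum_congr rfl fun D _ => sum_propBit_mul (h.foldr_lt D) fun x => propBit (acc x)

end IsAutomaton

/-! ## Numbers as bit strings -/

open Classical in
/-- The number whose bits below `Q` are given by `X`. -/
noncomputable def ofBitPred (Q : ℕ) (X : ℕ → Prop) : ℕ :=
  Nat.ofBits fun q : Fin Q => decide (X q)

theorem ofBitPred_lt (Q : ℕ) (X : ℕ → Prop) : ofBitPred Q X < 2 ^ Q :=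
  Nat.ofBits_lt_two_pow _

theorem testBit_ofBitPred {Q q : ℕ} {X : ℕ → Prop} :
    (ofBitPred Q X).testBit q ↔ q < Q ∧ X q := by
  rcases lt_or_ge q Q with hq | hq
  · simp [ofBitPred, Nat.testBit_ofBits_lt _ _ hq, hq]
  · simp [ofBitPred, Nat.testBit_ofBits_ge _ _ hq, hq]

theorem forall_testBit_iff {Q x y : ℕ} (hx : x < 2 ^ Q) (hy : y < 2 ^ Q) :
    (∀ q < Q, (x.testBit q ↔ y.testBit q)) ↔ x = y := by
  refine ⟨fun h => Nat.eq_of_testBit_eq fun q => ?_, by rintro rfl; simp⟩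
  rcases lt_or_ge q Q with hq | hq
  · exact Bool.eq_iff_iff.2 (h q hq)
  · have hpow : 2 ^ Q ≤ 2 ^ q := Nat.pow_le_pow_right two_pos hq
    rw [Nat.testBit_eq_false_of_lt (hx.trans_le hpow),
      Nat.testBit_eq_false_of_lt (hy.trans_le hpow)]

theorem forall_testBit_iff_ofBitPred_eq {Q y : ℕ} (hy : y < 2 ^ Q) (X : ℕ → Prop) :
    (∀ q < Q, (y.testBit q ↔ X q)) ↔ ofBitPred Q X = y := by
  rw [← forall_testBit_iff (ofBitPred_lt Q X) hy]
  exact forall₂_congr fun q hq => by simp only [testBit_ofBitPred, hq, true_and, iff_comm]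

/-- The labels of `p` in `α` and of `p'` in `β` agree, where a number is a labelling of states by
strings of `B` bits. -/
def LabelEq (B α p β p' : ℕ) : Prop :=
  ∀ t < B, (α.testBit (p * B + t) ↔ β.testBit (p' * B + t))

theorem LabelEq.zero (B p p' : ℕ) : LabelEq B 0 p 0 p' := fun _ _ => by simp

theorem mul_add_lt_mul {i m x n : ℕ} (hi : i < m) (hx : x < n) : i * n + x < m * n :=
  calc i * n + x < (i + 1) * n := by rw [Nat.succ_mul]; omega
    _ ≤ m * n := Nat.mul_le_mul_right _ hi

theorem exists_labelling (W B : ℕ) (f : ℕ → ℕ) : ∃ α < 2 ^ (W * B), ∀ p < W, ∀ t < B,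
    (α.testBit (p * B + t) ↔ (f p).testBit t) := by
  refine ⟨ofBitPred (W * B) fun q => (f (q / B)).testBit (q % B), ofBitPred_lt _ _,
    fun p hp t ht => ?_⟩
  rw [testBit_ofBitPred, and_iff_right (mul_add_lt_mul hp ht), Nat.mul_comm p B,
    Nat.mul_add_div (by omega), Nat.div_eq_of_lt ht, add_zero, Nat.mul_add_mod, Nat.mod_eq_of_lt ht]

theorem exists_labellings (W : ℕ) {T : Type*} (F G : ℕ → T) :
    ∃ α < 2 ^ (W * W.size), ∃ β < 2 ^ (W * W.size), ∀ p < W, ∀ p' < W,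
      LabelEq W.size α p β p' ↔ F p = G p' := by
  classical
  let index : T → ℕ := fun x => ((List.range W).map F).idxOf x
  have hlt : ∀ x, index x < 2 ^ W.size := fun x =>
    List.idxOf_le_length.trans_lt (by simpa using Nat.lt_size_self W)
  obtain ⟨α, hα, hα'⟩ := exists_labelling W W.size fun p => index (F p)
  obtain ⟨β, hβ, hβ'⟩ := exists_labelling W W.size fun p => index (G p)
  refine ⟨α, hα, β, hβ, fun p hp p' hp' => ?_⟩
  have hlabel : LabelEq W.size α p β p' ↔ index (F p) = index (G p') := by
    rw [← forall_testBit_iff (hlt _) (hlt _)]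
    exact forall₂_congr fun t ht => iff_congr (hα' p hp t ht) (hβ' p' hp' t ht)
  rw [hlabel]
  exact List.idxOf_inj (List.mem_map_of_mem (List.mem_range.2 hp))

/-! ## Deterministic systems of layers -/

/-- A deterministic system of layers. There are `size` layers and `symbols` symbols, and each layer
`i` acts on the states below `states` by `trans i p a`; `start i` is the initial state of `i` if `i`
is initial, and `accepting i` describes the final states. The relation `glues h i` tells whether
the right states of `h` are the left states of `i`. States will be labelled by numbers below
`labels`. -/
structure DetSystem where
  size : ℕ
  states : ℕ
  symbols : ℕ
  labels : ℕ
  initial : ℕ → Prop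
  final : ℕ → Prop
  glues : ℕ → ℕ → Prop
  start : ℕ → ℕ
  trans : ℕ → ℕ → ℕ → ℕ
  accepting : ℕ → ℕ → Prop

/-- Codes of quintuples. -/
def quintuple (i j b α β : ℕ) : ℕ :=
  Nat.pair i (Nat.pair j (Nat.pair b (Nat.pair α β)))

theorem quintuple_inj {i j b α β i' j' b' α' β' : ℕ} :
    quintuple i j b α β = quintuple i' j' b' α' β' ↔
      i = i' ∧ j = j' ∧ b = b' ∧ α = α' ∧ β = β' := by
  simp [quintuple, Nat.pair_eq_pair]

theorem pair_lt_pow {a b M e : ℕ} (ha : a < M) (hb : b < M ^ (e + 1)) :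
    Nat.pair a b < M ^ (2 * (e + 1)) := by
  have hM : M ≤ M ^ (e + 1) := Nat.le_self_pow (by omega) _
  calc Nat.pair a b < (max a b + 1) ^ 2 := Nat.pair_lt_max_add_one_sq a b
    _ ≤ (M ^ (e + 1)) ^ 2 := Nat.pow_le_pow_left (by omega) _
    _ = _ := by rw [← pow_mul, Nat.mul_comm]

theorem quintuple_lt {i j b α β M : ℕ} (hi : i < M) (hj : j < M) (hb : b < M)
    (hα : α < M) (hβ : β < M) : quintuple i j b α β < M ^ 16 :=
  pair_lt_pow (e := 7) hi (pair_lt_pow (e := 3) hj (pair_lt_pow (e := 1) hb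
    (pair_lt_pow (e := 0) hα (by simpa using hβ))))

open Classical in
theorem ncard_image_eq_card_filter_minimal {α β : Type*} [LinearOrder α] (f : α → β)
    (A : Finset α) :
    (f '' A).ncard = (A.filter fun x => ∀ y ∈ A, f x = f y → x ≤ y).card := by
  set I := A.filter fun x => ∀ y ∈ A, f x = f y → x ≤ y
  have himage : f '' A = f '' I := by
    refine Set.Subset.antisymm ?_ (Set.image_mono (Finset.coe_subset.2 (Finset.filter_subset _ _)))
    rintro _ ⟨x, hx, rfl⟩
    obtain ⟨y, hy, hmin⟩ := (A.filter fun y => f y = f x).exists_min_image id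
      ⟨x, Finset.mem_filter.2 ⟨hx, rfl⟩⟩
    rw [Finset.mem_filter] at hy
    refine ⟨y, Finset.mem_filter.2 ⟨hy.1, fun z hz he => ?_⟩, hy.2⟩
    exact hmin z (Finset.mem_filter.2 ⟨hz, he.symm.trans hy.2⟩)
  have hinj : Set.InjOn f I := fun x hx y hy he =>
    have hx := Finset.mem_filter.1 hx
    have hy := Finset.mem_filter.1 hy
    le_antisymm (hx.2 y hy.1 he) (hy.2 x hx.1 he.symm)
  rw [himage, hinj.ncard_image, Set.ncard_coe_finset]

namespace DetSystem

variable (M : DetSystem)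

/-- The states stay in range, and there are enough labellings to distinguish all states. -/
structure Bounded : Prop where
  states_pos : 0 < M.states
  labels_eq : M.labels = 2 ^ (M.states * M.states.size)
  start_lt : ∀ i < M.size, M.initial i → M.start i < M.states
  trans_lt : ∀ i < M.size, ∀ p < M.states, ∀ a < M.symbols, M.trans i p a < M.states

open Classical in
/-- The action of the layers, where an initial layer acts on its initial state. -/
noncomputable def act (i p a : ℕ) : ℕ :=
  if M.initial i then M.trans i (M.start i) a else M.trans i p a

/-- The layer `i` may follow the layer `h`, or may come first if `h = M.size`. -/
def Follows (h i : ℕ) : Prop :=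
  (h = M.size ∧ M.initial i) ∨ (h ≠ M.size ∧ ¬M.initial i ∧ ¬M.final h ∧ M.glues h i)

/-- The last layer of a sequence of layers (which is its head: sequences grow at the left end). -/
abbrev last (D : List ℕ) : ℕ := D.headD M.size

/-- Sequences of layers that fit together. -/
def Valid : List ℕ → Prop
  | [] => True
  | i :: D => i < M.size ∧ M.Follows (M.last D) i ∧ Valid D

/-- The state that is reached by a sequence of layers on a string; both are given from right to
left. -/
noncomputable def run : List ℕ → List ℕ → ℕ
  | i :: D, a :: u => M.act i (run D u) a
  | _, _ => 0

/-- The string `u` is accepted by the sequence `D` of layers. -/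
def Accepts (D u : List ℕ) : Prop := M.accepting (M.last D) (M.run D u)

/-- Sequences of layers that start with an initial layer and end with a final layer. -/
def Full (D : List ℕ) : Prop := M.Valid D ∧ M.final (M.last D)

/-- The labellings `α` and `β` certify a relation between `D` and `D'`: the states that the two
sequences reach on the same string have the same label. -/
def Certifies (D D' : List ℕ) (α β : ℕ) : Prop :=
  ∀ u ∈ words M.symbols D.length, LabelEq M.states.size α (M.run D u) β (M.run D' u)

/-- The labels of the states before two layers `i` and `j` determine those after them. -/
def Compat (α₀ β₀ i j α β : ℕ) : Prop :=
  ∀ p < M.states, ∀ p' < M.states, LabelEq M.states.size α₀ p β₀ p' → ∀ a < M.symbols,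
    LabelEq M.states.size α (M.act i p a) β (M.act j p' a)

/-- The labels of the states after two layers `i` and `j` determine acceptance. -/
def AcceptCompat (i j α β : ℕ) : Prop :=
  ∀ p < M.states, ∀ p' < M.states, LabelEq M.states.size α p β p' →
    (M.accepting i p ↔ M.accepting j p')

/-- The profile of the empty sequence. -/
def StartBit (q : ℕ) : Prop :=
  ∃ α < M.labels, ∃ β < M.labels, LabelEq M.states.size α 0 β 0 ∧
    q = quintuple M.size M.size 0 α β

/-- The change of the profile `X` of a sequence by the layer `i`. -/
def NextBit (X : ℕ → Prop) (i q : ℕ) : Prop :=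
  ∃ i₀ < M.size + 1, ∃ j₀ < M.size + 1, ∃ b₀ < 2, ∃ α₀ < M.labels, ∃ β₀ < M.labels,
    X (quintuple i₀ j₀ b₀ α₀ β₀) ∧ i < M.size ∧ M.Follows i₀ i ∧ ∃ j < M.size, M.Follows j₀ j ∧
      ∃ α < M.labels, ∃ β < M.labels, M.Compat α₀ β₀ i j α β ∧
        q = quintuple i j (propBit (j < i ∨ (j = i ∧ b₀ ≠ 0))) α β

/-- The profile of a sequence `D` of layers: the codes of `(last D, last D', [D' < D], α, β)`, for
all sequences `D'` of the same length and all labellings `α` and `β` that certify a relation between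
`D` and `D'`. It determines whether `D` is minimal, and is computed layer by layer. -/
def Profile : List ℕ → ℕ → Prop
  | [] => M.StartBit
  | i :: D => M.NextBit (Profile D) i

/-- The profile `X` belongs to a full sequence that is minimal among the full sequences that accept
the same strings. -/
def MinimalProfile (X : ℕ → Prop) : Prop :=
  (∃ i < M.size, ∃ j < M.size, ∃ b < 2, ∃ α < M.labels, ∃ β < M.labels,
    X (quintuple i j b α β) ∧ M.final i) ∧
  ¬∃ i < M.size, ∃ j < M.size, ∃ α < M.labels, ∃ β < M.labels,
    X (quintuple i j 1 α β) ∧ M.final i ∧ M.final j ∧ M.AcceptCompat i j α β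

variable {M}

theorem Valid.mem_words {D : List ℕ} (h : M.Valid D) : D ∈ words M.size D.length := by
  induction D with
  | nil => simp [words]
  | cons i D ih => exact cons_mem_words.2 ⟨h.1, ih h.2.2⟩

theorem last_lt_succ {D : List ℕ} (h : M.Valid D) : M.last D < M.size + 1 := by
  cases D with
  | nil => exact Nat.lt_succ_self _
  | cons i D => exact h.1.trans (Nat.lt_succ_self _)

theorem last_lt {D : List ℕ} (h : M.Valid D) (hD : 0 < D.length) : M.last D < M.size := by
  cases D with
  | nil => simp at hD
  | cons i D => exact h.1

namespace Bounded

theorem labels_pos (hM : M.Bounded) : 0 < M.labels := hM.labels_eq ▸ Nat.two_pow_pos _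

theorem act_lt (hM : M.Bounded) {i p a : ℕ} (hi : i < M.size) (hp : p < M.states)
    (ha : a < M.symbols) : M.act i p a < M.states := by
  unfold act
  split_ifs with hinit
  · exact hM.trans_lt i hi _ (hM.start_lt i hi hinit) a ha
  · exact hM.trans_lt i hi p hp a ha

theorem run_lt (hM : M.Bounded) {D u : List ℕ} (hD : M.Valid D)
    (hu : u ∈ words M.symbols D.length) : M.run D u < M.states := by
  induction D generalizing u with
  | nil => simpa [run] using hM.states_pos
  | cons i D ih =>
    cases u with
    | nil => simpa [run] using hM.states_pos
    | cons a u =>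
      obtain ⟨ha, hu⟩ := cons_mem_words.1 hu
      exact hM.act_lt hD.1 (ih hD.2.2 hu) ha

variable {D D' : List ℕ}

theorem exists_certificate (hM : M.Bounded) (hD : M.Valid D) (hD' : M.Valid D')
    (hlen : D'.length = D.length) {T : Type*} {F G : ℕ → T}
    (hFG : ∀ u ∈ words M.symbols D.length, F (M.run D u) = G (M.run D' u)) :
    ∃ α < M.labels, ∃ β < M.labels, M.Certifies D D' α β ∧
      ∀ p < M.states, ∀ p' < M.states, LabelEq M.states.size α p β p' → F p = G p' := by
  obtain ⟨α, hα, β, hβ, hlab⟩ := exists_labellings M.states F G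
  rw [hM.labels_eq]
  exact ⟨α, hα, β, hβ,
    fun u hu => (hlab _ (hM.run_lt hD hu) _ (hM.run_lt hD' (hlen ▸ hu))).2 (hFG u hu),
    fun p hp p' hp' => (hlab p hp p' hp').1⟩

theorem certifies_cons_iff (hM : M.Bounded) (hD : M.Valid D) (hD' : M.Valid D')
    (hlen : D'.length = D.length) {i j α β : ℕ} :
    M.Certifies (i :: D) (j :: D') α β ↔ ∃ α₀ < M.labels, ∃ β₀ < M.labels,
      M.Certifies D D' α₀ β₀ ∧ M.Compat α₀ β₀ i j α β := by
  constructor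
  · intro hcert
    obtain ⟨α₀, hα₀, β₀, hβ₀, hcert₀, hcompat⟩ := hM.exists_certificate hD hD' hlen
      (F := fun p a t => a < M.symbols → t < M.states.size →
        (α.testBit (M.act i p a * M.states.size + t) : Prop))
      (G := fun p a t => a < M.symbols → t < M.states.size →
        (β.testBit (M.act j p a * M.states.size + t) : Prop))
      fun u hu => funext₂ fun a t => propext <| forall₂_congr fun ha ht =>
        hcert (a :: u) (cons_mem_words.2 ⟨ha, hu⟩) t ht
    refine ⟨α₀, hα₀, β₀, hβ₀, hcert₀, fun p hp p' hp' hpp' a ha t ht => ?_⟩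
    simpa only [ha, ht, forall_const] using
      iff_of_eq (congrFun₂ (hcompat p hp p' hp' hpp') a t)
  · rintro ⟨α₀, -, β₀, -, hcert, hcompat⟩ (_ | ⟨a, u⟩) hu
    · simp [mem_words] at hu
    · obtain ⟨ha, hu⟩ := cons_mem_words.1 hu
      exact hcompat _ (hM.run_lt hD hu) _ (hM.run_lt hD' (hlen ▸ hu)) (hcert u hu) a ha

theorem forall_accepts_iff (hM : M.Bounded) (hD : M.Valid D) (hD' : M.Valid D')
    (hlen : D'.length = D.length) :
    (∀ u ∈ words M.symbols D.length, (M.Accepts D u ↔ M.Accepts D' u)) ↔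
      ∃ α < M.labels, ∃ β < M.labels, M.Certifies D D' α β ∧
        M.AcceptCompat (M.last D) (M.last D') α β := by
  constructor
  · intro hacc
    obtain ⟨α, hα, β, hβ, hcert, hcompat⟩ := hM.exists_certificate hD hD' hlen
      (F := M.accepting (M.last D)) (G := M.accepting (M.last D'))
      fun u hu => propext (hacc u hu)
    exact ⟨α, hα, β, hβ, hcert, fun p hp p' hp' h => iff_of_eq (hcompat p hp p' hp' h)⟩
  · rintro ⟨α, -, β, -, hcert, hcompat⟩ u hu
    exact hcompat _ (hM.run_lt hD hu) _ (hM.run_lt hD' (hlen ▸ hu)) (hcert u hu)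

theorem profile_iff (hM : M.Bounded) (D : List ℕ) (q : ℕ) :
    M.Profile D q ↔ M.Valid D ∧ ∃ D', M.Valid D' ∧ D'.length = D.length ∧
      ∃ α < M.labels, ∃ β < M.labels, M.Certifies D D' α β ∧
        q = quintuple (M.last D) (M.last D') (propBit (D' < D)) α β := by
  induction D generalizing q with
  | nil =>
    have hbit : propBit (([] : List ℕ) < []) = 0 := by simp [propBit]
    simp only [Profile, StartBit, Valid, Certifies, true_and, List.length_nil,
      List.length_eq_zero_iff, words, Finset.mem_singleton, forall_eq, run]
    exact ⟨fun ⟨α, hα, β, hβ, h, hq⟩ => ⟨[], trivial, rfl, α, hα, β, hβ, h, hbit ▸ hq⟩,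
      fun ⟨_, _, rfl, α, hα, β, hβ, h, hq⟩ => ⟨α, hα, β, hβ, h, hbit ▸ hq⟩⟩
  | cons i D ih =>
    have hbit : ∀ j D', (j < i ∨ (j = i ∧ propBit (D' < D) ≠ 0)) = (j :: D' < i :: D) :=
      fun j D' => by rw [propBit_ne_zero, List.cons_lt_cons_iff]
    constructor
    · rintro ⟨i₀, -, j₀, -, b₀, -, α₀, hα₀, β₀, hβ₀, hX, hi, hi₀, j, hj, hj₀, α, hα, β, hβ, hc, rfl⟩
      obtain ⟨hD, D', hD', hlen, α₁, -, β₁, -, hcert, he⟩ := (ih _).1 hX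
      obtain ⟨rfl, rfl, rfl, rfl, rfl⟩ := quintuple_inj.1 he
      exact ⟨⟨hi, hi₀, hD⟩, j :: D', ⟨hj, hj₀, hD'⟩, congrArg (· + 1) hlen, α, hα, β, hβ,
        (hM.certifies_cons_iff hD hD' hlen).2 ⟨α₀, hα₀, β₀, hβ₀, hcert, hc⟩, by rw [hbit]; rfl⟩
    · rintro ⟨⟨hi, hiD, hD⟩, _ | ⟨j, D'⟩, hD'', hlen, α, hα, β, hβ, hcert, rfl⟩
      · simp at hlen
      obtain ⟨hj, hjD, hD'⟩ := hD''
      have hlen : D'.length = D.length := Nat.succ_injective hlen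
      obtain ⟨α₀, hα₀, β₀, hβ₀, hcert₀, hc⟩ := (hM.certifies_cons_iff hD hD' hlen).1 hcert
      exact ⟨M.last D, last_lt_succ hD, M.last D', last_lt_succ hD', propBit (D' < D),
        (propBit_le_one _).trans_lt one_lt_two, α₀, hα₀, β₀, hβ₀,
        (ih _).2 ⟨hD, D', hD', hlen, α₀, hα₀, β₀, hβ₀, hcert₀, rfl⟩,
        hi, hiD, j, hj, hjD, α, hα, β, hβ, hc, by rw [hbit]; rfl⟩

theorem minimalProfile_iff (hM : M.Bounded) (hlen : 0 < D.length) :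
    M.MinimalProfile (M.Profile D) ↔ M.Full D ∧ ∀ D', M.Full D' → D'.length = D.length →
      (∀ u ∈ words M.symbols D.length, (M.Accepts D u ↔ M.Accepts D' u)) → D ≤ D' := by
  refine (and_congr_left' (b := M.Full D) ?_).trans (and_congr_right fun hF => ?_)
  · constructor
    · rintro ⟨i, -, j, -, b, -, α, -, β, -, hX, hi⟩
      obtain ⟨hD, D', -, -, α₁, -, β₁, -, -, he⟩ := (hM.profile_iff D _).1 hX
      obtain ⟨rfl, -⟩ := quintuple_inj.1 he
      exact ⟨hD, hi⟩
    · rintro ⟨hD, hfinal⟩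
      exact ⟨M.last D, last_lt hD hlen, M.last D, last_lt hD hlen, propBit (D < D),
        (propBit_le_one _).trans_lt one_lt_two, 0, hM.labels_pos, 0, hM.labels_pos,
        (hM.profile_iff D _).2 ⟨hD, D, hD, rfl, 0, hM.labels_pos, 0, hM.labels_pos,
          fun u _ => LabelEq.zero _ _ _, rfl⟩, hfinal⟩
  · constructor
    · intro h D' hD' hlen' hacc
      by_contra! hlt
      obtain ⟨α, hα, β, hβ, hcert, hcompat⟩ :=
        (hM.forall_accepts_iff hF.1 hD'.1 hlen').1 hacc
      exact h ⟨M.last D, last_lt hF.1 hlen, M.last D', last_lt hD'.1 (hlen' ▸ hlen), α, hα, β, hβ,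
        (hM.profile_iff D _).2 ⟨hF.1, D', hD'.1, hlen', α, hα, β, hβ, hcert,
          by rw [propBit_of_true hlt]⟩, hF.2, hD'.2, hcompat⟩
    · rintro h ⟨i, -, j, -, α, hα, β, hβ, hX, -, hj, hcompat⟩
      obtain ⟨hD, D', hD', hlen', α₁, -, β₁, -, hcert, he⟩ := (hM.profile_iff D _).1 hX
      obtain ⟨rfl, rfl, hbit, rfl, rfl⟩ := quintuple_inj.1 he
      refine (h D' ⟨hD', hj⟩ hlen' ?_).not_gt (propBit_ne_zero.1 (by omega))
      exact (hM.forall_accepts_iff hD hD' hlen').2 ⟨α, hα, β, hβ, hcert, hcompat⟩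

end Bounded

variable (M)

/-- The number of the profile of the empty sequence. -/
noncomputable def startNum (Q : ℕ) : ℕ := ofBitPred Q M.StartBit

/-- The action of a layer on the numbers of profiles. -/
noncomputable def nextNum (Q i x : ℕ) : ℕ := ofBitPred Q (M.NextBit (fun q => x.testBit q) i)

variable {M}

theorem Profile.lt {Q : ℕ} (hQ : (M.labels + M.size + 2) ^ 16 ≤ Q) {D : List ℕ} {q : ℕ}
    (h : M.Profile D q) : q < Q := by
  refine lt_of_lt_of_le ?_ hQ
  cases D with
  | nil =>
    obtain ⟨α, hα, β, hβ, -, rfl⟩ := h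
    apply quintuple_lt <;> omega
  | cons i D =>
    obtain ⟨i₀, -, j₀, -, b₀, -, α₀, -, β₀, -, -, hi, -, j, hj, -, α, hα, β, hβ, -, rfl⟩ := h
    have := propBit_le_one (j < i ∨ (j = i ∧ b₀ ≠ 0))
    apply quintuple_lt <;> omega

theorem testBit_foldr_nextNum {Q : ℕ} (hQ : (M.labels + M.size + 2) ^ 16 ≤ Q) (D : List ℕ) :
    (fun q => ((D.foldr (M.nextNum Q) (M.startNum Q)).testBit q : Prop)) = M.Profile D := by
  induction D with
  | nil => exact funext fun q => propext (testBit_ofBitPred.trans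
      (and_iff_right_of_imp (Profile.lt hQ (D := []))))
  | cons i D ih =>
    rw [List.foldr_cons, nextNum, ih]
    exact funext fun q => propext (testBit_ofBitPred.trans
      (and_iff_right_of_imp (Profile.lt hQ (D := i :: D))))

open Classical in
theorem Bounded.card_filter_minimalProfile (hM : M.Bounded) {k Q : ℕ} (hk : 0 < k)
    (hQ : (M.labels + M.size + 2) ^ 16 ≤ Q) {T : Type*} (F : List ℕ → T)
    (hF : ∀ D D', F D = F D' ↔ ∀ u ∈ words M.symbols k, (M.Accepts D u ↔ M.Accepts D' u)) :
    ((words M.size k).filter fun D => M.MinimalProfile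
      fun q => (D.foldr (M.nextNum Q) (M.startNum Q)).testBit q).card =
      (F '' {D | M.Full D ∧ D.length = k}).ncard := by
  have hfull : {D | M.Full D ∧ D.length = k} = (words M.size k).filter M.Full := by
    ext D
    simp only [Set.mem_ofPred_eq, Finset.coe_filter]
    exact ⟨fun ⟨hD, hlen⟩ => ⟨hlen ▸ hD.1.mem_words, hD⟩, fun ⟨hw, hD⟩ => ⟨hD, (mem_words.1 hw).1⟩⟩
  rw [hfull, ncard_image_eq_card_filter_minimal, Finset.filter_filter]
  refine congrArg Finset.card (Finset.filter_congr fun D hD => ?_)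
  obtain rfl := (mem_words.1 hD).1
  rw [testBit_foldr_nextNum hQ, hM.minimalProfile_iff hk]
  refine and_congr_right fun _ => forall_congr' fun D' => ?_
  rw [hF, Finset.mem_filter, and_imp]
  exact ⟨fun h hw hD' => h hD' (mem_words.1 hw).1, fun h hD' hlen => h (hlen ▸ hD'.1.mem_words) hD'⟩

end DetSystem

/-! ## Systems of encoded layers -/

/-- A list of layers that is encoded by numbers: the sizes of the alphabet and of the list, the
width, and the number `bits` whose binary digits are the bits of the layers. The numbers of states
and of labellings of the deterministic system that interprets the layers belong to the code because
they are exponential in the other components, whereas a computation in the sense of `RamComp` is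
polynomial. -/
structure LayerCode where
  symbols : ℕ
  width : ℕ
  states : ℕ
  size : ℕ
  bits : ℕ
  labels : ℕ

/-- The number of bits of a layer over `n` symbols of width `w`. -/
def layerBits (n w : ℕ) : ℕ := 2 + (w + w + w + w) + w * (n * w)

namespace LayerCode

variable (e : LayerCode)

/-- The code whose components are the first six variables. -/
def ofEnv (σ : ℕ → ℕ) : LayerCode := ⟨σ 0, σ 1, σ 2, σ 3, σ 4, σ 5⟩

/-- The bit `x` of the layer `i`. -/
def Bit (i x : ℕ) : Prop := e.bits.testBit (i * layerBits e.symbols e.width + x)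

/-- `q` is a left state of the layer `i`. -/
abbrev Left (i q : ℕ) : Prop := e.Bit i (2 + q)

/-- `q` is a right state of the layer `i`. -/
abbrev Right (i q : ℕ) : Prop := e.Bit i (2 + (e.width + q))

/-- `q` is an initial state of the layer `i`. -/
abbrev Initial (i q : ℕ) : Prop := e.Bit i (2 + (e.width + (e.width + q)))

/-- `q` is a final state of the layer `i`. -/
abbrev Final (i q : ℕ) : Prop := e.Bit i (2 + (e.width + (e.width + (e.width + q))))

/-- `(p, a, q)` is a transition of the layer `i`. -/
abbrev Trans (i p a q : ℕ) : Prop :=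
  e.Bit i (2 + (e.width + (e.width + (e.width + (e.width +
    (p * (e.symbols * e.width) + (a * e.width + q)))))))

/-- A bound for the codes that occur in profiles and for the number of digits of `bits`. -/
def codeBound : ℕ := (e.labels + e.size + layerBits e.symbols e.width + 2) ^ 16

end LayerCode

/-- A way to interpret encoded layers as deterministic layers. -/
structure Interpretation where
  /-- The number of states, as a function of the width. -/
  states : ℕ → ℕ
  start : LayerCode → ℕ → ℕ
  trans : LayerCode → ℕ → ℕ → ℕ → ℕ
  accepting : LayerCode → ℕ → ℕ → Prop

/-- The deterministic system that interprets a code. -/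
def Interpretation.system (I : Interpretation) (e : LayerCode) : DetSystem where
  size := e.size
  states := e.states
  symbols := e.symbols
  labels := e.labels
  initial i := e.Bit i 0
  final i := e.Bit i 1
  glues i j := ∀ q < e.width, (e.Right i q ↔ e.Left j q)
  start := I.start e
  trans := I.trans e
  accepting := I.accepting e

/-- All components of a code that depends on the memory and on the variables are computable. -/
structure RamCode (e : (ℕ → ℕ) → (ℕ → ℕ) → LayerCode) : Prop where
  symbols : RamComp 0 fun m σ => (e m σ).symbols
  width : RamComp 0 fun m σ => (e m σ).width
  states : RamComp 0 fun m σ => (e m σ).states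
  size : RamComp 0 fun m σ => (e m σ).size
  bits : RamComp 0 fun m σ => (e m σ).bits
  labels : RamComp 0 fun m σ => (e m σ).labels

/-- The components of the interpretation are computable. -/
structure Interpretation.Computable (I : Interpretation) : Prop where
  states : ∃ P c, ∀ s U, BoundedEnv paramReg 8 s U 0 → I.states (s.reg 1) ≤ U →
    Transforms P s (U ^ c) (s.setReg 2 (I.states (s.reg 1)))
  start : ∀ {e f}, RamCode e → RamComp 0 f → RamComp 0 fun m σ => I.start (e m σ) (f m σ)
  trans : ∀ {e f g h}, RamCode e → RamComp 0 f → RamComp 0 g → RamComp 0 h →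
    RamComp 0 fun m σ => I.trans (e m σ) (f m σ) (g m σ) (h m σ)
  accepting : ∀ {e f g}, RamCode e → RamComp 0 f → RamComp 0 g →
    RamPred 0 fun m σ => I.accepting (e m σ) (f m σ) (g m σ)

namespace RamCode

variable {e : (ℕ → ℕ) → (ℕ → ℕ) → LayerCode} {f g h p : (ℕ → ℕ) → (ℕ → ℕ) → ℕ}

theorem ofEnv : RamCode fun _ σ => .ofEnv σ :=
  ⟨.var 0, .var 1, .var 2, .var 3, .var 4, .var 5⟩

theorem tail (he : RamCode e) : RamCode fun m σ => e m (envTail σ) :=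
  ⟨he.symbols.tail, he.width.tail, he.states.tail, he.size.tail, he.bits.tail, he.labels.tail⟩

theorem layerBits (he : RamCode e) :
    RamComp 0 fun m σ => layerBits (e m σ).symbols (e m σ).width :=
  .add (.add (.const 2) (.add (.add (.add he.width he.width) he.width) he.width))
    (.mul he.width (.mul he.symbols he.width))

theorem codeBound (he : RamCode e) : RamComp 0 fun m σ => (e m σ).codeBound :=
  .pow (.add (.add (.add he.labels he.size) he.layerBits) (.const 2)) 16

theorem bit (he : RamCode e) (hf : RamComp 0 f) (hg : RamComp 0 g) :
    RamPred 0 fun m σ => (e m σ).Bit (f m σ) (g m σ) :=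
  .testBit he.bits (.add (.mul hf he.layerBits) hg)

theorem bit_initial (he : RamCode e) (hf : RamComp 0 f) (hp : RamComp 0 p) :
    RamPred 0 fun m σ => (e m σ).Initial (f m σ) (p m σ) :=
  he.bit hf (.add (.const 2) (.add he.width (.add he.width hp)))

theorem bit_final (he : RamCode e) (hf : RamComp 0 f) (hp : RamComp 0 p) :
    RamPred 0 fun m σ => (e m σ).Final (f m σ) (p m σ) :=
  he.bit hf (.add (.const 2) (.add he.width (.add he.width (.add he.width hp))))

theorem bit_trans (he : RamCode e) (hf : RamComp 0 f) (hp : RamComp 0 p) (hg : RamComp 0 g)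
    (hh : RamComp 0 h) : RamPred 0 fun m σ => (e m σ).Trans (f m σ) (p m σ) (g m σ) (h m σ) :=
  he.bit hf (.add (.const 2) (.add he.width (.add he.width (.add he.width (.add he.width
    (.add (.mul hp (.mul he.symbols he.width)) (.add (.mul hg he.width) hh)))))))

theorem glues (he : RamCode e) (hf : RamComp 0 f) (hg : RamComp 0 g) :
    RamPred 0 fun m σ => ∀ q < (e m σ).width, ((e m σ).Right (f m σ) q ↔ (e m σ).Left (g m σ) q) :=
  .forall_lt he.width <| .iff
    (he.tail.bit hf.tail (.add (.const 2) (.add he.tail.width (.var 0))))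
    (he.tail.bit hg.tail (.add (.const 2) (.var 0)))

end RamCode

theorem RamPred.labelEq {B α p β p' : (ℕ → ℕ) → (ℕ → ℕ) → ℕ} (hB : RamComp 0 B)
    (hα : RamComp 0 α) (hp : RamComp 0 p) (hβ : RamComp 0 β) (hp' : RamComp 0 p') :
    RamPred 0 fun m σ => LabelEq (B m σ) (α m σ) (p m σ) (β m σ) (p' m σ) :=
  .forall_lt hB (.iff (.testBit hα.tail (.add (.mul hp.tail hB.tail) (.var 0)))
    (.testBit hβ.tail (.add (.mul hp'.tail hB.tail) (.var 0))))

theorem RamComp.quintuple {f₁ f₂ f₃ f₄ f₅ : (ℕ → ℕ) → (ℕ → ℕ) → ℕ} (h₁ : RamComp 0 f₁)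
    (h₂ : RamComp 0 f₂) (h₃ : RamComp 0 f₃) (h₄ : RamComp 0 f₄) (h₅ : RamComp 0 f₅) :
    RamComp 0 fun m σ => quintuple (f₁ m σ) (f₂ m σ) (f₃ m σ) (f₄ m σ) (f₅ m σ) :=
  .pair h₁ (.pair h₂ (.pair h₃ (.pair h₄ h₅)))

namespace Interpretation.Computable

variable {I : Interpretation} {e : (ℕ → ℕ) → (ℕ → ℕ) → LayerCode}
  {f g h : (ℕ → ℕ) → (ℕ → ℕ) → ℕ}

theorem act (H : I.Computable) (he : RamCode e) (hf : RamComp 0 f) (hg : RamComp 0 g)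
    (hh : RamComp 0 h) :
    RamComp 0 fun m σ => (I.system (e m σ)).act (f m σ) (g m σ) (h m σ) := by
  classical
  unfold DetSystem.act
  exact .ite (he.bit hf (.const 0)) (H.trans he hf (H.start he hf) hh) (H.trans he hf hg hh)

theorem follows (he : RamCode e) (hf : RamComp 0 f) (hg : RamComp 0 g) :
    RamPred 0 fun m σ => (I.system (e m σ)).Follows (f m σ) (g m σ) :=
  .or (.and (.eq hf he.size) (he.bit hg (.const 0))) (.and (.not (.eq hf he.size))
    (.and (.not (he.bit hg (.const 0))) (.and (.not (he.bit hf (.const 1))) (he.glues hf hg))))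

theorem compat {α₀ β₀ i j α β : (ℕ → ℕ) → (ℕ → ℕ) → ℕ} (H : I.Computable) (he : RamCode e)
    (hα₀ : RamComp 0 α₀) (hβ₀ : RamComp 0 β₀) (hi : RamComp 0 i) (hj : RamComp 0 j)
    (hα : RamComp 0 α) (hβ : RamComp 0 β) :
    RamPred 0 fun m σ =>
      (I.system (e m σ)).Compat (α₀ m σ) (β₀ m σ) (i m σ) (j m σ) (α m σ) (β m σ) :=
  have he3 := he.tail.tail.tail
  .forall_lt he.states <| .forall_lt he.tail.states <|
    .imp (.labelEq he.tail.tail.states.size hα₀.tail.tail (.var 1) hβ₀.tail.tail (.var 0)) <|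
    .forall_lt he.tail.tail.symbols <| .labelEq he3.states.size
      hα.tail.tail.tail (H.act he3 hi.tail.tail.tail (.var 2) (.var 0))
      hβ.tail.tail.tail (H.act he3 hj.tail.tail.tail (.var 1) (.var 0))

theorem acceptCompat {i j α β : (ℕ → ℕ) → (ℕ → ℕ) → ℕ} (H : I.Computable) (he : RamCode e)
    (hi : RamComp 0 i) (hj : RamComp 0 j) (hα : RamComp 0 α) (hβ : RamComp 0 β) :
    RamPred 0 fun m σ => (I.system (e m σ)).AcceptCompat (i m σ) (j m σ) (α m σ) (β m σ) :=
  .forall_lt he.states <| .forall_lt he.tail.states <|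
    .imp (.labelEq he.tail.tail.states.size hα.tail.tail (.var 1) hβ.tail.tail (.var 0)) <|
    .iff (H.accepting he.tail.tail hi.tail.tail (.var 1))
      (H.accepting he.tail.tail hj.tail.tail (.var 0))

theorem startBit (he : RamCode e) (hf : RamComp 0 f) :
    RamPred 0 fun m σ => (I.system (e m σ)).StartBit (f m σ) :=
  .exists_lt he.labels <| .exists_lt he.tail.labels <|
    .and (.labelEq he.tail.tail.states.size (.var 1) (.const 0) (.var 0) (.const 0)) <|
    .eq hf.tail.tail (.quintuple he.tail.tail.size he.tail.tail.size (.const 0) (.var 1) (.var 0))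

theorem nextBit (H : I.Computable) (he : RamCode e) (hf : RamComp 0 f) (hg : RamComp 0 g)
    (hh : RamComp 0 h) :
    RamPred 0 fun m σ => (I.system (e m σ)).NextBit (fun q => (f m σ).testBit q) (g m σ) (h m σ) :=
  have he5 := he.tail.tail.tail.tail.tail
  have hg5 := hg.tail.tail.tail.tail.tail
  have he8 := he5.tail.tail.tail
  have hg8 := hg5.tail.tail.tail
  .exists_lt (.add he.size (.const 1)) <| .exists_lt (.add he.tail.size (.const 1)) <|
  .exists_lt (.const 2) <| .exists_lt he.tail.tail.tail.labels <|
  .exists_lt he.tail.tail.tail.tail.labels <|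
  .and (.testBit hf.tail.tail.tail.tail.tail
    (.quintuple (.var 4) (.var 3) (.var 2) (.var 1) (.var 0))) <|
  .and (.lt hg5 he5.size) <| .and (follows he5 (.var 4) hg5) <|
  .exists_lt he5.size <| .and (follows he5.tail (.var 4) (.var 0)) <|
  .exists_lt he5.tail.labels <| .exists_lt he5.tail.tail.labels <|
  .and (H.compat he8 (.var 4) (.var 3) hg8 (.var 2) (.var 1) (.var 0)) <|
  .eq hh.tail.tail.tail.tail.tail.tail.tail.tail <| .quintuple hg8 (.var 2)
    (RamPred.or (.lt (.var 2) hg8) (.and (.eq (.var 2) hg8) (.ne_zero (.var 5)))) (.var 1) (.var 0)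

theorem minimalProfile (H : I.Computable) (he : RamCode e) (hf : RamComp 0 f) :
    RamPred 0 fun m σ => (I.system (e m σ)).MinimalProfile fun q => (f m σ).testBit q :=
  have he4 := he.tail.tail.tail.tail
  .and
  (.exists_lt he.size <| .exists_lt he.tail.size <| .exists_lt (.const 2) <|
    .exists_lt he.tail.tail.tail.labels <| .exists_lt he4.labels <|
    .and (.testBit hf.tail.tail.tail.tail.tail
      (.quintuple (.var 4) (.var 3) (.var 2) (.var 1) (.var 0))) (he4.tail.bit (.var 4) (.const 1)))
  (.not <| .exists_lt he.size <| .exists_lt he.tail.size <|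
    .exists_lt he.tail.tail.labels <| .exists_lt he.tail.tail.tail.labels <|
    .and (.testBit hf.tail.tail.tail.tail
      (.quintuple (.var 3) (.var 2) (.const 1) (.var 1) (.var 0))) <|
    .and (he4.bit (.var 3) (.const 1)) <| .and (he4.bit (.var 2) (.const 1)) <|
    H.acceptCompat he4 (.var 3) (.var 2) (.var 1) (.var 0))

end Interpretation.Computable

open Classical in
/-- The sum of the numbers below `N` that satisfy `p`: a choice function when there is only one. -/
noncomputable def sumOf (N : ℕ) (p : ℕ → Prop) : ℕ := ∑ q ∈ Finset.range N, if p q then q else 0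

theorem sumOf_eq {N q : ℕ} {p : ℕ → Prop} (hq : q < N) (hp : ∀ x < N, p x ↔ x = q) :
    sumOf N p = q := by
  rw [sumOf, Finset.sum_eq_single_of_mem q (Finset.mem_range.2 hq) fun x hx hne =>
    if_neg fun h => hne ((hp x (Finset.mem_range.1 hx)).1 h), if_pos ((hp q hq).2 rfl)]

theorem sumOf_lt {N : ℕ} {p : ℕ → Prop} (hN : 0 < N)
    (hp : ∀ x < N, ∀ y < N, p x → p y → x = y) : sumOf N p < N := by
  by_cases h : ∃ q < N, p q
  · obtain ⟨q, hq, hpq⟩ := h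
    rwa [sumOf_eq hq fun x hx => ⟨fun hpx => hp x hx q hq hpx hpq, fun hxq => hxq ▸ hpq⟩]
  · push Not at h
    rwa [sumOf, Finset.sum_eq_zero fun x hx => if_neg (h x (Finset.mem_range.1 hx))]

theorem RamComp.sumOf {κ : ℕ} {N : (ℕ → ℕ) → (ℕ → ℕ) → ℕ} {P : (ℕ → ℕ) → (ℕ → ℕ) → ℕ → Prop}
    (hN : RamComp 0 N) (hP : RamPred κ fun m σ => P m (envTail σ) (σ 0)) :
    RamComp κ fun m σ => sumOf (N m σ) (P m σ) := by
  classical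
  exact .sum (F := fun m σ x => if P m σ x then x else 0) hN (.ite hP (.var 0) (.const 0))

/-- The interpretation of deterministic layers, on their own states. -/
noncomputable def Interpretation.det : Interpretation where
  states w := w
  start e i := sumOf e.states (e.Initial i)
  trans e i p a := sumOf e.states (e.Trans i p a)
  accepting e := e.Final

/-- The subset construction, with sets of states represented by their characteristic digits. -/
noncomputable def Interpretation.subset : Interpretation where
  states w := 2 ^ w
  start e i := sumOf e.states fun Y => ∀ q < e.width, (Y.testBit q ↔ e.Initial i q)
  trans e i X a := sumOf e.states fun Y => ∀ q < e.width,
    (Y.testBit q ↔ ∃ p < e.width, X.testBit p ∧ e.Trans i p a q)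
  accepting e i X := ∃ p < e.width, X.testBit p ∧ e.Final i p

theorem Interpretation.computable_det : Interpretation.det.Computable where
  states :=
    have ⟨P, c, hP⟩ := RamComp.exists_assign (κ := 0) (.var 1) 2
    ⟨P, c, fun s U hs _ => (hP s U 0 hs).mono (by simp)⟩
  start he hf := .sumOf he.states (he.tail.bit_initial hf.tail (.var 0))
  trans he hf hg hh := .sumOf he.states (he.tail.bit_trans hf.tail hg.tail hh.tail (.var 0))
  accepting he hf hg := he.bit_final hf hg

theorem Interpretation.computable_subset : Interpretation.subset.Computable where
  states :=
    have ⟨P, c, hP⟩ := RamComp.exists_assign_two_pow (.var 1) 2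
    ⟨P, c, fun s U hs hU => hP s U 0 hs hU⟩
  start he hf := .sumOf he.states <| .forall_lt he.tail.width <| .iff (.testBit (.var 1) (.var 0))
    (he.tail.tail.bit_initial hf.tail.tail (.var 0))
  trans he hf hg hh := .sumOf he.states <| .forall_lt he.tail.width <|
    .iff (.testBit (.var 1) (.var 0)) <| .exists_lt he.tail.tail.width <|
    .and (.testBit hg.tail.tail.tail (.var 0)) <|
    he.tail.tail.tail.bit_trans hf.tail.tail.tail (.var 0) hh.tail.tail.tail (.var 1)
  accepting he hf hg := .exists_lt he.width <| .and (.testBit hg.tail (.var 0))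
    (he.tail.bit_final hf.tail (.var 0))

/-! ## The counting program -/

theorem isAutomaton_nextNum (M : DetSystem) (Q : ℕ) :
    IsAutomaton (2 ^ Q) M.size (fun y => ∀ q < Q, (y.testBit q ↔ M.StartBit q))
      (fun i x y => ∀ q < Q, (y.testBit q ↔ M.NextBit (fun q => x.testBit q) i q))
      (M.startNum Q) (M.nextNum Q) where
  start_lt := ofBitPred_lt _ _
  step_lt _ _ := ofBitPred_lt _ _
  start_iff _ hy := forall_testBit_iff_ofBitPred_eq hy _
  next_iff _ _ _ _ _ hy := forall_testBit_iff_ofBitPred_eq hy _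

theorem pathCount_time_le {U S k c : ℕ} (hU : 2 ≤ U) (hS : S ≤ U) (hk : 0 < k) :
    U ^ c * (((S + 1) * k + 1) * (k + 1)) ≤ U ^ (c + 3) * k ^ 2 := by
  have hleft : (S + 1) * k + 1 ≤ U * U * k :=
    calc (S + 1) * k + 1 ≤ (S + 2) * k := by rw [Nat.add_mul S 2, Nat.add_mul S 1]; omega
      _ ≤ U * U * k := Nat.mul_le_mul_right _ (by nlinarith)
  have hright : k + 1 ≤ U * k := by nlinarith
  calc U ^ c * (((S + 1) * k + 1) * (k + 1)) ≤ U ^ c * (U * U * k * (U * k)) :=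
        Nat.mul_le_mul_left _ (Nat.mul_le_mul hleft hright)
    _ = U ^ (c + 3) * k ^ 2 := by ring

theorem pow_le_two_pow_mul {S t k : ℕ} (ht : t ≤ k) : S ^ t ≤ 2 ^ ((S + 1) * k) :=
  calc S ^ t ≤ (S + 1) ^ k := (Nat.pow_le_pow_left (Nat.le_succ _) t).trans
        (Nat.pow_le_pow_right (Nat.succ_pos _) ht)
    _ ≤ (2 ^ (S + 1)) ^ k := Nat.pow_le_pow_left Nat.lt_two_pow_self.le _
    _ = 2 ^ ((S + 1) * k) := (pow_mul _ _ _).symm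

namespace Interpretation

variable {I : Interpretation}

theorem Computable.exists_profile_program (H : I.Computable) :
    ∃ P c, ∀ (s : RAMState) (U k : ℕ) (e : LayerCode), e = .ofEnv s.params →
      BoundedEnv paramReg 8 s U 0 → s.reg 6 = 2 ^ e.codeBound → s.reg 7 = k → 0 < k →
      (I.system e).Bounded → ∀ {T : Type*} (F : List ℕ → T),
        (∀ D D', F D = F D' ↔ ∀ u ∈ words e.symbols k,
          ((I.system e).Accepts D u ↔ (I.system e).Accepts D' u)) →
        RAMOutputsWithin P s (F '' {D | (I.system e).Full D ∧ D.length = k}).ncard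
          (U ^ c * k ^ 2) := by
  obtain ⟨P, c, hP⟩ := exists_pathCount_program
    (start := fun σ y => ∀ q < (LayerCode.ofEnv σ).codeBound,
      (y.testBit q ↔ (I.system (.ofEnv σ)).StartBit q))
    (next := fun σ i x y => ∀ q < (LayerCode.ofEnv σ).codeBound,
      (y.testBit q ↔ (I.system (.ofEnv σ)).NextBit (fun q => x.testBit q) i q))
    (acc := fun σ x => (I.system (.ofEnv σ)).MinimalProfile fun q => x.testBit q)
    (.forall_lt RamCode.ofEnv.tail.codeBound <|
      .iff (.testBit (.var 1) (.var 0)) (Computable.startBit RamCode.ofEnv.tail.tail (.var 0)))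
    (.forall_lt RamCode.ofEnv.tail.tail.tail.codeBound <| .iff (.testBit (.var 3) (.var 0))
      (H.nextBit RamCode.ofEnv.tail.tail.tail.tail (.var 2) (.var 1) (.var 0)))
    (H.minimalProfile RamCode.ofEnv.tail (.var 0))
  refine ⟨P, c + 3, fun s U k e he hs hN hk hk0 hB T F hF => ?_⟩
  have hauto : IsAutomaton (2 ^ e.codeBound) e.size _ _ _ _ :=
    isAutomaton_nextNum (I.system e) e.codeBound
  have hcount : ∀ t ≤ k, ∀ y < 2 ^ e.codeBound, pathCount (2 ^ e.codeBound) e.size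
      (fun y => ∀ q < e.codeBound, (y.testBit q ↔ (I.system e).StartBit q))
      (fun i x y => ∀ q < e.codeBound,
        (y.testBit q ↔ (I.system e).NextBit (fun q => x.testBit q) i q)) t y ≤
      2 ^ ((e.size + 1) * k) := fun t ht y hy =>
    (hauto.pathCount_le t hy).trans (pow_le_two_pow_mul ht)
  have hQ : ((I.system e).labels + (I.system e).size + 2) ^ 16 ≤ e.codeBound :=
    Nat.pow_le_pow_left (by change e.labels + e.size + 2 ≤ _; omega) _
  have hsize : s.reg 3 = e.size := by rw [he]; rfl
  have hrun := hP s U ((e.size + 1) * k) ⟨hs.lt, hs.two_le, hs.reg_le,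
    fun a => (hs.mem_le a).trans (Nat.pow_le_pow_right two_pos (Nat.zero_le _))⟩
    (hk ▸ Nat.le_mul_of_pos_left _ (Nat.succ_pos _))
  rw [hN, hk, hsize, ← he] at hrun
  have hrun := hrun hcount
  rw [hauto.sum_pathCount_eq fun x => (I.system e).MinimalProfile fun q => x.testBit q] at hrun
  rw [← hB.card_filter_minimalProfile hk0 hQ F hF]
  obtain ⟨t, s', hr, ht, hv⟩ := hrun
  exact ⟨t, s', hr, ht.trans (pathCount_time_le hs.two_le (hsize ▸ hs.reg_le 3) hk0), hv⟩

end Interpretation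

/-- The registers `0, …, 3` of `s` hold the sizes of an alphabet, a width, a length and the length
of a list of layers, and the memory holds the bits of the layers, as in `countingInput`. -/
structure IsCountingInput (s : RAMState) : Prop where
  width_pos : 0 < s.reg 1
  length_pos : 0 < s.reg 2
  reg_eq_zero : ∀ i, 4 ≤ i → s.reg i = 0
  mem_le_one : ∀ a, s.mem a ≤ 1
  mem_eq_zero : ∀ a, s.reg 3 * layerBits (s.reg 0) (s.reg 1) ≤ a → s.mem a = 0

/-- The code of the list of layers in the input `s`. -/
noncomputable def Interpretation.code (I : Interpretation) (s : RAMState) : LayerCode where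
  symbols := s.reg 0
  width := s.reg 1
  states := I.states (s.reg 1)
  size := s.reg 3
  bits := ofBitPred (s.reg 3 * layerBits (s.reg 0) (s.reg 1)) fun a => s.mem a ≠ 0
  labels := 2 ^ (I.states (s.reg 1) * (I.states (s.reg 1)).size)

/-- The input `s` after the computation of its code; the number of profiles is in register `6`. -/
noncomputable def Interpretation.preparedState (I : Interpretation) (s : RAMState) : RAMState :=
  ((((s.setReg 7 (s.reg 2)).setReg 2 (I.code s).states).setReg 5 (I.code s).labels).setReg 6
    (2 ^ (I.code s).codeBound)).setReg 4 (I.code s).bits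

namespace LayerCode

variable (e : LayerCode)

theorem le_codeBound : e.labels + e.size + layerBits e.symbols e.width + 2 ≤ e.codeBound :=
  Nat.le_self_pow (by norm_num) _

theorem labels_lt {U : ℕ} (hU : U = 2 ^ e.codeBound) : e.labels < U := by
  have hcode : e.codeBound < U := hU ▸ Nat.lt_two_pow_self
  have := e.le_codeBound
  omega

theorem size_mul_layerBits_le_codeBound : e.size * layerBits e.symbols e.width ≤ e.codeBound :=
  calc e.size * layerBits e.symbols e.width
      ≤ (e.labels + e.size + layerBits e.symbols e.width + 2) *
        (e.labels + e.size + layerBits e.symbols e.width + 2) :=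
        Nat.mul_le_mul (by omega) (by omega)
    _ = (e.labels + e.size + layerBits e.symbols e.width + 2) ^ 2 := (sq _).symm
    _ ≤ e.codeBound := Nat.pow_le_pow_right (by omega) (by norm_num)

end LayerCode

theorem width_le_layerBits (n w : ℕ) : w ≤ layerBits n w := by
  unfold layerBits; omega

theorem symbols_le_layerBits (n : ℕ) {w : ℕ} (hw : 0 < w) : n ≤ layerBits n w :=
  calc n ≤ w * (n * w) := (Nat.le_mul_of_pos_right _ hw).trans (Nat.le_mul_of_pos_left _ hw)
    _ ≤ layerBits n w := Nat.le_add_left _ _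

theorem le_two_pow_mul_size (W : ℕ) : W ≤ 2 ^ (W * W.size) := by
  rcases Nat.eq_zero_or_pos W with rfl | hW
  · exact Nat.zero_le _
  · exact (Nat.lt_size_self W).le.trans
      (Nat.pow_le_pow_right two_pos (Nat.le_mul_of_pos_left _ hW))

theorem LayerCode.states_lt (e : LayerCode) {U : ℕ}
    (hlabels : e.labels = 2 ^ (e.states * e.states.size)) (hU : U = 2 ^ e.codeBound) :
    e.states < U :=
  ((le_two_pow_mul_size _).trans_eq hlabels.symm).trans_lt (e.labels_lt hU)

theorem BoundedEnv.setReg_param {s : RAMState} {U K v : ℕ} (h : BoundedEnv paramReg 8 s U K) (r : ℕ)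
    (hv : v ≤ U) : BoundedEnv paramReg 8 (s.setReg r v) U K where
  lt := h.lt
  two_le := h.two_le
  reg_le i := by
    rw [RAMState.setReg_reg]
    split_ifs
    exacts [hv, h.reg_le i]
  mem_le := h.mem_le

theorem IsCountingInput.boundedEnv {s : RAMState} (hs : IsCountingInput s) (I : Interpretation)
    {U : ℕ} (hU : U = 2 ^ (I.code s).codeBound) :
    BoundedEnv paramReg 8 ((s.setReg 7 (s.reg 2)).setReg 2 0) U 0 := by
  have := (I.code s).labels_lt hU
  have hcode : (I.code s).codeBound < U := hU ▸ Nat.lt_two_pow_self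
  have hle : (I.code s).labels + s.reg 3 + layerBits (s.reg 0) (s.reg 1) + 2 ≤ _ :=
    (I.code s).le_codeBound
  refine ⟨fun i => by unfold paramReg; omega, by omega, fun i => ?_, hs.mem_le_one⟩
  have h0 := symbols_le_layerBits (s.reg 0) hs.width_pos
  have h1 := width_le_layerBits (s.reg 0) (s.reg 1)
  have h4 := hs.reg_eq_zero 4 le_rfl
  have h5 := hs.reg_eq_zero 5 (by norm_num)
  have h6 := hs.reg_eq_zero 6 (by norm_num)
  have hi : min i 6 ≤ 6 := min_le_right _ _
  unfold paramReg
  interval_cases min i 6 <;> simp only [RAMState.setReg_reg] <;> simp <;> omega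

theorem IsCountingInput.bits_testBit {s : RAMState} (hs : IsCountingInput s) (I : Interpretation)
    {a : ℕ} : (I.code s).bits.testBit a ↔ s.mem a = 1 := by
  have hle := hs.mem_le_one a
  rw [Interpretation.code, testBit_ofBitPred]
  refine ⟨fun h => by omega, fun h => ⟨?_, by omega⟩⟩
  by_contra! ha
  exact absurd (hs.mem_eq_zero a ha) (by omega)

theorem Interpretation.code_bits_lt (I : Interpretation) (s : RAMState) :
    (I.code s).bits < 2 ^ (I.code s).codeBound :=
  (ofBitPred_lt _ fun a => s.mem a ≠ 0).trans_le
    (Nat.pow_le_pow_right two_pos (I.code s).size_mul_layerBits_le_codeBound)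

theorem IsCountingInput.bits_eq_sumOf {s : RAMState} (hs : IsCountingInput s) (I : Interpretation) :
    sumOf (2 ^ (I.code s).codeBound) (fun y => ∀ a < (I.code s).codeBound,
      (y.testBit a ↔ s.mem a ≠ 0)) = (I.code s).bits := by
  have hbits := I.code_bits_lt s
  refine sumOf_eq hbits fun y hy => ?_
  rw [← forall_testBit_iff hy hbits]
  refine forall₂_congr fun a _ => iff_congr Iff.rfl ?_
  rw [hs.bits_testBit, Nat.ne_zero_iff_zero_lt]
  have := hs.mem_le_one a
  omega

namespace RAMState

theorem setReg_setReg (s : RAMState) (i v v' : ℕ) : (s.setReg i v).setReg i v' = s.setReg i v' := by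
  simp [setReg]

end RAMState

theorem IsCountingInput.boundedEnv_preparedState {s : RAMState} (hs : IsCountingInput s)
    (I : Interpretation) {U : ℕ} (hU : U = 2 ^ (I.code s).codeBound) :
    BoundedEnv paramReg 8 (I.preparedState s) U 0 := by
  have henv := ((((hs.boundedEnv I hU).setReg_param 2 ((I.code s).states_lt rfl hU).le).setReg_param
    5 ((I.code s).labels_lt hU).le).setReg_param 6 hU.ge).setReg_param 4
    ((I.code_bits_lt s).trans_eq hU.symm).le
  rwa [RAMState.setReg_setReg] at henv

theorem RunsIn.outputsWithin_seq {P Q : RAMProgram} {s s' : RAMState} {T T' v : ℕ}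
    (h : RunsIn P s T s') (h' : RAMOutputsWithin Q s' v T') :
    RAMOutputsWithin (.seq P Q) s v (T + T') :=
  let ⟨_, hr, ht⟩ := h
  let ⟨_, s'', hr', ht', hv⟩ := h'
  ⟨_, s'', .seq P Q s s' s'' _ _ hr hr', Nat.add_le_add ht ht', hv⟩

theorem RAMOutputsWithin.mono {P : RAMProgram} {s : RAMState} {T T' v : ℕ}
    (h : RAMOutputsWithin P s v T) (hT : T ≤ T') : RAMOutputsWithin P s v T' :=
  let ⟨t, s', hr, ht, hv⟩ := h
  ⟨t, s', hr, ht.trans hT, hv⟩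

theorem RunsIn.transforms_setReg {P : RAMProgram} {i v T : ℕ} {s : RAMState}
    (h : ∀ s', s.AgreesBelow 8 s' → RunsIn P s' T (s'.setReg i v)) :
    Transforms P s T (s.setReg i v) := fun s' hs' => ⟨_, h s' hs', hs'.setReg_setReg i v⟩

theorem Interpretation.Computable.exists_prepare_program {I : Interpretation} (H : I.Computable) :
    ∃ P c, ∀ s U, IsCountingInput s → U = 2 ^ (I.code s).codeBound →
      Transforms P s (U ^ c * (s.reg 2 + 1)) (I.preparedState s) := by
  obtain ⟨P₁, c₁, h₁⟩ := H.states
  obtain ⟨P₂, c₂, h₂⟩ := RamComp.exists_assign_two_pow (f := fun _ σ => σ 2 * (σ 2).size)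
    (.mul (.var 2) (RamComp.var 2).size) 5
  obtain ⟨P₃, c₃, h₃⟩ := RamComp.exists_assign_two_pow RamCode.ofEnv.codeBound 6
  obtain ⟨P₄, c₄, h₄⟩ := RamComp.exists_assign (κ := 1)
    (f := fun m σ => sumOf (σ 6) fun y => ∀ a < (LayerCode.ofEnv σ).codeBound,
      (y.testBit a ↔ m a ≠ 0))
    (.sumOf (.var 6) (.forall_lt RamCode.ofEnv.tail.codeBound (.iff
      (RamComp.of_zero (RamPred.testBit (.var 1) (.var 0))) (.ne_zero (.read (.var 0)))))) 4
  refine ⟨.seq (.copy 7 2) (.seq (.const 2 0) (.seq P₁ (.seq P₂ (.seq P₃ P₄)))),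
    c₁ + c₂ + c₃ + c₄ + 3, fun s U hs hU => ?_⟩
  have hcopy : Transforms (.copy 7 2) s (s.reg 2 + 1) (s.setReg 7 (s.reg 2)) :=
    RunsIn.transforms_setReg fun s' hs' => by
      rw [← hs'.2 2 (by norm_num)]
      exact (RunsIn.copy 7 2 s').mono (by have := size_le_self (s'.reg 2); omega)
  have hconst : Transforms (.const 2 0) (s.setReg 7 (s.reg 2)) 1 _ :=
    RunsIn.transforms_setReg fun s' _ => (RunsIn.const 2 0 s').mono (by simp)
  have hs₁ := hs.boundedEnv I hU
  have hs₂ := hs₁.setReg_param 2 ((I.code s).states_lt rfl hU).le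
  have hs₃ := hs₂.setReg_param 5 ((I.code s).labels_lt hU).le
  have hs₄ := hs₃.setReg_param 6 hU.ge
  have hP₁ := h₁ _ U hs₁ ((I.code s).states_lt rfl hU).le
  rw [RAMState.setReg_setReg] at hs₂ hs₃ hs₄ hP₁
  have hP₂ := h₂ _ U 0 hs₂ ((I.code s).labels_lt hU).le
  have hP₃ := h₃ _ U 0 hs₃ hU.ge
  have hP₄ := (h₄ _ U 0 hs₄).mono (T' := U ^ c₄) (by simp)
  have hbound : ∀ c ≤ c₁ + c₂ + c₃ + c₄, ∀ {T}, T ≤ U ^ c * (s.reg 2 + 1) →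
      T ≤ U ^ (c₁ + c₂ + c₃ + c₄) * (s.reg 2 + 1) := fun c hc T hT =>
    hT.trans (pow_mul_le_pow_mul hs₁.two_le hc)
  have hpow : ∀ c, U ^ c ≤ U ^ c * (s.reg 2 + 1) := fun c =>
    Nat.le_mul_of_pos_right _ (Nat.succ_pos _)
  rw [Interpretation.preparedState, ← hs.bits_eq_sumOf I]
  refine ((hcopy.mono (hbound 0 (by omega) (by simp))).seq <|
    (hconst.mono (hbound 0 (by omega) (by simp))).seq <|
    (hP₁.mono (hbound c₁ (by omega) (hpow _))).seq <|
    (hP₂.mono (hbound c₂ (by omega) (hpow _))).seq <|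
    (hP₃.mono (hbound c₃ (by omega) (hpow _))).seq <|
    hP₄.mono (hbound c₄ (by omega) (hpow _))).mono ?_
  have := mul_le_pow_add_mul (c := c₁ + c₂ + c₃ + c₄) (X := s.reg 2 + 1) (n := 6) (e := 3)
    hs₁.two_le (by norm_num)
  omega

theorem Interpretation.Computable.exists_count_program {I : Interpretation} (H : I.Computable) :
    ∃ P c, ∀ s, IsCountingInput s → (I.system (I.code s)).Bounded →
      ∀ {T : Type*} (F : List ℕ → T),
        (∀ D D', F D = F D' ↔ ∀ u ∈ words (s.reg 0) (s.reg 2),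
          ((I.system (I.code s)).Accepts D u ↔ (I.system (I.code s)).Accepts D' u)) →
        RAMOutputsWithin P s (F '' {D | (I.system (I.code s)).Full D ∧ D.length = s.reg 2}).ncard
          (2 ^ (c * (I.code s).codeBound) * s.reg 2 ^ 2) := by
  obtain ⟨P, c, hP⟩ := H.exists_prepare_program
  obtain ⟨Q, c', hQ⟩ := H.exists_profile_program
  refine ⟨.seq P Q, c + c' + 2, fun s hs hB T F hF => ?_⟩
  obtain ⟨s', hr, hs'⟩ := hP s _ hs rfl s (.refl 8 s)
  have henv := hs.boundedEnv_preparedState I rfl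
  have hcode : I.code s = .ofEnv s'.params := by rw [RAMState.params, henv.reg_comp_eq hs']; rfl
  refine (hr.outputsWithin_seq (hQ s' _ (s.reg 2) _ hcode (henv.of_agreesBelow hs' le_rfl)
    (hs'.2 6 (by norm_num)) (hs'.2 7 (by norm_num)) hs.length_pos hB F hF)).mono ?_
  have h2 := henv.two_le
  have hk := hs.length_pos
  rw [mul_comm (c + c' + 2), pow_mul]
  generalize 2 ^ (I.code s).codeBound = U at h2
  have h3 := pow_mul_le_pow_mul (a := c) (b := c + c') (X := 2 * s.reg 2 ^ 2) h2 (by omega)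
  have h4 := pow_mul_le_pow_mul (a := c') (b := c + c') (X := s.reg 2 ^ 2) h2 (by omega)
  have h5 : U ^ c * (s.reg 2 + 1) ≤ U ^ c * (2 * s.reg 2 ^ 2) :=
    Nat.mul_le_mul_left _ (by nlinarith)
  have h6 := mul_le_pow_add_mul (c := c + c') (X := s.reg 2 ^ 2) (n := 3) (e := 2) h2 (by norm_num)
  linarith

/-! ## Decoding the input -/

theorem getD_append_length_add {α : Type*} {l l' : List α} {m : ℕ} (h : l.length = m) (x : ℕ)
    (d : α) : (l ++ l').getD (m + x) d = l'.getD x d := by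
  subst h
  rw [List.getD_append_right _ _ _ _ (Nat.le_add_right _ _), Nat.add_sub_cancel_left]

theorem getD_map_finRange {α : Type*} {w : ℕ} (f : Fin w → α) (q : Fin w) (d : α) :
    ((List.finRange w).map f).getD q d = f q := by
  rw [List.getD_eq_getElem _ _ (by simp)]
  simp

theorem getD_flatMap_of_length {α β : Type*} {l : List α} {f : α → List β} {L : ℕ}
    (hf : ∀ a ∈ l, (f a).length = L) {i x : ℕ} (hi : i < l.length) (hx : x < L) (d : β) :
    (l.flatMap f).getD (i * L + x) d = (f l[i]).getD x d := by
  induction l generalizing i with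
  | nil => simp at hi
  | cons a l ih =>
    have ha : (f a).length = L := hf a List.mem_cons_self
    rw [List.flatMap_cons]
    rcases i with _ | i
    · rw [List.getD_append _ _ _ _ (by omega)]
      simp
    · rw [show (i + 1) * L + x = L + (i * L + x) by ring, getD_append_length_add ha]
      exact ih (fun b hb => hf b (List.mem_cons_of_mem a hb)) (Nat.lt_of_succ_lt_succ hi)

theorem length_flatMap_of_length {α β : Type*} {l : List α} {f : α → List β} {L : ℕ}
    (hf : ∀ a ∈ l, (f a).length = L) : (l.flatMap f).length = l.length * L := by
  rw [List.length_flatMap, List.map_congr_left hf]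
  simp

namespace Layer

variable {A : Type*} {n w : ℕ}

instance : Inhabited (Layer A w) where
  default :=
    { leftStates := ∅, rightStates := ∅, transitions := ∅, initialStates := ∅, finalStates := ∅
      initialFlag := false, finalFlag := false
      transitions_subset := by simp
      initialStates_subset := by simp
      finalStates_subset := by simp
      initialStates_eq_empty := by simp
      finalStates_eq_empty := by simp }

variable (ε : A ≃ Fin n) (B : Layer A w)

theorem encode_eq : B.encode ε =
    propBit (B.initialFlag = true) :: propBit (B.finalFlag = true) ::
    ((List.finRange w).map (fun q => propBit (q ∈ B.leftStates)) ++
    ((List.finRange w).map (fun q => propBit (q ∈ B.rightStates)) ++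
    ((List.finRange w).map (fun q => propBit (q ∈ B.initialStates)) ++
    ((List.finRange w).map (fun q => propBit (q ∈ B.finalStates)) ++
    (List.finRange w).flatMap fun p => (List.finRange n).flatMap fun a =>
      (List.finRange w).map fun q => propBit ((p, ε.symm a, q) ∈ B.transitions))))) := by
  simp [Layer.encode]

theorem length_encode_transitions (p : Fin w) :
    ((List.finRange n).flatMap fun a => (List.finRange w).map fun q =>
      propBit ((p, ε.symm a, q) ∈ B.transitions)).length = n * w := by
  rw [length_flatMap_of_length (L := w) (by simp), List.length_finRange]

theorem length_encode : (B.encode ε).length = layerBits n w := by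
  rw [B.encode_eq]
  simp only [List.length_cons, List.length_append, List.length_map, List.length_finRange,
    length_flatMap_of_length fun p _ => B.length_encode_transitions ε p, layerBits]
  ring

theorem getD_encode_left (q : Fin w) :
    (B.encode ε).getD (2 + q) 0 = propBit (q ∈ B.leftStates) := by
  rw [B.encode_eq, Nat.add_comm]
  simp only [List.getD_cons_succ]
  rw [List.getD_append _ _ _ _ (by simp), getD_map_finRange]

theorem getD_encode_right (q : Fin w) :
    (B.encode ε).getD (2 + (w + q)) 0 = propBit (q ∈ B.rightStates) := by
  rw [B.encode_eq, Nat.add_comm]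
  simp only [List.getD_cons_succ]
  rw [getD_append_length_add (by simp), List.getD_append _ _ _ _ (by simp), getD_map_finRange]

theorem getD_encode_initial (q : Fin w) :
    (B.encode ε).getD (2 + (w + (w + q))) 0 = propBit (q ∈ B.initialStates) := by
  rw [B.encode_eq, Nat.add_comm]
  simp only [List.getD_cons_succ]
  rw [getD_append_length_add (by simp), getD_append_length_add (by simp),
    List.getD_append _ _ _ _ (by simp), getD_map_finRange]

theorem getD_encode_final (q : Fin w) :
    (B.encode ε).getD (2 + (w + (w + (w + q)))) 0 = propBit (q ∈ B.finalStates) := by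
  rw [B.encode_eq, Nat.add_comm]
  simp only [List.getD_cons_succ]
  rw [getD_append_length_add (by simp), getD_append_length_add (by simp),
    getD_append_length_add (by simp), List.getD_append _ _ _ _ (by simp), getD_map_finRange]

theorem getD_encode_transitions (p : Fin w) (a : A) (q : Fin w) :
    (B.encode ε).getD (2 + (w + (w + (w + (w + (p * (n * w) + (ε a * w + q))))))) 0 =
      propBit ((p, a, q) ∈ B.transitions) := by
  rw [B.encode_eq, Nat.add_comm]
  simp only [List.getD_cons_succ]
  rw [getD_append_length_add (by simp), getD_append_length_add (by simp),
    getD_append_length_add (by simp), getD_append_length_add (by simp),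
    getD_flatMap_of_length (fun p _ => B.length_encode_transitions ε p) (by simp)
      (mul_add_lt_mul (ε a).2 q.2),
    getD_flatMap_of_length (L := w) (by simp) (by simp) q.2, getD_map_finRange]
  simp

theorem le_one_of_mem_encode {y : ℕ} (hy : y ∈ B.encode ε) : y ≤ 1 := by
  simp only [encode, List.mem_flatMap, List.mem_append, List.mem_map, List.mem_cons,
    List.not_mem_nil, or_false] at hy
  rcases hy with ((((( rfl | rfl) | ⟨q, -, rfl⟩) | ⟨q, -, rfl⟩) | ⟨q, -, rfl⟩) | ⟨q, -, rfl⟩) |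
    ⟨p, -, a, -, q, -, rfl⟩ <;> exact propBit_le_one _

end Layer

/-- The code `e` describes the layers of the list `Ls`. -/
structure Describes {A : Type*} {n w : ℕ} (ε : A ≃ Fin n) (Ls : List (Layer A w))
    (e : LayerCode) : Prop where
  symbols : e.symbols = n
  width : e.width = w
  size : e.size = Ls.length
  initialFlag : ∀ i < Ls.length, (e.Bit i 0 ↔ (Ls.getD i default).initialFlag = true)
  finalFlag : ∀ i < Ls.length, (e.Bit i 1 ↔ (Ls.getD i default).finalFlag = true)
  left : ∀ i < Ls.length, ∀ q : Fin w, (e.Left i q ↔ q ∈ (Ls.getD i default).leftStates)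
  right : ∀ i < Ls.length, ∀ q : Fin w, (e.Right i q ↔ q ∈ (Ls.getD i default).rightStates)
  initial : ∀ i < Ls.length, ∀ q : Fin w,
    (e.Initial i q ↔ q ∈ (Ls.getD i default).initialStates)
  final : ∀ i < Ls.length, ∀ q : Fin w, (e.Final i q ↔ q ∈ (Ls.getD i default).finalStates)
  trans : ∀ i < Ls.length, ∀ (p : Fin w) (a : A) (q : Fin w),
    (e.Trans i p (ε a) q ↔ (p, a, q) ∈ (Ls.getD i default).transitions)

section CountingInput

variable {A : Type*} {n w : ℕ} (ε : A ≃ Fin n) (Ls : List (Layer A w)) (k : ℕ)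

theorem isCountingInput_countingInput (hw : 0 < w) (hk : 0 < k) :
    IsCountingInput (countingInput ε Ls k) where
  width_pos := hw
  length_pos := hk
  reg_eq_zero _ hi := List.getD_eq_default _ _ hi
  mem_le_one a := by
    change (Ls.flatMap (Layer.encode ε)).getD a 0 ≤ 1
    by_cases ha : a < (Ls.flatMap (Layer.encode ε)).length
    · rw [List.getD_eq_getElem _ _ ha]
      obtain ⟨B, -, hB⟩ := List.mem_flatMap.1 (List.getElem_mem ha)
      exact B.le_one_of_mem_encode ε hB
    · rw [List.getD_eq_default _ _ (not_lt.1 ha)]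
      exact Nat.zero_le _
  mem_eq_zero a ha := List.getD_eq_default _ _ <| by
    rwa [length_flatMap_of_length fun B _ => B.length_encode ε]

variable {ε Ls k} (hs : IsCountingInput (countingInput ε Ls k)) (I : Interpretation)
include hs

theorem IsCountingInput.code_bit_iff {i x : ℕ} (hi : i < Ls.length) (hx : x < layerBits n w)
    {p : Prop} (hp : ((Ls.getD i default).encode ε).getD x 0 = propBit p) :
    (I.code (countingInput ε Ls k)).Bit i x ↔ p := by
  have hbit : (Ls.flatMap (Layer.encode ε)).getD (i * layerBits n w + x) 0 = propBit p := by
    rw [getD_flatMap_of_length (fun B _ => B.length_encode ε) hi hx,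
      ← List.getD_eq_getElem _ default hi, hp]
  refine hs.bits_testBit I |>.trans ?_
  change (Ls.flatMap (Layer.encode ε)).getD (i * layerBits n w + x) 0 = 1 ↔ p
  rw [hbit]
  by_cases h : p <;> simp [propBit, h]

theorem IsCountingInput.describes_code : Describes ε Ls (I.code (countingInput ε Ls k)) where
  symbols := rfl
  width := rfl
  size := rfl
  initialFlag i hi :=
    hs.code_bit_iff I hi (by unfold layerBits; omega) (by rw [Layer.encode_eq]; rfl)
  finalFlag i hi :=
    hs.code_bit_iff I hi (by unfold layerBits; omega) (by rw [Layer.encode_eq]; rfl)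
  left i hi q := hs.code_bit_iff I hi (by unfold layerBits; omega) (Layer.getD_encode_left ..)
  right i hi q := hs.code_bit_iff I (x := 2 + (w + q)) hi (by unfold layerBits; omega)
    (Layer.getD_encode_right ..)
  initial i hi q := hs.code_bit_iff I (x := 2 + (w + (w + q))) hi (by unfold layerBits; omega)
    (Layer.getD_encode_initial ..)
  final i hi q := hs.code_bit_iff I (x := 2 + (w + (w + (w + q)))) hi
    (by unfold layerBits; omega) (Layer.getD_encode_final ..)
  trans i hi p a q := by
    have hlt := mul_add_lt_mul p.2 (mul_add_lt_mul (ε a).2 q.2)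
    exact hs.code_bit_iff I
      (x := 2 + (w + (w + (w + (w + (p * (n * w) + (ε a * w + q)))))))
      hi (by unfold layerBits; omega) (Layer.getD_encode_transitions ..)

end CountingInput

/-! ## Accepted strings -/

/-- The list `[x (t - 1), …, x 0]`. -/
def revPrefix (x : ℕ → ℕ) (t : ℕ) : List ℕ := ((List.range t).map x).reverse

theorem revPrefix_succ (x : ℕ → ℕ) (t : ℕ) : revPrefix x (t + 1) = x t :: revPrefix x t := by
  simp [revPrefix, List.range_succ]

theorem length_revPrefix (x : ℕ → ℕ) (t : ℕ) : (revPrefix x t).length = t := by simp [revPrefix]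

theorem revPrefix_eq_ofFn (x : ℕ → ℕ) (t : ℕ) :
    revPrefix x t = (List.ofFn fun i : Fin t => x i).reverse := by
  rw [revPrefix, ← List.map_coe_finRange_eq_range, List.map_map, List.ofFn_eq_map]
  rfl

theorem exists_eq_revPrefix (D : List ℕ) : ∃ x, D = revPrefix x D.length := by
  refine ⟨fun i => D.reverse.getD i 0, List.reverse_injective <| List.ext_getElem ?_ ?_⟩
  · simp [revPrefix]
  · intro i hi _
    simp [revPrefix, List.length_reverse .. ▸ hi]

theorem revPrefix_mem_words {x : ℕ → ℕ} {S t : ℕ} :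
    revPrefix x t ∈ words S t ↔ ∀ i < t, x i < S := by
  simp [mem_words, revPrefix]

theorem exists_extension {α : Type*} [Nonempty α] {k : ℕ} (s : Fin k → α) :
    ∃ s' : ℕ → α, (fun i : Fin k => s' i) = s :=
  ⟨Function.extend Fin.val s fun _ => Classical.arbitrary α,
    funext fun _ => Fin.val_injective.extend_apply ..⟩

namespace DetSystem

variable {M : DetSystem} {x : ℕ → ℕ} {k : ℕ}

theorem last_revPrefix (hk : 0 < k) : M.last (revPrefix x k) = x (k - 1) := by
  obtain ⟨k, rfl⟩ := Nat.exists_eq_add_of_lt hk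
  rw [revPrefix_succ]
  rfl

theorem valid_revPrefix : M.Valid (revPrefix x k) ↔
    (∀ i < k, x i < M.size ∧ (M.initial (x i) ↔ i = 0)) ∧
      ∀ i, i + 1 < k → ¬M.final (x i) ∧ M.glues (x i) (x (i + 1)) := by
  induction k with
  | zero => simp [revPrefix, Valid]
  | succ k ih =>
    rw [revPrefix_succ, Valid, ih, Nat.forall_lt_succ_right]
    rcases k with _ | k
    · simp [revPrefix, Follows]
    · have hlast : M.last (revPrefix x (k + 1)) = x k := last_revPrefix (Nat.succ_pos k)
      simp only [Nat.add_lt_add_iff_right, Nat.forall_lt_succ_right (n := k), hlast, Follows]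
      constructor
      · rintro ⟨hlt, hfollows, ⟨hini, hk⟩, hglue⟩
        have := hfollows.resolve_left fun h => hk.1.ne h.1
        exact ⟨⟨⟨hini, hk⟩, hlt, by simp [this.2.1]⟩, hglue, this.2.2⟩
      · rintro ⟨⟨⟨hini, hk⟩, hlt, hne⟩, hglue, hlast⟩
        exact ⟨hlt, Or.inr ⟨hk.1.ne, by simp [hne], hlast⟩, ⟨hini, hk⟩, hglue⟩

theorem full_revPrefix (hk : 0 < k) : M.Full (revPrefix x k) ↔
    (∀ i < k, x i < M.size) ∧ (∀ i, i + 1 < k → M.glues (x i) (x (i + 1))) ∧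
      (∀ i < k, (M.initial (x i) ↔ i = 0)) ∧ ∀ i < k, (M.final (x i) ↔ i + 1 = k) := by
  obtain ⟨k, rfl⟩ := Nat.exists_eq_add_of_lt hk
  rw [Full, last_revPrefix hk, valid_revPrefix]
  simp only [zero_add, Nat.add_sub_cancel]
  constructor
  · rintro ⟨⟨hini, hglue⟩, hfin⟩
    refine ⟨fun i hi => (hini i hi).1, fun i hi => (hglue i hi).2, fun i hi => (hini i hi).2,
      fun i hi => ⟨fun h => ?_, ?_⟩⟩
    · by_contra hik
      exact (hglue i (by omega)).1 h
    · intro h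
      rwa [Nat.succ_injective h]
  · rintro ⟨hlt, hglue, hini, hfin⟩
    refine ⟨⟨fun i hi => ⟨hlt i hi, hini i hi⟩, fun i hi => ⟨fun h => ?_, hglue i hi⟩⟩,
      (hfin k (by omega)).2 rfl⟩
    exact hi.ne ((hfin i (by omega)).1 h)

end DetSystem

section Reach

variable {A : Type*} {w k : ℕ} {D : ℕ → Layer A w} {s : ℕ → A}

/-- The states that are reached by the first `t` layers on a string. -/
def reachSet (D : ℕ → Layer A w) (s : ℕ → A) : ℕ → Set (Fin w)
  | 0 => (D 0).initialStates
  | t + 1 => {q | ∃ p ∈ reachSet D s t, (p, s t, q) ∈ (D t).transitions}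

theorem exists_path {t : ℕ} {q : Fin w} (hq : q ∈ reachSet D s t) :
    ∃ P : ℕ → Fin w, P 0 ∈ (D 0).initialStates ∧ P t = q ∧
      ∀ i < t, (P i, s i, P (i + 1)) ∈ (D i).transitions := by
  induction t generalizing q with
  | zero => exact ⟨fun _ => q, hq, rfl, by simp⟩
  | succ t ih =>
    obtain ⟨p, hp, hpq⟩ := hq
    obtain ⟨P, h0, rfl, h⟩ := ih hp
    refine ⟨Function.update P (t + 1) q, ?_, Function.update_self .., fun i hi => ?_⟩
    · rwa [Function.update_of_ne (by omega)]
    · rw [Function.update_of_ne (by omega)]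
      rcases Nat.lt_succ_iff_lt_or_eq.1 hi with hi' | rfl
      · rw [Function.update_of_ne (by omega)]
        exact h i hi'
      · rwa [Function.update_self]

theorem oddAccepts_iff (hk : 0 < k) : ODDAccepts (fun i : Fin k => D i) (fun i => s i) ↔
    ∃ q ∈ reachSet D s k, q ∈ (D (k - 1)).finalStates := by
  constructor
  · rintro ⟨p, q, hT, hpq, h0, hF⟩
    have hreach (t : ℕ) (ht : t < k) : q ⟨t, ht⟩ ∈ reachSet D s (t + 1) := by
      induction t with
      | zero => exact ⟨p ⟨0, ht⟩, h0 ⟨0, ht⟩ rfl, hT ⟨0, ht⟩⟩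
      | succ t ih =>
        refine ⟨p ⟨t + 1, ht⟩, ?_, hT ⟨t + 1, ht⟩⟩
        rw [hpq ⟨t, by omega⟩ ⟨t + 1, ht⟩ rfl]
        exact ih _
    refine ⟨q ⟨k - 1, by omega⟩, ?_, hF ⟨k - 1, by omega⟩ (Nat.sub_add_cancel hk)⟩
    simpa only [Nat.sub_add_cancel hk] using hreach (k - 1) (by omega)
  · rintro ⟨q, hq, hF⟩
    obtain ⟨P, h0, rfl, h⟩ := exists_path hq
    refine ⟨fun i => P i, fun i => P (i + 1), fun i => h i i.2, fun i j hij => by simp [hij],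
      fun i hi => ?_, fun i hi => ?_⟩
    · simpa [hi] using h0
    · simp only [hi]
      rwa [show (i : ℕ) = k - 1 by omega]

theorem DetSystem.accepts_revPrefix_iff {M : DetSystem} {x u : ℕ → ℕ} (hk : 0 < k)
    (hx : M.Valid (revPrefix x k)) (R : ℕ → ℕ → Set (Fin w) → Prop)
    (hstart : R 0 (M.start (x 0)) (reachSet D s 0))
    (hstep : ∀ t < k, ∀ X, R t X (reachSet D s t) →
      R (t + 1) (M.trans (x t) X (u t)) (reachSet D s (t + 1)))
    (haccept : ∀ X, R k X (reachSet D s k) → (M.accepting (x (k - 1)) X ↔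
      ∃ q ∈ reachSet D s k, q ∈ (D (k - 1)).finalStates)) :
    M.Accepts (revPrefix x k) (revPrefix u k) ↔ ODDAccepts (fun i : Fin k => D i) fun i => s i := by
  have hinitial := (valid_revPrefix.1 hx).1
  have hrun (t : ℕ) (ht : t < k) :
      R (t + 1) (M.run (revPrefix x (t + 1)) (revPrefix u (t + 1))) (reachSet D s (t + 1)) := by
    induction t with
    | zero =>
      rw [revPrefix_succ, revPrefix_succ, run, act, if_pos ((hinitial 0 ht).2.2 rfl)]
      exact hstep 0 ht _ hstart
    | succ t ih =>
      rw [revPrefix_succ, revPrefix_succ u, run, act,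
        if_neg (mt (hinitial (t + 1) ht).2.1 (Nat.succ_ne_zero t))]
      exact hstep (t + 1) ht _ (ih (by omega))
  rw [oddAccepts_iff hk, Accepts, last_revPrefix hk]
  refine haccept _ ?_
  simpa only [Nat.sub_add_cancel hk] using hrun (k - 1) (by omega)

end Reach

section Interpretation

variable {A : Type*} {n w k : ℕ} {ε : A ≃ Fin n} {Ls : List (Layer A w)} {e : LayerCode}
  {I : Interpretation} {x : ℕ → ℕ}

/-- The layers of the list `Ls` with the numbers `x 0, x 1, …`. -/
abbrev layersAt (Ls : List (Layer A w)) (x : ℕ → ℕ) (i : ℕ) : Layer A w := Ls.getD (x i) default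

theorem getD_mem_of_lt {i : ℕ} (hi : i < Ls.length) : Ls.getD i default ∈ Ls := by
  rw [List.getD_eq_getElem _ _ hi]
  exact List.getElem_mem _

theorem Describes.glues_iff (he : Describes ε Ls e) {i j : ℕ} (hi : i < Ls.length)
    (hj : j < Ls.length) : (I.system e).glues i j ↔
      (Ls.getD j default).leftStates = (Ls.getD i default).rightStates := by
  simp only [Interpretation.system, he.width, Set.ext_iff, ← he.left j hj, ← he.right i hi]
  exact ⟨fun h q => (h q q.2).symm, fun h q hq => (h ⟨q, hq⟩).symm⟩

theorem Describes.full_iff (he : Describes ε Ls e) (hk : 0 < k) :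
    (I.system e).Full (revPrefix x k) ↔
      (∀ i < k, x i < Ls.length) ∧ IsODD fun i : Fin k => layersAt Ls x i := by
  rw [DetSystem.full_revPrefix hk, ← he.size]
  refine and_congr_right fun hlt => ?_
  have hlt' : ∀ i < k, x i < Ls.length := he.size ▸ hlt
  refine Iff.trans (and_congr ?_ (and_congr ?_ ?_)) (and_iff_right hk).symm
  · constructor
    · intro h i j hij
      have := (he.glues_iff (hlt' i i.2) (hlt' _ (hij ▸ j.2))).1 (h i (hij ▸ j.2))
      rwa [← hij] at this
    · exact fun h i hi => (he.glues_iff (hlt' i (by omega)) (hlt' _ hi)).2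
        (h ⟨i, by omega⟩ ⟨i + 1, hi⟩ rfl)
  · rw [Fin.forall_iff]
    exact forall₂_congr fun i hi => by rw [← he.initialFlag _ (hlt' i hi)]; rfl
  · rw [Fin.forall_iff]
    exact forall₂_congr fun i hi => by rw [← he.finalFlag _ (hlt' i hi)]; rfl

/-- The codes of the symbols of a string, from right to left. -/
def revWord (ε : A ≃ Fin n) (s : Fin k → A) : List ℕ := (List.ofFn fun i => (ε (s i) : ℕ)).reverse

theorem revWord_restrict (s : ℕ → A) :
    revWord ε (fun i : Fin k => s i) = revPrefix (fun t => ε (s t)) k :=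
  (revPrefix_eq_ofFn (fun t => ε (s t)) k).symm

theorem mem_words_iff_exists_revWord {u : List ℕ} :
    u ∈ words n k ↔ ∃ s : Fin k → A, revWord ε s = u := by
  constructor
  · intro hu
    obtain ⟨x, hx⟩ := exists_eq_revPrefix u
    rw [(mem_words.1 hu).1] at hx
    rw [hx, revPrefix_mem_words] at hu
    refine ⟨fun i => ε.symm ⟨x i, hu i i.2⟩, ?_⟩
    simp [revWord, hx, revPrefix_eq_ofFn]
  · rintro ⟨s, rfl⟩
    simp +contextual [mem_words, revWord]

open Classical in
/-- The function of strings that is computed by a sequence of layers. -/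
noncomputable def DetSystem.computes (M : DetSystem) (ε : A ≃ Fin n) (k : ℕ) (D : List ℕ) :
    (Fin k → A) → Bool :=
  fun s => decide (M.Accepts D (revWord ε s))

theorem DetSystem.computes_eq_iff {M : DetSystem} {D D' : List ℕ} :
    M.computes ε k D = M.computes ε k D' ↔ ∀ u ∈ words n k, (M.Accepts D u ↔ M.Accepts D' u) := by
  simp only [computes, funext_iff, decide_eq_decide, mem_words_iff_exists_revWord (ε := ε),
    forall_exists_index, forall_apply_eq_imp_iff]

theorem Describes.computableFunctions_eq_image [Nonempty A] (he : Describes ε Ls e) (hk : 0 < k)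
    (haccepts : ∀ x, (I.system e).Full (revPrefix x k) → ∀ s : ℕ → A,
      ((I.system e).Accepts (revPrefix x k) (revPrefix (fun t => ε (s t)) k) ↔
        ODDAccepts (fun i : Fin k => layersAt Ls x i) fun i => s i)) :
    computableFunctions {B | B ∈ Ls} k =
      (I.system e).computes ε k '' {D | (I.system e).Full D ∧ D.length = k} := by
  have hcomputes (x : ℕ → ℕ) (hx : (I.system e).Full (revPrefix x k)) (s : Fin k → A) :
      (I.system e).computes ε k (revPrefix x k) s = true ↔
        ODDAccepts (fun i : Fin k => layersAt Ls x i) s := by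
    obtain ⟨s, rfl⟩ := exists_extension s
    simp only [DetSystem.computes, decide_eq_true_eq, revWord_restrict, haccepts x hx]
  ext f
  constructor
  · rintro ⟨D, hD, hmem, hf⟩
    choose y hy using fun i => List.getElem_of_mem (hmem i)
    choose hlt hy using hy
    obtain ⟨x, rfl⟩ := exists_extension y
    have hDx : D = fun i : Fin k => layersAt Ls x i :=
      funext fun i => by rw [layersAt, List.getD_eq_getElem _ _ (hlt i), hy]
    subst hDx
    have hx : (I.system e).Full (revPrefix x k) :=
      (he.full_iff hk).2 ⟨fun i hi => hlt ⟨i, hi⟩, hD⟩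
    exact ⟨_, ⟨hx, length_revPrefix x k⟩,
      funext fun s => Bool.eq_iff_iff.2 ((hcomputes x hx s).trans (hf s).symm)⟩
  · rintro ⟨D, ⟨hD, rfl⟩, rfl⟩
    obtain ⟨x, hx⟩ := exists_eq_revPrefix D
    rw [hx] at hD
    obtain ⟨hlt, hodd⟩ := (he.full_iff hk).1 hD
    refine ⟨_, hodd, fun i => getD_mem_of_lt (hlt i i.2), fun s => ?_⟩
    nth_rw 2 [hx]
    exact hcomputes x hD s

/-! ### Deterministic layers -/

theorem Layer.Deterministic.exists_initialStates_eq {B : Layer A w} (hB : B.Deterministic)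
    (h : B.initialFlag = true) : ∃ q ∈ B.leftStates, B.initialStates = {q} := by
  obtain ⟨hinitial, hcard⟩ := hB.1 h
  obtain ⟨q, hq⟩ := Set.ncard_eq_one.1 hcard
  exact ⟨q, by simp [hq], hinitial.trans hq⟩

theorem Layer.Deterministic.eq_of_mem_transitions {B : Layer A w} (hB : B.Deterministic)
    {p q q' : Fin w} {a : A} (h : (p, a, q) ∈ B.transitions) (h' : (p, a, q') ∈ B.transitions) :
    q = q' :=
  have hpq := B.transitions_subset _ _ _ h
  hB.2 p hpq.1 a q hpq.2 q' (B.transitions_subset _ _ _ h').2 h h'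

theorem sumOf_forall_testBit (P : ℕ → Prop) :
    sumOf (2 ^ w) (fun Y => ∀ q < w, (Y.testBit q ↔ P q)) = ofBitPred w P :=
  sumOf_eq (ofBitPred_lt w P) fun _ hy => (forall_testBit_iff_ofBitPred_eq hy P).trans eq_comm

namespace Describes

variable (he : Describes ε Ls e)
include he

theorem det_trans (hstates : e.states = w) {i : ℕ} (hi : i < Ls.length)
    (hdet : (Ls.getD i default).Deterministic) {p q : Fin w} {a : A}
    (h : (p, a, q) ∈ (Ls.getD i default).transitions) :
    (Interpretation.det.system e).trans i p (ε a) = q := by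
  refine sumOf_eq (hstates ▸ q.2) fun y hy => ?_
  lift y to Fin w using hstates ▸ hy
  refine (he.trans i hi p a y).trans ⟨fun h' => ?_, fun hyq => ?_⟩
  · rw [hdet.eq_of_mem_transitions h' h]
  · rwa [Fin.ext hyq]

theorem det_start (hstates : e.states = w) {i : ℕ} (hi : i < Ls.length) {q : Fin w}
    (h : (Ls.getD i default).initialStates = {q}) :
    (Interpretation.det.system e).start i = q := by
  refine sumOf_eq (hstates ▸ q.2) fun y hy => ?_
  lift y to Fin w using hstates ▸ hy
  rw [he.initial i hi, h, Set.mem_singleton_iff, Fin.ext_iff]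

theorem bounded_det (hw : 0 < w) (hstates : e.states = w)
    (hlabels : e.labels = 2 ^ (e.states * e.states.size)) (hdet : ∀ B ∈ Ls, B.Deterministic) :
    (Interpretation.det.system e).Bounded where
  states_pos := hw.trans_eq hstates.symm
  labels_eq := hlabels
  start_lt i hi hinitial := by
    have hi' : i < Ls.length := he.size ▸ hi
    obtain ⟨q, -, hq⟩ := (hdet _ (getD_mem_of_lt hi')).exists_initialStates_eq
      ((he.initialFlag i hi').1 hinitial)
    rw [he.det_start hstates hi' hq]
    exact hstates ▸ q.2
  trans_lt i hi p hp a ha := by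
    have hi' : i < Ls.length := he.size ▸ hi
    lift p to Fin w using hstates ▸ hp
    lift a to Fin n using he.symbols ▸ ha
    refine sumOf_lt (hstates ▸ hw) fun y hy z hz hyT hzT => ?_
    lift y to Fin w using hstates ▸ hy
    lift z to Fin w using hstates ▸ hz
    rw [← ε.apply_symm_apply a, he.trans i hi'] at hyT hzT
    rw [(hdet _ (getD_mem_of_lt hi')).eq_of_mem_transitions hyT hzT]

theorem accepts_det (hstates : e.states = w) (hdet : ∀ B ∈ Ls, B.Deterministic ∧ B.Complete)
    (hk : 0 < k) (hx : (Interpretation.det.system e).Full (revPrefix x k)) (s : ℕ → A) :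
    (Interpretation.det.system e).Accepts (revPrefix x k) (revPrefix (fun t => ε (s t)) k) ↔
      ODDAccepts (fun i : Fin k => layersAt Ls x i) fun i => s i := by
  obtain ⟨hlt, -, hglue, hinitial, -⟩ := (he.full_iff hk).1 hx
  have hmem (t : ℕ) (ht : t < k) := hdet _ (getD_mem_of_lt (hlt t ht))
  refine DetSystem.accepts_revPrefix_iff hk hx.1 (fun t X T => ∃ q : Fin w, X = q ∧ T = {q} ∧
    (t < k → q ∈ (layersAt Ls x t).leftStates)) ?_ ?_ ?_
  · obtain ⟨q, hq, heq⟩ := (hmem 0 hk).1.exists_initialStates_eq ((hinitial ⟨0, hk⟩).2 rfl)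
    exact ⟨q, he.det_start hstates (hlt 0 hk) heq, heq, fun _ => hq⟩
  · rintro t ht _ ⟨q, rfl, hT, hq⟩
    obtain ⟨q', hq', hqq'⟩ := (hmem t ht).2.2 q (hq ht) (s t)
    refine ⟨q', he.det_trans hstates (hlt t ht) (hmem t ht).1 hqq', ?_, fun ht' => ?_⟩
    · ext y
      simp only [reachSet, hT, Set.mem_singleton_iff, exists_eq_left, Set.mem_ofPred_eq]
      constructor
      · exact fun hy => (hmem t ht).1.eq_of_mem_transitions hy hqq'
      · rintro rfl
        exact hqq'
    · rw [hglue ⟨t, ht⟩ ⟨t + 1, ht'⟩ rfl]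
      exact hq'
  · rintro _ ⟨q, rfl, hT, -⟩
    simp only [hT, Set.mem_singleton_iff, exists_eq_left]
    exact he.final _ (hlt (k - 1) (by omega)) q

/-! ### The subset construction -/

theorem subset_start (hstates : e.states = 2 ^ w) (i : ℕ) :
    (Interpretation.subset.system e).start i = ofBitPred w (e.Initial i) := by
  simp only [Interpretation.system, Interpretation.subset, he.width, hstates]
  exact sumOf_forall_testBit _

theorem subset_trans (hstates : e.states = 2 ^ w) (i X a : ℕ) :
    (Interpretation.subset.system e).trans i X a =
      ofBitPred w fun q => ∃ p < w, X.testBit p ∧ e.Trans i p a q := by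
  simp only [Interpretation.system, Interpretation.subset, he.width, hstates]
  exact sumOf_forall_testBit _

theorem bounded_subset (hstates : e.states = 2 ^ w)
    (hlabels : e.labels = 2 ^ (e.states * e.states.size)) :
    (Interpretation.subset.system e).Bounded where
  states_pos := w.two_pow_pos.trans_eq hstates.symm
  labels_eq := hlabels
  start_lt i _ _ := by
    rw [he.subset_start hstates]
    exact (ofBitPred_lt _ _).trans_eq hstates.symm
  trans_lt i _ X _ a _ := by
    rw [he.subset_trans hstates]
    exact (ofBitPred_lt _ _).trans_eq hstates.symm

theorem accepts_subset (hstates : e.states = 2 ^ w) (hk : 0 < k)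
    (hx : (Interpretation.subset.system e).Full (revPrefix x k)) (s : ℕ → A) :
    (Interpretation.subset.system e).Accepts (revPrefix x k) (revPrefix (fun t => ε (s t)) k) ↔
      ODDAccepts (fun i : Fin k => layersAt Ls x i) fun i => s i := by
  obtain ⟨hlt, -⟩ := (he.full_iff hk).1 hx
  refine DetSystem.accepts_revPrefix_iff hk hx.1 (fun _ X T => ∀ q : Fin w, X.testBit q ↔ q ∈ T)
    (fun q => ?_) (fun t ht X hX q => ?_) fun X hX => ?_
  · rw [he.subset_start hstates, testBit_ofBitPred, and_iff_right q.2, he.initial _ (hlt 0 hk)]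
    rfl
  · rw [he.subset_trans hstates, testBit_ofBitPred, and_iff_right q.2]
    constructor
    · rintro ⟨p, hp, hpX, hpq⟩
      exact ⟨⟨p, hp⟩, (hX ⟨p, hp⟩).1 hpX, (he.trans _ (hlt t ht) ⟨p, hp⟩ (s t) q).1 hpq⟩
    · rintro ⟨p, hp, hpq⟩
      exact ⟨p, p.2, (hX p).2 hp, (he.trans _ (hlt t ht) p (s t) q).2 hpq⟩
  · change (∃ p < e.width, X.testBit p ∧ e.Final (x (k - 1)) p) ↔ _
    rw [he.width]
    constructor
    · rintro ⟨q, hq, hqX, hqF⟩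
      exact ⟨⟨q, hq⟩, (hX ⟨q, hq⟩).1 hqX, (he.final _ (hlt (k - 1) (by omega)) ⟨q, hq⟩).1 hqF⟩
    · rintro ⟨q, hq, hqF⟩
      exact ⟨q, q.2, (hX q).2 hq, (he.final _ (hlt (k - 1) (by omega)) q).2 hqF⟩

end Describes

end Interpretation

/-! ## The number of layers -/

namespace Layer

variable {A : Type*} {w : ℕ}

/-- The components of a layer, except for the transitions. -/
abbrev frame (B : Layer A w) :
    Bool × Bool × Set (Fin w) × Set (Fin w) × Set (Fin w) × Set (Fin w) :=
  (B.initialFlag, B.finalFlag, B.leftStates, B.rightStates, B.initialStates, B.finalStates)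

theorem eq_of_frame_eq {B B' : Layer A w} (h : B.frame = B'.frame)
    (hT : B.transitions = B'.transitions) : B = B' := by
  simp only [frame, Prod.mk.injEq] at h
  exact Layer.ext h.2.2.1 h.2.2.2.1 hT h.2.2.2.2.1 h.2.2.2.2.2 h.1 h.2.1

theorem injective_frame_transitions :
    Function.Injective fun B : Layer A w => (B.frame, B.transitions) :=
  fun _ _ h => eq_of_frame_eq (Prod.mk.inj h).1 (Prod.mk.inj h).2

instance [Finite A] : Finite (Layer A w) := .of_injective _ injective_frame_transitions

open Classical in
/-- The transitions as a partial function, for a deterministic layer. For other layers, some of the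
transitions are chosen. -/
noncomputable def successor (B : Layer A w) (p : Fin w) (a : A) : Option (Fin w) :=
  if h : ∃ q, (p, a, q) ∈ B.transitions then some h.choose else none

theorem Deterministic.mem_transitions_iff {B : Layer A w} (hB : B.Deterministic) {p q : Fin w}
    {a : A} : (p, a, q) ∈ B.transitions ↔ B.successor p a = some q := by
  unfold successor
  split_ifs with h
  · rw [Option.some_inj]
    exact ⟨hB.eq_of_mem_transitions h.choose_spec, fun hq => hq ▸ h.choose_spec⟩
  · exact ⟨fun hq => absurd ⟨q, hq⟩ h, nofun⟩

end Layer

section Card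

variable {A : Type*} [Fintype A] {w : ℕ} {Ls : List (Layer A w)}

theorem length_le_card_of_injOn {α β : Type*} [Fintype β] {l : List α} (hl : l.Nodup)
    {f : α → β} (hf : ∀ a ∈ l, ∀ b ∈ l, f a = f b → a = b) : l.length ≤ Fintype.card β := by
  simpa using (hl.map_on hf).length_le_card

theorem length_le_of_nodup (hLs : Ls.Nodup) :
    Ls.length ≤ 2 ^ (2 + 4 * w + w * (Fintype.card A * w)) := by
  classical
  refine (length_le_card_of_injOn hLs fun _ _ _ _ h =>
    Layer.injective_frame_transitions h).trans_eq ?_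
  simp only [Fintype.card_prod, Fintype.card_bool, Fintype.card_set, Fintype.card_fin]
  rw [pow_add, pow_add, pow_mul]
  ring

theorem length_le_of_deterministic (hLs : Ls.Nodup) (hdet : ∀ B ∈ Ls, B.Deterministic) :
    Ls.length ≤ 2 ^ (2 + 4 * w) * (w + 1) ^ (w * Fintype.card A) := by
  classical
  refine (length_le_card_of_injOn hLs (f := fun B => (B.frame, fun x : Fin w × A =>
    B.successor x.1 x.2)) fun B hB B' hB' h => ?_).trans_eq ?_
  · refine Layer.eq_of_frame_eq (Prod.mk.inj h).1 (Set.ext fun ⟨p, a, q⟩ => ?_)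
    rw [(hdet B hB).mem_transitions_iff, (hdet B' hB').mem_transitions_iff,
      congrFun (Prod.mk.inj h).2 (p, a)]
  · simp only [Fintype.card_prod, Fintype.card_bool, Fintype.card_set, Fintype.card_fin,
      Fintype.card_fun, Fintype.card_option]
    rw [pow_add, pow_mul]
    ring

end Card

/-! ## The algorithms -/

theorem layerBits_le (n w : ℕ) : layerBits n w ≤ 2 ^ (2 * w + n + 4) := by
  have hw : w ≤ 2 ^ w := Nat.lt_two_pow_self.le
  have hn : n ≤ 2 ^ n := Nat.lt_two_pow_self.le
  have hprod : w * (n * w) ≤ 2 ^ (2 * w + n) :=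
    calc w * (n * w) ≤ 2 ^ w * (2 ^ n * 2 ^ w) := Nat.mul_le_mul hw (Nat.mul_le_mul hn hw)
      _ = _ := by ring
  have hpow : 2 ^ w ≤ 2 ^ (2 * w + n) := Nat.pow_le_pow_right two_pos (by omega)
  have hone : 1 ≤ 2 ^ (2 * w + n) := Nat.one_le_two_pow
  rw [layerBits, pow_add 2 (2 * w + n) 4]
  omega

theorem mul_codeBound_le {e : LayerCode} {E : ℕ} (hE : 1 ≤ E) (hsymbols : e.symbols ≤ E)
    (hwidth : e.width ≤ E) (hlabels : e.labels ≤ 2 ^ (2 * E)) (hsize : e.size ≤ 2 ^ (8 * E))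
    (c : ℕ) : c * e.codeBound ≤ 2 ^ ((c + 320) * E) := by
  have hpow {a b : ℕ} (h : a ≤ b) : 2 ^ a ≤ 2 ^ b := Nat.pow_le_pow_right two_pos h
  have hsum : e.labels + e.size + layerBits e.symbols e.width + 2 ≤ 2 ^ (20 * E) := by
    have hbits := (layerBits_le e.symbols e.width).trans (hpow (b := 18 * E) (by omega))
    have hlabels' := hlabels.trans (hpow (b := 18 * E) (by omega))
    have hsize' := hsize.trans (hpow (b := 18 * E) (by omega))
    have htwo : 2 ^ 1 ≤ 2 ^ (18 * E) := hpow (by omega)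
    have hfour : 2 ^ (18 * E + 2) ≤ 2 ^ (20 * E) := hpow (by omega)
    rw [pow_add] at hfour
    omega
  calc c * e.codeBound ≤ 2 ^ c * (2 ^ (20 * E)) ^ 16 :=
        Nat.mul_le_mul Nat.lt_two_pow_self.le (Nat.pow_le_pow_left hsum 16)
    _ = 2 ^ (c + 320 * E) := by ring
    _ ≤ 2 ^ ((c + 320) * E) := hpow (by nlinarith)

theorem Interpretation.Computable.exists_counting_program {I : Interpretation}
    (H : I.Computable) : ∃ P c, ∀ {A : Type*} [Nonempty A] {n w : ℕ} {ε : A ≃ Fin n}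
      {Ls : List (Layer A w)} {k E : ℕ}, 0 < w → 0 < k → 1 ≤ E → n ≤ E → w ≤ E →
      I.states w * (I.states w).size ≤ 2 * E → Ls.length ≤ 2 ^ (8 * E) →
      (I.system (I.code (countingInput ε Ls k))).Bounded →
      (∀ x, (I.system (I.code (countingInput ε Ls k))).Full (revPrefix x k) → ∀ s : ℕ → A,
        ((I.system (I.code (countingInput ε Ls k))).Accepts (revPrefix x k)
            (revPrefix (fun t => ε (s t)) k) ↔
          ODDAccepts (fun i : Fin k => layersAt Ls x i) fun i => s i)) →
      RAMOutputsWithin P (countingInput ε Ls k) (computableFunctions {B | B ∈ Ls} k).ncard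
        (2 ^ 2 ^ (c * E) * k ^ 2) := by
  obtain ⟨P, c, hP⟩ := H.exists_count_program
  refine ⟨P, c + 320, fun {A} _ {n w ε Ls k E} hw hk hE hn hwE hlabels hlength hB haccepts => ?_⟩
  have hs := isCountingInput_countingInput ε Ls k hw hk
  rw [(hs.describes_code I).computableFunctions_eq_image hk haccepts]
  exact (hP _ hs hB _ fun D D' => DetSystem.computes_eq_iff ..).mono <|
    Nat.mul_le_mul_right _ <| Nat.pow_le_pow_right two_pos <|
    mul_codeBound_le hE hn hwE (Nat.pow_le_pow_right two_pos hlabels) hlength c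

theorem exists_program_nondeterministic : ∃ (P : RAMProgram) (c : ℕ), ∀ (A : Type*) [Nonempty A]
    (n : ℕ) (e : A ≃ Fin n) (w : ℕ), 0 < w → ∀ (S : Set (Layer A w)) (Ls : List (Layer A w)),
      Ls.Nodup → (∀ B, B ∈ Ls ↔ B ∈ S) → ∀ k : ℕ, 0 < k →
        RAMOutputsWithin P (countingInput e Ls k) (computableFunctions S k).ncard
          (2 ^ 2 ^ (c * (n * w * 2 ^ w)) * k ^ 2) := by
  obtain ⟨P, c, hP⟩ := Interpretation.computable_subset.exists_counting_program
  refine ⟨P, c, fun A _ n ε w hw S Ls hLs hS k hk => ?_⟩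
  obtain rfl : S = {B | B ∈ Ls} := Set.ext fun B => (hS B).symm
  have he := (isCountingInput_countingInput ε Ls k hw hk).describes_code .subset
  have hn : 0 < n := Fin.pos (ε (Classical.arbitrary A))
  have : Fintype A := .ofEquiv _ ε.symm
  have hw2 : w < 2 ^ w := Nat.lt_two_pow_self
  have hnw : n * w ≤ n * w * 2 ^ w := Nat.le_mul_of_pos_right _ (by positivity)
  have hwn : w ≤ n * w := Nat.le_mul_of_pos_left _ hn
  have hnn : n ≤ n * w := Nat.le_mul_of_pos_right _ hw
  refine hP hw hk (by nlinarith) (by omega) (by omega) ?_ ?_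
    (he.bounded_subset rfl rfl) fun x hx s => he.accepts_subset rfl hk hx s
  · have hsize : (2 ^ w).size = w + 1 := Nat.size_pow
    change 2 ^ w * (2 ^ w).size ≤ _
    rw [hsize]
    nlinarith
  · have hcard : Fintype.card A = n := by rw [Fintype.card_congr ε, Fintype.card_fin]
    refine (length_le_of_nodup hLs).trans (Nat.pow_le_pow_right two_pos ?_)
    rw [hcard]
    nlinarith

theorem exists_program_deterministic : ∃ (P : RAMProgram) (c : ℕ), ∀ (A : Type*) [Nonempty A]
    (n : ℕ) (e : A ≃ Fin n) (w : ℕ), 0 < w → ∀ (S : Set (Layer A w)) (Ls : List (Layer A w)),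
      Ls.Nodup → (∀ B, B ∈ Ls ↔ B ∈ S) → (∀ B ∈ S, B.Deterministic ∧ B.Complete) →
      ∀ k : ℕ, 0 < k →
        RAMOutputsWithin P (countingInput e Ls k) (computableFunctions S k).ncard
          (2 ^ 2 ^ (c * (n * w * Nat.log 2 (w + 1))) * k ^ 2) := by
  obtain ⟨P, c, hP⟩ := Interpretation.computable_det.exists_counting_program
  refine ⟨P, c, fun A _ n ε w hw S Ls hLs hS hdet k hk => ?_⟩
  obtain rfl : S = {B | B ∈ Ls} := Set.ext fun B => (hS B).symm
  have he := (isCountingInput_countingInput ε Ls k hw hk).describes_code .det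
  have hn : 0 < n := Fin.pos (ε (Classical.arbitrary A))
  have : Fintype A := .ofEquiv _ ε.symm
  set g := Nat.log 2 (w + 1)
  have hg : 1 ≤ g := Nat.log_pos one_lt_two (by omega)
  have hwg : w + 1 < 2 ^ (g + 1) := Nat.lt_pow_succ_log_self one_lt_two _
  have hnw : n * w ≤ n * w * g := Nat.le_mul_of_pos_right _ hg
  have hwn : w ≤ n * w := Nat.le_mul_of_pos_left _ hn
  have hnn : n ≤ n * w := Nat.le_mul_of_pos_right _ hw
  refine hP hw hk (by nlinarith) (by omega) (by omega) ?_ ?_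
    (he.bounded_det hw rfl rfl fun B hB => (hdet B hB).1)
    fun x hx s => he.accepts_det rfl hdet hk hx s
  · have hsize : w.size ≤ g + 1 := Nat.size_le.2 (by omega)
    calc w * w.size ≤ w * (g + 1) := Nat.mul_le_mul_left _ hsize
      _ ≤ 2 * (n * w * g) := by nlinarith
  · have hcard : Fintype.card A = n := by rw [Fintype.card_congr ε, Fintype.card_fin]
    calc Ls.length ≤ 2 ^ (2 + 4 * w) * (w + 1) ^ (w * n) :=
          hcard ▸ length_le_of_deterministic hLs fun B hB => (hdet B hB).1
      _ ≤ 2 ^ (2 + 4 * w) * (2 ^ (g + 1)) ^ (w * n) :=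
          Nat.mul_le_mul_left _ (Nat.pow_le_pow_left hwg.le _)
      _ = 2 ^ (2 + 4 * w + (g + 1) * (w * n)) := by rw [← pow_mul, ← pow_add]
      _ ≤ 2 ^ (8 * (n * w * g)) := Nat.pow_le_pow_right two_pos (by nlinarith)

/-! ## Fixed sets of layers -/

theorem overwrite_cons (m : ℕ → ℕ) (v : ℕ) (l : List ℕ) (b : ℕ) :
    overwrite m b (v :: l).length (fun y => (v :: l).getD y 0) =
      overwrite (Function.update m b v) (b + 1) l.length fun y => l.getD y 0 := by
  funext a
  obtain h | rfl | h := lt_trichotomy a b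
  · simp [overwrite, h.not_ge, h.ne, (h.trans (Nat.lt_succ_self b)).not_ge]
  · simp [overwrite]
  · obtain ⟨d, rfl⟩ := Nat.exists_eq_add_of_le' (Nat.succ_le_of_lt h)
    have hsub : d + b.succ - b = d + 1 := by omega
    have hne : d + (b + 1) ≠ b := by omega
    have hlt : b ≤ d + (b + 1) ∧ d + (b + 1) < b + (l.length + 1) ↔
      d + (b + 1) < b + 1 + l.length := by omega
    simp [overwrite, hsub, hne, hlt]

theorem exists_write_program (l : List ℕ) (b : ℕ) : ∃ P T, ∀ s, RunsIn P s T
    ⟨fun j => if j = 4 ∨ j = 5 then 0 else s.reg j,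
      overwrite s.mem b l.length fun y => l.getD y 0⟩ := by
  induction l generalizing b with
  | nil =>
    refine ⟨.seq (.const 4 0) (.const 5 0), (1 + Nat.size 0) + (1 + Nat.size 0), fun s => ?_⟩
    convert (RunsIn.const 4 0 s).seq (RunsIn.const 5 0 _) using 1
    refine congrArg₂ RAMState.mk (funext fun j => ?_) (funext fun a => ?_)
    · by_cases h4 : j = 4 <;> by_cases h5 : j = 5 <;> simp [h4, h5]
    · exact if_neg (by simp)
  | cons v l ih =>
    obtain ⟨P, T, h⟩ := ih (b + 1)
    refine ⟨.seq (.const 4 b) (.seq (.const 5 v) (.seq (.store 4 5) P)),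
      (1 + b.size) + ((1 + v.size) + ((1 + b.size + v.size) + T)), fun s => ?_⟩
    have hstore : RunsIn (.store 4 5) ((s.setReg 4 b).setReg 5 v) (1 + b.size + v.size)
        (((s.setReg 4 b).setReg 5 v).setMem b v) := by
      simpa using RunsIn.store 4 5 ((s.setReg 4 b).setReg 5 v)
    convert (RunsIn.const 4 b s).seq ((RunsIn.const 5 v _).seq (hstore.seq (h _))) using 1
    refine congrArg₂ RAMState.mk (funext fun j => ?_) (funext fun a => ?_)
    · by_cases h4 : j = 4 <;> by_cases h5 : j = 5 <;> simp [h4, h5]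
    · exact congrFun (overwrite_cons s.mem v l b) a

/-- The state after the registers of `numberInput k` have been set for `countingInput`. -/
def fixedInput (n w m k : ℕ) : RAMState :=
  ((((numberInput k).setReg 2 k).setReg 0 n).setReg 1 w).setReg 3 m

theorem countingInput_eq_overwrite {A : Type*} {n w : ℕ} (ε : A ≃ Fin n) (Ls : List (Layer A w))
    (k : ℕ) : countingInput ε Ls k =
      ⟨fun j => if j = 4 ∨ j = 5 then 0 else (fixedInput n w Ls.length k).reg j,
        overwrite (fixedInput n w Ls.length k).mem 0 (Ls.flatMap (Layer.encode ε)).length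
          fun y => (Ls.flatMap (Layer.encode ε)).getD y 0⟩ := by
  refine congrArg₂ RAMState.mk (funext fun j => ?_) (funext fun a => ?_)
  · match j with
    | 0 | 1 | 2 | 3 | 4 | 5 => simp [fixedInput, numberInput]
    | j + 6 => simp [fixedInput, numberInput]
  · by_cases ha : a < (Ls.flatMap (Layer.encode ε)).length
    · simp only [overwrite, zero_add, Nat.zero_le, true_and, if_pos ha]
      rfl
    · rw [overwrite_apply_of_le (by omega)]
      exact List.getD_eq_default _ _ (not_lt.1 ha)

theorem exists_prepare_fixed_program {A : Type*} {n w : ℕ} (ε : A ≃ Fin n)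
    (Ls : List (Layer A w)) :
    ∃ P C, ∀ k, 0 < k → RunsIn P (numberInput k) (C * k) (countingInput ε Ls k) := by
  obtain ⟨P, T, hP⟩ := exists_write_program (Ls.flatMap (Layer.encode ε)) 0
  refine ⟨.seq (.copy 2 0) (.seq (.const 0 n) (.seq (.const 1 w) (.seq (.const 3 Ls.length) P))),
    n.size + w.size + Ls.length.size + T + 5, fun k hk => ?_⟩
  rw [countingInput_eq_overwrite]
  refine ((RunsIn.copy 2 0 (numberInput k)).seq ((RunsIn.const 0 n _).seq
    ((RunsIn.const 1 w _).seq ((RunsIn.const 3 Ls.length _).seq (hP _))))).mono ?_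
  have hsize : ((numberInput k).reg 0).size ≤ k := Nat.size_le.2 Nat.lt_two_pow_self
  nlinarith [Nat.le_mul_of_pos_right (n.size + w.size + Ls.length.size + T + 4) hk]

theorem exists_program_of_fixed {A : Type*} [Nonempty A] [Finite A] {w : ℕ} (hw : 0 < w)
    (S : Set (Layer A w)) : ∃ (P : RAMProgram) (C : ℕ), ∀ k : ℕ, 0 < k →
      RAMOutputsWithin P (numberInput k) (computableFunctions S k).ncard (C * k ^ 2) := by
  obtain ⟨n, ⟨ε⟩⟩ := Finite.exists_equiv_fin A
  obtain ⟨P, c, hP⟩ := exists_program_nondeterministic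
  set Ls := S.toFinite.toFinset.toList
  obtain ⟨Q, C, hQ⟩ := exists_prepare_fixed_program ε Ls
  refine ⟨.seq Q P, C + 2 ^ 2 ^ (c * (n * w * 2 ^ w)), fun k hk => ?_⟩
  have hcount := hP A n ε w hw S Ls (Finset.nodup_toList _) (fun B => by simp [Ls]) k hk
  refine ((hQ k hk).outputsWithin_seq hcount).mono ?_
  rw [add_mul]
  exact Nat.add_le_add_right (Nat.mul_le_mul_left _ (Nat.le_self_pow two_ne_zero k)) _

/-- Counting the functions computed by ODDs over a given set of layers. In the first two parts, one
program serves all alphabets, widths, sets of layers and lengths, and the set `S` is given by a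
list `Ls` of its elements without repetitions. In the second part, `Nat.log 2 (w + 1)` is
`⌊log₂ (w + 1)⌋`, which is positive also for `w = 1`. The last part is about the ODDs (and the
deterministic, complete ODDs) of width at most `w` over a fixed alphabet. -/
theorem corollary5p8 :
    (∃ (P : RAMProgram) (c : ℕ), ∀ (A : Type u) [Nonempty A] (n : ℕ) (e : A ≃ Fin n) (w : ℕ),
      0 < w → ∀ (S : Set (Layer A w)) (Ls : List (Layer A w)), Ls.Nodup → (∀ B, B ∈ Ls ↔ B ∈ S) →
        ∀ k : ℕ, 0 < k →
          RAMOutputsWithin P (countingInput e Ls k) (computableFunctions S k).ncard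
            (2 ^ 2 ^ (c * (n * w * 2 ^ w)) * k ^ 2)) ∧
    (∃ (P : RAMProgram) (c : ℕ), ∀ (A : Type u) [Nonempty A] (n : ℕ) (e : A ≃ Fin n) (w : ℕ),
      0 < w → ∀ (S : Set (Layer A w)) (Ls : List (Layer A w)), Ls.Nodup → (∀ B, B ∈ Ls ↔ B ∈ S) →
        (∀ B ∈ S, B.Deterministic ∧ B.Complete) →
        ∀ k : ℕ, 0 < k →
          RAMOutputsWithin P (countingInput e Ls k) (computableFunctions S k).ncard
            (2 ^ 2 ^ (c * (n * w * Nat.log 2 (w + 1))) * k ^ 2)) ∧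
    (∀ (A : Type u) [Nonempty A] [Finite A] (w : ℕ), 0 < w →
      (∃ (P : RAMProgram) (C : ℕ), ∀ k : ℕ, 0 < k →
        RAMOutputsWithin P (numberInput k)
          (computableFunctions (Set.univ : Set (Layer A w)) k).ncard (C * k ^ 2)) ∧
      (∃ (P : RAMProgram) (C : ℕ), ∀ k : ℕ, 0 < k →
        RAMOutputsWithin P (numberInput k)
          (computableFunctions {B : Layer A w | B.Deterministic ∧ B.Complete} k).ncard
          (C * k ^ 2))) :=
  ⟨exists_program_nondeterministic, exists_program_deterministic, fun _ _ _ _ hw =>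
    ⟨exists_program_of_fixed hw _, exists_program_of_fixed hw _⟩⟩
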